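/- Let $k$ be an algebraically closed field of characteristic zero and let $X\subset\mathbb P^4$ be a cubic threefold over $k$ with exactly six singular points, not all of them of type $\mathsf A_1$. Let $\mathrm{Aut}(X)\subset \mathrm{PGL}_5(k)$ be the automorphism group of $X$, i.e. the group of projective transformations of $\mathbb P^4$ mapping $X$ onto itself. Then: 1. The $\mathrm{Aut}(X)$-action on $X$ is linearizable: there are a finite-dimensional linear representation $V$ of $\mathrm{Aut}(X)$ over $k$ and an $\mathrm{Aut}(X)$-equivariant birational map $X\dashrightarrow\mathbb P(V)$. 2. If $\mathrm{Aut}(X)$ fixes no singular point of $X$, then the singularity type of $X$ is $2\mathsf A_2+4\mathsf A_1$ or $2\mathsf A_3+4\mathsf A_1$. 3. If the singularity type of $X$ is $2\mathsf A_2+4\mathsf A_1$ or $2\mathsf A_3+4\mathsf A_1$, then the four $\mathsf A_1$-points span a plane $\Pi\subset X$, the two remaining singular points span a line $l\subset X$, both $\Pi$ and $l$ are $\mathrm{Aut}(X)$-invariant, and $\Pi\cap l=\varnothing$. -/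

import Mathlib

open scoped LinearAlgebra.Projectivization MatrixGroups Pointwise

namespace CubicThreefold

/-- The projective space `ℙⁿ` over `k`, as the set of lines through the origin of `kⁿ⁺¹`. The group
`PGL(Fin (n + 1), k)` acts on it. -/
abbrev ProjSpace (k : Type*) [Field k] (n : ℕ) : Type _ := ℙ k (Fin (n + 1) → k)

/-- The hypersurface `{f = 0} ⊆ ℙⁿ` of a homogeneous polynomial `f`. (Whether `f` vanishes at a
vector does not change when the vector is rescaled.) -/
def hypersurface {k : Type*} [Field k] {n : ℕ} (f : MvPolynomial (Fin (n + 1)) k) :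
    Set (ProjSpace k n) :=
  {p | MvPolynomial.eval p.rep f = 0}

/-- The singular points of the hypersurface `{f = 0}`: the points of it at which all partial
derivatives of `f` vanish. -/
def singularPoints {k : Type*} [Field k] {n : ℕ} (f : MvPolynomial (Fin (n + 1)) k) :
    Set (ProjSpace k n) :=
  {p | p ∈ hypersurface f ∧ ∀ i, MvPolynomial.eval p.rep (MvPolynomial.pderiv i f) = 0}

/-- The group `Aut(X)` of the hypersurface `X = {f = 0} ⊆ ℙⁿ`: all projective transformations of
`ℙⁿ` that map `X` onto itself. (For a cubic threefold with isolated singularities every automorphism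
of the variety `X` is the restriction of exactly one of these.) -/
def aut {k : Type*} [Field k] {n : ℕ} (f : MvPolynomial (Fin (n + 1)) k) :
    Subgroup PGL(Fin (n + 1), k) :=
  MulAction.stabilizer PGL(Fin (n + 1), k) (hypersurface f)

/-! ### Singularities of type `A_m` on a threefold in `ℙ⁴` -/

/-- The point `[1 : 0 : ⋯ : 0]`. -/
def basePoint (k : Type*) [Field k] (n : ℕ) : ProjSpace k n :=
  Projectivization.mk k (Pi.single 0 1) (by simp)

/-- The affine equation `g(y₁, …, yₙ) = f(A (1, y₁, …, yₙ))` of the hypersurface `{f = 0}` in the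
affine chart centred at the point `A • [1 : 0 : ⋯ : 0]`. -/
noncomputable def localEquation {k : Type*} [Field k] {n : ℕ} (f : MvPolynomial (Fin (n + 1)) k)
    (A : GL (Fin (n + 1)) k) : MvPolynomial (Fin n) k :=
  MvPolynomial.aeval
    (fun i => MvPolynomial.C (A i 0) + ∑ j : Fin n, MvPolynomial.C (A i j.succ) * MvPolynomial.X j)
    f

/-- The equation `y₁² + y₂² + y₃² + y₄^(m+1)` of the three-dimensional `A_m` singularity. -/
noncomputable def normalFormA (k : Type*) [Field k] (m : ℕ) : MvPolynomial (Fin 4) k :=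
  MvPolynomial.X 0 ^ 2 + MvPolynomial.X 1 ^ 2 + MvPolynomial.X 2 ^ 2 + MvPolynomial.X 3 ^ (m + 1)

/-- The threefold `{f = 0} ⊆ ℙ⁴` has a singularity of type `A_m` at `p`: in suitable formal
coordinates at `p` its local equation is `y₁² + y₂² + y₃² + y₄^(m+1)` up to a unit. A formal change
of coordinates is an automorphism of the `k`-algebra `k⟦y₁, y₂, y₃, y₄⟧`. -/
def IsTypeA {k : Type*} [Field k] (f : MvPolynomial (Fin 5) k) (m : ℕ) (p : ProjSpace k 4) : Prop :=
  ∃ A : GL (Fin 5) k, A • basePoint k 4 = p ∧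
    ∃ θ : MvPowerSeries (Fin 4) k ≃ₐ[k] MvPowerSeries (Fin 4) k,
      Associated (θ (localEquation f A : MvPowerSeries (Fin 4) k))
        (normalFormA k m : MvPowerSeries (Fin 4) k)

/-- The nodes (that is, the `A₁`-points) of `{f = 0} ⊆ ℙ⁴`. -/
def nodes {k : Type*} [Field k] (f : MvPolynomial (Fin 5) k) : Set (ProjSpace k 4) :=
  {p | p ∈ singularPoints f ∧ IsTypeA f 1 p}

/-- The singular points of `{f = 0} ⊆ ℙ⁴` that are not nodes. -/
def nonNodes {k : Type*} [Field k] (f : MvPolynomial (Fin 5) k) : Set (ProjSpace k 4) :=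
  {p | p ∈ singularPoints f ∧ ¬ IsTypeA f 1 p}

/-- For `m ≥ 2`: the singularity type of `{f = 0} ⊆ ℙ⁴` is `2A_m + 4A_1`, i.e. it has exactly six
singular points, four of type `A₁` and two of type `A_m`. -/
def HasType2Am4A1 {k : Type*} [Field k] (f : MvPolynomial (Fin 5) k) (m : ℕ) : Prop :=
  (singularPoints f).ncard = 6 ∧ (nodes f).ncard = 4 ∧
    {p | p ∈ singularPoints f ∧ IsTypeA f m p}.ncard = 2

/-! ### Linear subspaces of projective space -/

/-- The linear span of a set of points of `ℙⁿ`, as a subspace of `kⁿ⁺¹`. -/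
def linearSpan {k : Type*} [Field k] {n : ℕ} (S : Set (ProjSpace k n)) :
    Submodule k (Fin (n + 1) → k) :=
  ⨆ p ∈ S, p.submodule

/-- The points of `ℙⁿ` in the linear subspace `ℙ(W)`; it is a plane if `dim W = 3` and a line if
`dim W = 2`. -/
def projSubspace {k : Type*} [Field k] {n : ℕ} (W : Submodule k (Fin (n + 1) → k)) :
    Set (ProjSpace k n) :=
  {p | p.submodule ≤ W}

/-! ### Rational maps and linearizability -/

/-- A representative of a rational map `ℙⁿ ⇢ ℙᵐ`, or of one defined on a subvariety of `ℙⁿ`: a tuple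
`(F₀, …, F_m)` of homogeneous polynomials of the same degree. -/
structure RatMap (k : Type*) [Field k] (n m : ℕ) where
  degree : ℕ
  coord : Fin (m + 1) → MvPolynomial (Fin (n + 1)) k
  isHomogeneous : ∀ i, (coord i).IsHomogeneous degree

/-- `F.Maps p q`: the coordinates of `F` do not all vanish at `p`, and
`q = [F₀(p) : ⋯ : F_m(p)]`. -/
def RatMap.Maps {k : Type*} [Field k] {n m : ℕ} (F : RatMap k n m) (p : ProjSpace k n)
    (q : ProjSpace k m) : Prop :=
  ∃ h : (fun i => MvPolynomial.eval p.rep (F.coord i)) ≠ 0, Projectivization.mk k _ h = q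

/-- For an irreducible closed subvariety `X ⊆ ℙⁿ`: the rational maps `F : X ⇢ ℙᵐ` and
`H : ℙᵐ ⇢ X` are mutually inverse birational maps. The first condition says that the composites are
defined on a nonempty (hence dense) open set. -/
def AreInverseBirational {k : Type*} [Field k] {n m : ℕ} (X : Set (ProjSpace k n))
    (F : RatMap k n m) (H : RatMap k m n) : Prop :=
  (∃ p ∈ X, ∃ q, F.Maps p q ∧ H.Maps q p) ∧
  (∀ q p, H.Maps q p → p ∈ X) ∧
  (∀ p ∈ X, ∀ q p', F.Maps p q → H.Maps q p' → p' = p) ∧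
  (∀ q p q', H.Maps q p → F.Maps p q' → q' = q)

/-- The action on an irreducible closed subvariety `X ⊆ ℙⁿ` of a group `G` of projective
transformations that preserve `X` is linearizable: there are a linear representation `ρ` of `G` on
`V = kᵐ⁺¹` and a `G`-equivariant birational map `X ⇢ ℙ(V)`. -/
def IsLinearizable {k : Type*} [Field k] {n : ℕ} (X : Set (ProjSpace k n))
    (G : Subgroup PGL(Fin (n + 1), k)) : Prop :=
  ∃ (m : ℕ) (ρ : G →* GL (Fin (m + 1)) k) (F : RatMap k n m) (H : RatMap k m n),
    AreInverseBirational X F H ∧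
    ∀ g : G, ∀ p ∈ X, ∀ q q', F.Maps p q → F.Maps (g • p) q' → q' = ρ g • q

end CubicThreefold

open CubicThreefold

set_option linter.unusedSectionVars false
set_option linter.unusedSimpArgs false

namespace CubicThreefold

open Module

section Trilinear

variable {k V : Type*} [Field k] [AddCommGroup V] [Module k V]

/-- A symmetric trilinear form. -/
structure IsSymmTrilinear (T : V →ₗ[k] V →ₗ[k] V →ₗ[k] k) : Prop where
  swap_left : ∀ x y, T x y = T y x
  swap_right : ∀ x y z, T x y z = T x z y

/-- The tangent cone of the cubic at the singular vector `v` is degenerate. -/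
def IsDegenerateAt (T : V →ₗ[k] V →ₗ[k] V →ₗ[k] k) (v : V) : Prop :=
  ∃ u, u ∉ Submodule.span k {v} ∧ T v u = 0

/-- The vectors `v 0, …, v 5` represent the singular points of the cubic `T x x x`, without
repetition. -/
structure IsSixSingular (T : V →ₗ[k] V →ₗ[k] V →ₗ[k] k) (v : Fin 6 → V) : Prop where
  symm : IsSymmTrilinear T
  sing : ∀ i, T (v i) (v i) = 0
  indep : ∀ i j, i ≠ j → LinearIndependent k ![v i, v j]
  all : ∀ x, T x x = 0 → ∃ i, x ∈ Submodule.span k {v i}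

theorem exists_quadratic_zero [IsAlgClosed k] [CharZero k] (a b c : k) :
    ∃ s t : k, (s ≠ 0 ∨ t ≠ 0) ∧ a * s ^ 2 + b * (s * t) + c * t ^ 2 = 0 := by
  by_cases ha : a = 0
  · exact ⟨1, 0, Or.inl one_ne_zero, by simp [ha]⟩
  · obtain ⟨d, hd⟩ := IsAlgClosed.exists_pow_nat_eq (b ^ 2 - 4 * a * c) (n := 2) (by norm_num)
    refine ⟨(d - b) / (2 * a), 1, Or.inr one_ne_zero, ?_⟩
    field_simp
    linear_combination hd

theorem linearIndependent_triple_iff {a b c : V} : LinearIndependent k ![a, b, c] ↔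
    ∀ r s t : k, r • a + s • b + t • c = 0 → r = 0 ∧ s = 0 ∧ t = 0 := by
  rw [Fintype.linearIndependent_iff]
  constructor
  · intro h r s t hr
    have := h ![r, s, t] (by simpa [Fin.sum_univ_three] using hr)
    exact ⟨this 0, this 1, this 2⟩
  · intro h g hg i
    have := h (g 0) (g 1) (g 2) (by simpa [Fin.sum_univ_three] using hg)
    fin_cases i
    exacts [this.1, this.2.1, this.2.2]

namespace IsSixSingular

variable {T : V →ₗ[k] V →ₗ[k] V →ₗ[k] k} {v : Fin 6 → V}

theorem ne_zero (h : IsSixSingular T v) (i : Fin 6) : v i ≠ 0 := by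
  obtain ⟨j, hj⟩ : ∃ j : Fin 6, i ≠ j := ⟨i + 1, by fin_cases i <;> decide⟩
  exact (h.indep i j hj).ne_zero 0

theorem comp_perm (h : IsSixSingular T v) (σ : Equiv.Perm (Fin 6)) :
    IsSixSingular T (v ∘ σ) where
  symm := h.symm
  sing i := h.sing _
  indep i j hij := h.indep _ _ (σ.injective.ne hij)
  all x hx := by
    obtain ⟨i, hi⟩ := h.all x hx
    exact ⟨σ.symm i, by simpa using hi⟩

/-- A form that vanishes at none of the singular points. -/
theorem exists_form [CharZero k] (h : IsSixSingular T v) :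
    ∃ M : Dual k V, ∀ x, T x x = 0 → M x = 0 → x = 0 := by
  obtain ⟨M, hM⟩ := Module.exists_dual_forall_apply_ne_zero (K := k) v h.ne_zero
  refine ⟨M, fun x hx hMx => ?_⟩
  obtain ⟨i, hi⟩ := h.all x hx
  obtain ⟨c, rfl⟩ := Submodule.mem_span_singleton.1 hi
  have : c = 0 := by simpa [hM i] using hMx
  simp [this]

theorem not_gradient_mem [IsAlgClosed k] [CharZero k] [FiniteDimensional k V]
    (h : IsSixSingular T v) (U : Submodule k V) (hU : 3 ≤ finrank k U) (l : Dual k V)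
    (hl : ∀ x ∈ U, ∃ c : k, T x x = c • l) : False := by
  obtain ⟨M, hM⟩ := h.exists_form
  have hker : 1 < finrank k (LinearMap.ker (M ∘ₗ U.subtype)) := by
    have h1 := LinearMap.finrank_range_add_finrank_ker (M ∘ₗ U.subtype)
    have h2 : finrank k (LinearMap.range (M ∘ₗ U.subtype)) ≤ 1 := by
      simpa using Submodule.finrank_le (LinearMap.range (M ∘ₗ U.subtype))
    omega
  have : Nontrivial (LinearMap.ker (M ∘ₗ U.subtype)) :=
    Module.nontrivial_of_finrank_pos (R := k) (by omega)
  obtain ⟨e, he⟩ := exists_ne (0 : LinearMap.ker (M ∘ₗ U.subtype))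
  obtain ⟨f, hf⟩ := exists_linearIndependent_pair_of_one_lt_finrank hker he
  have hMe : M (e : U) = 0 := e.2
  have hMf : M (f : U) = 0 := f.2
  obtain ⟨a, ha⟩ := hl _ (e : U).2
  obtain ⟨c, hc⟩ := hl _ (f : U).2
  obtain ⟨d, hd⟩ := hl _ (e + f : U).2
  obtain ⟨s, t, hst, h0⟩ := exists_quadratic_zero a (d - a - c) c
  have hx : T ((s • e + t • f : U) : V) ((s • e + t • f : U) : V) = 0 := by
    simp only [Submodule.coe_add, Submodule.coe_smul, map_add, map_smul, LinearMap.add_apply,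
      LinearMap.smul_apply] at hd ⊢
    rw [h.symm.swap_left (f : U) (e : U)] at hd ⊢
    have key : (2 : k) • T (e : U) (f : U) = (d - a - c) • l := by
      rw [ha, hc] at hd
      have h2 : (2 : k) • T (e : U) (f : U) = (a • l + T (e : U) (f : U) +
        (T (e : U) (f : U) + c • l)) - a • l - c • l := by module
      rw [h2, hd]
      module
    rw [ha, hc]
    have := congrArg (fun z => (s * t) • z) key
    simp only [smul_smul] at this
    calc _ = (a * s ^ 2 + c * t ^ 2) • l + (s * t * 2) • T (e : U) (f : U) := by module
      _ = (a * s ^ 2 + (d - a - c) * (s * t) + c * t ^ 2) • l := by rw [this]; module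
      _ = 0 := by rw [h0, zero_smul]
  have hz := hM _ hx (by simp [hMe, hMf])
  have hz' : s • e + t • f = 0 := by
    apply Subtype.ext; apply Subtype.ext; simpa using hz
  have := LinearIndependent.pair_iff.1 hf s t hz'
  tauto

theorem finrank_span_triple {a b c : V} (h : LinearIndependent k ![a, b, c]) :
    finrank k (Submodule.span k {a, b, c}) = 3 := by
  have := finrank_span_eq_card h
  rwa [Matrix.range_cons, Matrix.range_cons, Matrix.range_cons, Matrix.range_empty,
    Set.union_empty, Set.singleton_union, Set.singleton_union] at this

theorem not_gradient_mem_triple [IsAlgClosed k] [CharZero k] [FiniteDimensional k V]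
    (h : IsSixSingular T v) {a b c : V} (hi : LinearIndependent k ![a, b, c]) (l : Dual k V)
    (haa : ∃ m : k, T a a = m • l) (hbb : ∃ m : k, T b b = m • l) (hcc : ∃ m : k, T c c = m • l)
    (hab : ∃ m : k, T a b = m • l) (hac : ∃ m : k, T a c = m • l) (hbc : ∃ m : k, T b c = m • l) :
    False := by
  refine h.not_gradient_mem (Submodule.span k {a, b, c}) (finrank_span_triple hi).ge l ?_
  intro x hx
  obtain ⟨r, s, t, rfl⟩ := Submodule.mem_span_triple.1 hx
  obtain ⟨m1, h1⟩ := haa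
  obtain ⟨m2, h2⟩ := hbb
  obtain ⟨m3, h3⟩ := hcc
  obtain ⟨m4, h4⟩ := hab
  obtain ⟨m5, h5⟩ := hac
  obtain ⟨m6, h6⟩ := hbc
  refine ⟨r * r * m1 + s * s * m2 + t * t * m3 + 2 * (r * s * m4 + r * t * m5 + s * t * m6), ?_⟩
  simp only [map_add, map_smul, LinearMap.add_apply, LinearMap.smul_apply, h.symm.swap_left b a,
    h.symm.swap_left c a, h.symm.swap_left c b, h1, h2, h3, h4, h5, h6]
  module

theorem apply_ne_zero [CharZero k] [FiniteDimensional k V]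
    (h : IsSixSingular T v) {i j : Fin 6} (hij : i ≠ j) : T (v i) (v j) ≠ 0 := by
  intro h0
  obtain ⟨M, hM⟩ := h.exists_form
  have hx := hM (M (v j) • v i - M (v i) • v j) (by
    simp [h.sing, h0, h.symm.swap_left (v j) (v i)]) (by simp [mul_comm])
  have h1 := LinearIndependent.pair_iff.1 (h.indep i j hij) (M (v j)) (-M (v i)) (by
    rw [← hx]; module)
  exact h.ne_zero j (hM _ (h.sing j) h1.1)

/-- No three of the singular points are collinear. -/
theorem linearIndependent_triple [CharZero k] [FiniteDimensional k V]
    (h : IsSixSingular T v) {i j l : Fin 6} (hij : i ≠ j) (hil : i ≠ l) (hjl : j ≠ l) :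
    LinearIndependent k ![v i, v j, v l] := by
  rw [linearIndependent_triple_iff]
  intro r s t hr
  have h1 : T (r • v i + s • v j) (r • v i + s • v j) = 0 := by
    rw [eq_neg_of_add_eq_zero_left hr]
    simp [h.sing]
  simp only [map_add, map_smul, LinearMap.add_apply, LinearMap.smul_apply, h.sing, smul_zero,
    zero_add, add_zero, h.symm.swap_left (v j) (v i)] at h1
  have h2 : (2 * r * s) • T (v i) (v j) = 0 := by rw [← h1]; module
  have h3 := (smul_eq_zero.1 h2).resolve_right (h.apply_ne_zero hij)
  rcases mul_eq_zero.1 h3 with h4 | h4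
  · have hr0 : r = 0 := by simpa using h4
    have := LinearIndependent.pair_iff.1 (h.indep j l hjl) s t (by rw [← hr, hr0]; module)
    exact ⟨hr0, this⟩
  · have := LinearIndependent.pair_iff.1 (h.indep i l hil) r t (by rw [← hr, h4]; module)
    exact ⟨this.1, h4, this.2⟩

/-! ### Two degenerate singular points -/

theorem linearIndependent_of_degenerate [CharZero k] [FiniteDimensional k V]
    (h : IsSixSingular T v) {i j : Fin 6} (hij : i ≠ j) {u : V}
    (hu : u ∉ Submodule.span k {v i}) (hTu : T (v i) u = 0) :
    LinearIndependent k ![v i, v j, u] := by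
  rw [linearIndependent_triple_iff]
  intro r s t hr
  have h1 := congrArg (T (v i)) hr
  simp only [map_add, map_smul, h.sing, hTu, smul_zero, zero_add, add_zero, map_zero] at h1
  have hs := (smul_eq_zero.1 h1).resolve_right (h.apply_ne_zero hij)
  have ht : t = 0 := by
    by_contra ht
    refine hu (Submodule.mem_span_singleton.2 ⟨-(t⁻¹ * r), ?_⟩)
    have : t⁻¹ • (r • v i + s • v j + t • u) = 0 := by rw [hr, smul_zero]
    rw [hs, smul_add, smul_smul t⁻¹ t, inv_mul_cancel₀ ht] at this
    rw [← sub_eq_zero, ← neg_eq_zero, ← this]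
    module
  refine ⟨?_, hs, ht⟩
  rw [hs, ht] at hr
  simpa [h.ne_zero i] using hr

/-- The tangent cone at a degenerate singular point restricts to a quadratic form of rank at most
one on the hyperplane polar to another singular point. -/
theorem apply_mul_apply_of_degenerate [CharZero k] [FiniteDimensional k V]
    (h : IsSixSingular T v) (hV : finrank k V = 5) {i j : Fin 6} (hij : i ≠ j)
    (hd : IsDegenerateAt T (v i)) {x y : V} (hx : T (v i) (v j) x = 0)
    (hy : T (v i) (v j) y = 0) :
    T (v i) x y ^ 2 = T (v i) x x * T (v i) y y := by
  obtain ⟨u, hu, hTu⟩ := hd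
  set L := T (v i) (v j) with hL
  have hind := h.linearIndependent_of_degenerate hij hu hTu
  have hker := Module.Dual.finrank_ker_add_one_of_ne_zero (f := L) (h.apply_ne_zero hij)
  have h0 : L (v i) = 0 := by rw [hL, h.symm.swap_right, h.sing]; rfl
  have h1 : L (v j) = 0 := by rw [hL, h.symm.swap_left, h.symm.swap_right, h.sing]; rfl
  have h2 : L u = 0 := by rw [hL, h.symm.swap_right, hTu]; rfl
  let w : Fin 5 → LinearMap.ker L := ![⟨v i, h0⟩, ⟨v j, h1⟩, ⟨u, h2⟩, ⟨x, hx⟩, ⟨y, hy⟩]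
  have hdep : ¬ LinearIndependent k w := fun hw => by
    have := hw.fintype_card_le_finrank
    simp at this
    omega
  rw [Fintype.not_linearIndependent_iff] at hdep
  obtain ⟨g, hg, m, hm⟩ := hdep
  have hg' := congrArg (LinearMap.ker L).subtype hg
  simp only [w, Fin.sum_univ_five, map_add, map_smul, Submodule.subtype_apply, Matrix.cons_val,
    map_zero] at hg'
  have key : ∀ z, L z = 0 → g 3 * T (v i) x z + g 4 * T (v i) y z = 0 := by
    intro z hz
    have := congrArg (fun a => T (v i) a z) hg'
    simpa [h.sing, hTu, ← hL, hz] using this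
  have kx := key x hx
  have ky := key y hy
  rw [h.symm.swap_right _ y x] at kx
  by_cases h3 : g 3 = 0
  · by_cases h4 : g 4 = 0
    · exfalso
      rw [h3, h4] at hg'
      have := linearIndependent_triple_iff.1 hind (g 0) (g 1) (g 2) (by simpa using hg')
      fin_cases m <;> simp_all
    · have e1 : T (v i) x y = 0 := by simpa [h3, h4] using kx
      have e2 : T (v i) y y = 0 := by simpa [h3, h4] using ky
      rw [e1, e2]; ring
  · have : g 3 * (T (v i) x y ^ 2 - T (v i) x x * T (v i) y y) = 0 := by
      linear_combination T (v i) x y * ky - T (v i) y y * kx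
    exact sub_eq_zero.1 ((mul_eq_zero.1 this).resolve_left h3)

/-- On the polar hyperplane, an isotropic vector of the tangent cone is in the radical. -/
theorem exists_smul_of_degenerate [CharZero k] [FiniteDimensional k V]
    (h : IsSixSingular T v) (hV : finrank k V = 5) {i j : Fin 6} (hij : i ≠ j)
    (hd : IsDegenerateAt T (v i)) {x : V} (hx : T (v i) (v j) x = 0)
    (hxx : T (v i) x x = 0) : ∃ m : k, T (v i) x = m • T (v i) (v j) := by
  have hm : T (v i) x ∈ Submodule.span k (Set.range fun _ : Unit => T (v i) (v j)) := by
    refine mem_span_of_iInf_ker_le_ker fun y hy => ?_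
    have hy' : T (v i) (v j) y = 0 := by simpa using hy
    have := h.apply_mul_apply_of_degenerate hV hij hd hx hy'
    rw [hxx, zero_mul] at this
    simpa using this
  rw [Set.range_const, Submodule.mem_span_singleton] at hm
  obtain ⟨m, hm⟩ := hm
  exact ⟨m, hm.symm⟩

theorem apply_apply_ne_zero [IsAlgClosed k] [CharZero k] [FiniteDimensional k V]
    (h : IsSixSingular T v) (hV : finrank k V = 5) {i j l : Fin 6} (hij : i ≠ j) (hil : i ≠ l)
    (hjl : j ≠ l) (hdi : IsDegenerateAt T (v i)) (hdj : IsDegenerateAt T (v j)) :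
    T (v i) (v j) (v l) ≠ 0 := by
  intro h0
  have e : ∀ a b, T (v a) (v b) (v b) = 0 := fun a b => by
    rw [h.symm.swap_left, h.symm.swap_right, h.sing]; rfl
  obtain ⟨m, hm⟩ := h.exists_smul_of_degenerate hV hij hdi h0 (e _ _)
  obtain ⟨n, hn⟩ := h.exists_smul_of_degenerate hV hij.symm hdj
    (by rw [h.symm.swap_left, h0]) (e _ l)
  rw [h.symm.swap_left (v j) (v i)] at hn
  exact h.not_gradient_mem_triple (h.linearIndependent_triple hij hil hjl) (T (v i) (v j))
    ⟨0, by simp [h.sing]⟩ ⟨0, by simp [h.sing]⟩ ⟨0, by simp [h.sing]⟩ ⟨1, by simp⟩ ⟨m, hm⟩ ⟨n, hn⟩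

end IsSixSingular

end Trilinear

end CubicThreefold

namespace CubicThreefold

open Module

section Bidegenerate

variable {k V : Type*} [Field k] [AddCommGroup V] [Module k V]

theorem IsDegenerateAt.smul {T : V →ₗ[k] V →ₗ[k] V →ₗ[k] k} {v : V} (h : IsDegenerateAt T v)
    {c : k} (hc : c ≠ 0) : IsDegenerateAt T (c • v) := by
  obtain ⟨u, hu, hT⟩ := h
  refine ⟨u, ?_, by simp [hT]⟩
  rwa [Submodule.span_singleton_smul_eq (IsUnit.mk0 c hc)]

theorem IsSixSingular.smul {T : V →ₗ[k] V →ₗ[k] V →ₗ[k] k} {v : Fin 6 → V}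
    (h : IsSixSingular T v) {c : Fin 6 → k} (hc : ∀ i, c i ≠ 0) :
    IsSixSingular T (fun i => c i • v i) where
  symm := h.symm
  sing i := by simp [h.sing]
  indep i j hij := by
    rw [LinearIndependent.pair_iff]
    intro s t hst
    rw [smul_smul, smul_smul] at hst
    simpa [hc] using LinearIndependent.pair_iff.1 (h.indep i j hij) _ _ hst
  all x hx := by
    obtain ⟨i, hi⟩ := h.all x hx
    exact ⟨i, by rwa [Submodule.span_singleton_smul_eq (IsUnit.mk0 _ (hc i))]⟩

/-- Six singular vectors of a cubic threefold, the first two of them degenerate, with the others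
normalized. -/
structure IsBidegenerate (T : V →ₗ[k] V →ₗ[k] V →ₗ[k] k) (v : Fin 6 → V) : Prop extends
    IsSixSingular T v where
  finrank_eq : finrank k V = 5
  degenerate_zero : IsDegenerateAt T (v 0)
  degenerate_one : IsDegenerateAt T (v 1)
  apply_eq_one : ∀ j, j ≠ 0 → j ≠ 1 → T (v 0) (v 1) (v j) = 1

namespace IsBidegenerate

variable {T : V →ₗ[k] V →ₗ[k] V →ₗ[k] k} {v : Fin 6 → V}

theorem swap (h : IsBidegenerate T v) : IsBidegenerate T (v ∘ Equiv.swap 0 1) where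
  toIsSixSingular := h.comp_perm _
  finrank_eq := h.finrank_eq
  degenerate_zero := by simpa using h.degenerate_one
  degenerate_one := by simpa using h.degenerate_zero
  apply_eq_one j h0 h1 := by
    simp only [Function.comp, Equiv.swap_apply_left, Equiv.swap_apply_right,
      Equiv.swap_apply_of_ne_of_ne h0 h1]
    rw [h.symm.swap_left]
    exact h.apply_eq_one j h0 h1

theorem comp_perm_of_fix (h : IsBidegenerate T v) (σ : Equiv.Perm (Fin 6)) (h0 : σ 0 = 0)
    (h1 : σ 1 = 1) : IsBidegenerate T (v ∘ σ) where
  toIsSixSingular := h.comp_perm _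
  finrank_eq := h.finrank_eq
  degenerate_zero := by simpa [h0] using h.degenerate_zero
  degenerate_one := by simpa [h1] using h.degenerate_one
  apply_eq_one j hj0 hj1 := by
    simp only [Function.comp, h0, h1]
    exact h.apply_eq_one _ (fun e => hj0 (σ.injective (e.trans h0.symm)))
      (fun e => hj1 (σ.injective (e.trans h1.symm)))

/-- A singular vector is isotropic for every tangent cone. -/
theorem apply_self (h : IsBidegenerate T v) (x : V) (i : Fin 6) : T x (v i) (v i) = 0 := by
  rw [h.symm.swap_left, h.symm.swap_right, h.sing]; rfl

theorem apply_self' (h : IsBidegenerate T v) (x : V) (i : Fin 6) : T (v i) x (v i) = 0 := by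
  rw [h.symm.swap_right, h.sing]; rfl

theorem relation_two [CharZero k] (h : IsBidegenerate T v)
    {i j : Fin 6} (hij : i ≠ j) (hi0 : i ≠ 0) (hi1 : i ≠ 1) (hj0 : j ≠ 0) (hj1 : j ≠ 1)
    {a b c d : k} (hr : a • v 0 + b • v 1 + c • v i + d • v j = 0) :
    a = 0 ∧ b = 0 ∧ c = 0 ∧ d = 0 := by
  have hi := h.apply_eq_one i hi0 hi1
  have hj := h.apply_eq_one j hj0 hj1
  have hi' : T (v 1) (v 0) (v i) = 1 := by rw [h.symm.swap_left, hi]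
  have hj' : T (v 1) (v 0) (v j) = 1 := by rw [h.symm.swap_left, hj]
  have eL := congrArg (T (v 0) (v 1)) hr
  have e1 := congrArg (fun x => T (v 0) x (v i)) hr
  have e2 := congrArg (fun x => T (v 0) x (v j)) hr
  have e3 := congrArg (fun x => T (v 1) x (v i)) hr
  have e4 := congrArg (fun x => T (v 1) x (v j)) hr
  simp only [map_add, map_smul, LinearMap.add_apply, LinearMap.smul_apply, h.apply_self,
    h.apply_self', hi, hj, hi', hj', h.sing, map_zero, LinearMap.zero_apply, smul_eq_mul,
    mul_zero, mul_one, zero_add, add_zero] at eL e1 e2 e3 e4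
  rw [h.symm.swap_right _ (v j) (v i)] at e1 e3
  have hb : b = 0 := by
    have : 2 * b = 0 := by linear_combination e1 + e2 - T (v 0) (v i) (v j) * eL
    simpa using this
  have ha : a = 0 := by
    have : 2 * a = 0 := by linear_combination e3 + e4 - T (v 1) (v i) (v j) * eL
    simpa using this
  have := LinearIndependent.pair_iff.1 (h.indep i j hij) c d (by rw [← hr, ha, hb]; module)
  tauto

theorem relation_three_aux [IsAlgClosed k] [CharZero k] [FiniteDimensional k V]
    (h : IsBidegenerate T v) {i j l : Fin 6} (hij : i ≠ j)
    (hi0 : i ≠ 0) (hi1 : i ≠ 1) (hj0 : j ≠ 0) (hj1 : j ≠ 1)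
    {a c d e : k} (hc : c ≠ 0) (hd : d ≠ 0) (hp : T (v 0) (v i) (v j) = 0)
    (hr : a • v 0 + c • v i + d • v j + e • v l = 0) : False := by
  have hi := h.apply_eq_one i hi0 hi1
  have hj := h.apply_eq_one j hj0 hj1
  have hp' : T (v 0) (v j) (v i) = 0 := by rw [h.symm.swap_right, hp]
  obtain ⟨m, hm⟩ := h.exists_smul_of_degenerate h.finrank_eq (i := 0) (j := 1) (by decide)
    h.degenerate_zero (x := v i - v j) (by simp [hi, hj])
    (by simp [hp, hp', h.apply_self])
  have hm0 : m = 0 := by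
    have := congrArg (fun φ => φ (v i)) hm
    simpa [hp', h.apply_self, hi] using this.symm
  have hT : T (v 0) (v j) = T (v 0) (v i) := by
    rw [hm0, zero_smul, map_sub, sub_eq_zero] at hm
    exact hm.symm
  have hx : T (a • v 0 + c • v i + d • v j) (a • v 0 + c • v i + d • v j) = 0 := by
    rw [eq_neg_of_add_eq_zero_left hr]
    simp [h.sing]
  simp only [map_add, map_smul, LinearMap.add_apply, LinearMap.smul_apply, h.sing, smul_zero,
    zero_add, add_zero, h.symm.swap_left (v j) (v i), h.symm.swap_left (v i) (v 0),
    h.symm.swap_left (v j) (v 0), hT] at hx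
  have hx2 : (c * d) • T (v i) (v j) = (-(a * (c + d))) • T (v 0) (v i) := by
    have h2 : (2 : k) • ((c * d) • T (v i) (v j) - (-(a * (c + d))) • T (v 0) (v i)) = 0 := by
      rw [← hx]; module
    exact sub_eq_zero.1 ((smul_eq_zero.1 h2).resolve_left two_ne_zero)
  have hx3 : T (v i) (v j) = ((c * d)⁻¹ * (-(a * (c + d)))) • T (v 0) (v i) := by
    rw [mul_smul, ← hx2, smul_smul, inv_mul_cancel₀ (mul_ne_zero hc hd), one_smul]
  exact h.not_gradient_mem_triple (h.linearIndependent_triple hi0.symm hj0.symm hij)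
    (T (v 0) (v i)) ⟨0, by simp [h.sing]⟩ ⟨0, by simp [h.sing]⟩ ⟨0, by simp [h.sing]⟩
    ⟨1, by simp⟩ ⟨1, by simp [hT]⟩ ⟨_, hx3⟩

theorem relation_three [IsAlgClosed k] [CharZero k] [FiniteDimensional k V]
    (h : IsBidegenerate T v) {i j l : Fin 6} (hij : i ≠ j) (hil : i ≠ l) (hjl : j ≠ l)
    (hi0 : i ≠ 0) (hi1 : i ≠ 1) (hj0 : j ≠ 0) (hj1 : j ≠ 1) (hl0 : l ≠ 0) (hl1 : l ≠ 1)
    {a b c d e : k} (hr : a • v 0 + b • v 1 + c • v i + d • v j + e • v l = 0) :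
    a = 0 ∧ b = 0 ∧ c = 0 ∧ d = 0 ∧ e = 0 := by
  by_cases hc : c = 0
  · have := h.relation_two hjl hj0 hj1 hl0 hl1 (a := a) (b := b) (c := d) (d := e)
      (by rw [← hr, hc]; module)
    tauto
  by_cases hd : d = 0
  · have := h.relation_two hil hi0 hi1 hl0 hl1 (a := a) (b := b) (c := c) (d := e)
      (by rw [← hr, hd]; module)
    tauto
  by_cases he : e = 0
  · have := h.relation_two hij hi0 hi1 hj0 hj1 (a := a) (b := b) (c := c) (d := d)
      (by rw [← hr, he]; module)
    tauto
  exfalso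
  have hi := h.apply_eq_one i hi0 hi1
  have hj := h.apply_eq_one j hj0 hj1
  have hl := h.apply_eq_one l hl0 hl1
  have hi' : T (v 1) (v 0) (v i) = 1 := by rw [h.symm.swap_left, hi]
  have hj' : T (v 1) (v 0) (v j) = 1 := by rw [h.symm.swap_left, hj]
  have hl' : T (v 1) (v 0) (v l) = 1 := by rw [h.symm.swap_left, hl]
  have eL := congrArg (T (v 0) (v 1)) hr
  have e1 := congrArg (fun x => T (v 0) x (v i)) hr
  have e2 := congrArg (fun x => T (v 0) x (v j)) hr
  have e3 := congrArg (fun x => T (v 0) x (v l)) hr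
  have f1 := congrArg (fun x => T (v 1) x (v i)) hr
  have f2 := congrArg (fun x => T (v 1) x (v j)) hr
  have f3 := congrArg (fun x => T (v 1) x (v l)) hr
  have g1 := congrArg (fun x => T x (v i) (v j)) hr
  have g2 := congrArg (fun x => T x (v i) (v l)) hr
  have g3 := congrArg (fun x => T x (v j) (v l)) hr
  simp only [map_add, map_smul, LinearMap.add_apply, LinearMap.smul_apply, h.apply_self,
    h.apply_self', hi, hj, hl, hi', hj', hl', h.sing, map_zero, LinearMap.zero_apply, smul_eq_mul,
    mul_zero, mul_one, zero_add, add_zero] at eL e1 e2 e3 f1 f2 f3 g1 g2 g3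
  rw [h.symm.swap_right _ (v j) (v i), h.symm.swap_right _ (v l) (v i)] at e1 f1
  rw [h.symm.swap_right _ (v l) (v j)] at e2 f2
  rw [h.symm.swap_left (v l) (v i), h.symm.swap_right _ (v l) (v j)] at g1
  rw [h.symm.swap_left (v j) (v i)] at g2
  set p1 := T (v 0) (v i) (v j)
  set p2 := T (v 0) (v j) (v l)
  set p3 := T (v 0) (v i) (v l)
  set q1 := T (v 1) (v i) (v j)
  set q2 := T (v 1) (v j) (v l)
  set q3 := T (v 1) (v i) (v l)
  set r := T (v i) (v j) (v l)
  have k1 : 2 * (c * d * p1 - b * e) = 0 := by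
    linear_combination c * e1 + d * e2 - e * e3 - b * eL
  have k2 : 2 * (d * e * p2 - b * c) = 0 := by
    linear_combination -c * e1 + d * e2 + e * e3 - b * eL
  have k3 : 2 * (c * e * p3 - b * d) = 0 := by
    linear_combination c * e1 - d * e2 + e * e3 - b * eL
  have l1 : 2 * (c * d * q1 - a * e) = 0 := by
    linear_combination c * f1 + d * f2 - e * f3 - a * eL
  have l2 : 2 * (d * e * q2 - a * c) = 0 := by
    linear_combination -c * f1 + d * f2 + e * f3 - a * eL
  have l3 : 2 * (c * e * q3 - a * d) = 0 := by
    linear_combination c * f1 - d * f2 + e * f3 - a * eL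
  have hp1 : c * d * p1 = b * e := by simpa [sub_eq_zero] using k1
  have hp2 : d * e * p2 = b * c := by simpa [sub_eq_zero] using k2
  have hp3 : c * e * p3 = b * d := by simpa [sub_eq_zero] using k3
  have hq1 : c * d * q1 = a * e := by simpa [sub_eq_zero] using l1
  have hq2 : d * e * q2 = a * c := by simpa [sub_eq_zero] using l2
  have hq3 : c * e * q3 = a * d := by simpa [sub_eq_zero] using l3
  have m1 : e * (2 * a * b + c * d * r) = 0 := by
    linear_combination c * d * g1 - a * hp1 - b * hq1
  have m2 : d * (2 * a * b + c * e * r) = 0 := by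
    linear_combination c * e * g2 - a * hp3 - b * hq3
  have m3 : c * (2 * a * b + d * e * r) = 0 := by
    linear_combination d * e * g3 - a * hp2 - b * hq2
  have n1 := (mul_eq_zero.1 m1).resolve_left he
  have n2 := (mul_eq_zero.1 m2).resolve_left hd
  have n3 := (mul_eq_zero.1 m3).resolve_left hc
  have hb : b = 0 → False := by
    intro hb
    have hp : p1 = 0 := by
      rw [hb, zero_mul] at hp1
      exact (mul_eq_zero.1 hp1).resolve_left (mul_ne_zero hc hd)
    exact h.relation_three_aux hij hi0 hi1 hj0 hj1 hc hd hp (a := a) (l := l) (e := e)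
      (by rw [← hr, hb]; module)
  have ha : a = 0 → False := by
    intro ha
    have hq : q1 = 0 := by
      rw [ha, zero_mul] at hq1
      exact (mul_eq_zero.1 hq1).resolve_left (mul_ne_zero hc hd)
    have hs : ∀ x : Fin 6, x ≠ 0 → x ≠ 1 → (v ∘ Equiv.swap 0 1) x = v x := fun x h0 h1 => by
      simp [Equiv.swap_apply_of_ne_of_ne h0 h1]
    have hs0 : (v ∘ Equiv.swap 0 1) 0 = v 1 := by simp
    refine h.swap.relation_three_aux hij hi0 hi1 hj0 hj1 hc hd ?_ (a := b) (l := l) (e := e) ?_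
    · rw [hs i hi0 hi1, hs j hj0 hj1, hs0, ← hq]
    · rw [hs i hi0 hi1, hs j hj0 hj1, hs l hl0 hl1, hs0, ← hr, ha]; module
  have hr0 : r ≠ 0 := by
    intro hr0
    have : 2 * a * b = 0 := by simpa [hr0] using n1
    rcases mul_eq_zero.1 this with h1 | h1
    · exact ha (by simpa using h1)
    · exact hb h1
  have o1 : d = e := by
    have : (c * r) * (d - e) = 0 := by linear_combination n1 - n2
    exact sub_eq_zero.1 ((mul_eq_zero.1 this).resolve_left (mul_ne_zero hc hr0))
  have o2 : c = e := by
    have : (d * r) * (c - e) = 0 := by linear_combination n1 - n3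
    exact sub_eq_zero.1 ((mul_eq_zero.1 this).resolve_left (mul_ne_zero hd hr0))
  have : 3 * e = 0 := by linear_combination eL - o1 - o2
  exact he (by simpa using this)

theorem linearIndependent_five [IsAlgClosed k] [CharZero k] [FiniteDimensional k V]
    (h : IsBidegenerate T v) : LinearIndependent k ![v 0, v 1, v 2, v 3, v 4] := by
  rw [Fintype.linearIndependent_iff]
  intro g hg
  have := h.relation_three (i := 2) (j := 3) (l := 4) (by decide) (by decide) (by decide)
    (by decide) (by decide) (by decide) (by decide) (by decide) (by decide)
    (a := g 0) (b := g 1) (c := g 2) (d := g 3) (e := g 4)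
    (by simpa [Fin.sum_univ_five] using hg)
  intro i
  fin_cases i
  exacts [this.1, this.2.1, this.2.2.1, this.2.2.2.1, this.2.2.2.2]

end IsBidegenerate

end Bidegenerate

end CubicThreefold

namespace CubicThreefold

open Module

section Bidegenerate

variable {k V : Type*} [Field k] [AddCommGroup V] [Module k V]

/-- The scalar relations forced by a sixth singular point. -/
theorem sixth_point_relations [CharZero k] {c2 c3 c4 m0 m1 p1 p2 p3 q1 q2 q3 r : k}
    (hs : c2 + c3 + c4 = 1) (h2 : c2 ≠ 0) (h3 : c3 ≠ 0) (h4 : c4 ≠ 0)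
    (e0 : m1 + (p1 * c2 * c3 + p2 * c3 * c4 + p3 * c2 * c4) = 0)
    (e1 : m0 + (q1 * c2 * c3 + q2 * c3 * c4 + q3 * c2 * c4) = 0)
    (e2 : m0 * m1 + m0 * (p1 * c3 + p3 * c4) + m1 * (q1 * c3 + q3 * c4) + r * c3 * c4 = 0)
    (e3 : m0 * m1 + m0 * (p1 * c2 + p2 * c4) + m1 * (q1 * c2 + q2 * c4) + r * c2 * c4 = 0)
    (e4 : m0 * m1 + m0 * (p3 * c2 + p2 * c3) + m1 * (q3 * c2 + q2 * c3) + r * c2 * c3 = 0) :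
    r * (c2 * c3 * c4) = m0 * m1 ∧
    r * (c2 * c3) * 2 = -(m1 * (q2 + q3 - q1) + m0 * (p2 + p3 - p1)) ∧
    r * (c3 * c4) * 2 = -(m1 * (q1 + q3 - q2) + m0 * (p1 + p3 - p2)) ∧
    r * (c2 * c4) * 2 = -(m1 * (q1 + q2 - q3) + m0 * (p1 + p2 - p3)) := by
  have hr : r * (c2 * c3 * c4) = m0 * m1 := by
    have : 3 * (r * (c2 * c3 * c4) - m0 * m1) = 0 := by
      linear_combination c2 * e2 + c3 * e3 + c4 * e4 - m0 * m1 * hs - 2 * m0 * e0 - 2 * m1 * e1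
    exact sub_eq_zero.1 (by simpa using this)
  have hp1 : -(m0 * p1 + m1 * q1) = r * c4 * (c2 + c3) := by
    have : c2 * c3 * (-(m0 * p1 + m1 * q1) - r * c4 * (c2 + c3)) = 0 := by
      linear_combination c4 * e4 - m0 * e0 - m1 * e1 - (c2 + c3 + 1) * hr - m0 * m1 * hs
    exact sub_eq_zero.1 ((mul_eq_zero.1 this).resolve_left (mul_ne_zero h2 h3))
  have hp2 : -(m0 * p2 + m1 * q2) = r * c2 * (c3 + c4) := by
    have : c3 * c4 * (-(m0 * p2 + m1 * q2) - r * c2 * (c3 + c4)) = 0 := by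
      linear_combination c2 * e2 - m0 * e0 - m1 * e1 - (c3 + c4 + 1) * hr - m0 * m1 * hs
    exact sub_eq_zero.1 ((mul_eq_zero.1 this).resolve_left (mul_ne_zero h3 h4))
  have hp3 : -(m0 * p3 + m1 * q3) = r * c3 * (c2 + c4) := by
    have : c2 * c4 * (-(m0 * p3 + m1 * q3) - r * c3 * (c2 + c4)) = 0 := by
      linear_combination c3 * e3 - m0 * e0 - m1 * e1 - (c2 + c4 + 1) * hr - m0 * m1 * hs
    exact sub_eq_zero.1 ((mul_eq_zero.1 this).resolve_left (mul_ne_zero h2 h4))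
  refine ⟨hr, ?_, ?_, ?_⟩
  · linear_combination -hp2 - hp3 + hp1
  · linear_combination -hp1 - hp3 + hp2
  · linear_combination -hp1 - hp2 + hp3

namespace IsBidegenerate

variable {T : V →ₗ[k] V →ₗ[k] V →ₗ[k] k} {v : Fin 6 → V}

theorem apply_two_three (h : IsBidegenerate T v) (a b x y z : k) :
    let w := a • v 0 + b • v 1 + x • v 2 + y • v 3 + z • v 4
    T w w (v 0) = 2 * (b * (x + y + z) + (T (v 0) (v 2) (v 3) * x * y +
      T (v 0) (v 3) (v 4) * y * z + T (v 0) (v 2) (v 4) * x * z)) ∧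
    T w w (v 1) = 2 * (a * (x + y + z) + (T (v 1) (v 2) (v 3) * x * y +
      T (v 1) (v 3) (v 4) * y * z + T (v 1) (v 2) (v 4) * x * z)) ∧
    T w w (v 2) = 2 * (a * b + a * (T (v 0) (v 2) (v 3) * y + T (v 0) (v 2) (v 4) * z) +
      b * (T (v 1) (v 2) (v 3) * y + T (v 1) (v 2) (v 4) * z) +
      T (v 2) (v 3) (v 4) * y * z) ∧
    T w w (v 3) = 2 * (a * b + a * (T (v 0) (v 2) (v 3) * x + T (v 0) (v 3) (v 4) * z) +
      b * (T (v 1) (v 2) (v 3) * x + T (v 1) (v 3) (v 4) * z) +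
      T (v 2) (v 3) (v 4) * x * z) ∧
    T w w (v 4) = 2 * (a * b + a * (T (v 0) (v 2) (v 4) * x + T (v 0) (v 3) (v 4) * y) +
      b * (T (v 1) (v 2) (v 4) * x + T (v 1) (v 3) (v 4) * y) +
      T (v 2) (v 3) (v 4) * x * y) := by
  have h2 := h.apply_eq_one 2 (by decide) (by decide)
  have h3 := h.apply_eq_one 3 (by decide) (by decide)
  have h4 := h.apply_eq_one 4 (by decide) (by decide)
  intro w
  refine ⟨?_, ?_, ?_, ?_, ?_⟩ <;>
  · simp only [w, map_add, map_smul, LinearMap.add_apply, LinearMap.smul_apply, h.apply_self,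
      h.apply_self', h.sing, LinearMap.zero_apply, smul_eq_mul, mul_zero,
      zero_add, add_zero, h.symm.swap_left (v 1) (v 0), h.symm.swap_left (v 2) (v 0),
      h.symm.swap_left (v 3) (v 0), h.symm.swap_left (v 4) (v 0), h.symm.swap_left (v 2) (v 1),
      h.symm.swap_left (v 3) (v 1), h.symm.swap_left (v 4) (v 1), h.symm.swap_left (v 3) (v 2),
      h.symm.swap_left (v 4) (v 2), h.symm.swap_left (v 4) (v 3),
      h.symm.swap_right _ (v 2) (v 0),
      h.symm.swap_right _ (v 3) (v 0), h.symm.swap_right _ (v 4) (v 0),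
      h.symm.swap_right _ (v 2) (v 1), h.symm.swap_right _ (v 3) (v 1),
      h.symm.swap_right _ (v 4) (v 1), h.symm.swap_right _ (v 3) (v 2),
      h.symm.swap_right _ (v 4) (v 2), h.symm.swap_right _ (v 4) (v 3), h2, h3, h4]
    ring

/-- The first five singular vectors form a basis. -/
noncomputable def basis [IsAlgClosed k] [CharZero k] [FiniteDimensional k V]
    (h : IsBidegenerate T v) : Basis (Fin 5) k V :=
  basisOfLinearIndependentOfCardEqFinrank h.linearIndependent_five (by simp [h.finrank_eq])

variable [IsAlgClosed k] [CharZero k] [FiniteDimensional k V]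

theorem basis_coe (h : IsBidegenerate T v) : ⇑h.basis = ![v 0, v 1, v 2, v 3, v 4] := by
  simp [basis]

theorem exists_coords (h : IsBidegenerate T v) (x : V) :
    ∃ a b c d e : k, x = a • v 0 + b • v 1 + c • v 2 + d • v 3 + e • v 4 := by
  refine ⟨h.basis.repr x 0, h.basis.repr x 1, h.basis.repr x 2, h.basis.repr x 3,
    h.basis.repr x 4, ?_⟩
  have := h.basis.sum_repr x
  rw [Fin.sum_univ_five, h.basis_coe] at this
  exact this.symm

theorem ext_dual (h : IsBidegenerate T v) {φ ψ : Dual k V} (h0 : φ (v 0) = ψ (v 0))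
    (h1 : φ (v 1) = ψ (v 1)) (h2 : φ (v 2) = ψ (v 2)) (h3 : φ (v 3) = ψ (v 3))
    (h4 : φ (v 4) = ψ (v 4)) : φ = ψ := by
  refine h.basis.ext fun i => ?_
  rw [h.basis_coe]
  fin_cases i
  exacts [h0, h1, h2, h3, h4]

theorem tangent_relation (h : IsBidegenerate T v) :
    (T (v 0) (v 2) (v 3) + T (v 0) (v 3) (v 4) - T (v 0) (v 2) (v 4)) ^ 2 =
      4 * T (v 0) (v 2) (v 3) * T (v 0) (v 3) (v 4) := by
  have h2 := h.apply_eq_one 2 (by decide) (by decide)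
  have h3 := h.apply_eq_one 3 (by decide) (by decide)
  have h4 := h.apply_eq_one 4 (by decide) (by decide)
  have := h.apply_mul_apply_of_degenerate h.finrank_eq (i := 0) (j := 1) (by decide)
    h.degenerate_zero (x := v 2 - v 3) (y := v 3 - v 4) (by simp [h2, h3]) (by simp [h3, h4])
  simp only [map_sub, LinearMap.sub_apply, h.apply_self, h.symm.swap_right _ (v 3) (v 2),
    h.symm.swap_right _ (v 4) (v 3)] at this
  linear_combination this

theorem tangent_relation' (h : IsBidegenerate T v) :
    (T (v 1) (v 2) (v 3) + T (v 1) (v 3) (v 4) - T (v 1) (v 2) (v 4)) ^ 2 =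
      4 * T (v 1) (v 2) (v 3) * T (v 1) (v 3) (v 4) := by
  have := h.swap.tangent_relation
  have e0 : (v ∘ Equiv.swap 0 1) 0 = v 1 := by simp
  have e2 : (v ∘ Equiv.swap 0 1) 2 = v 2 := by simp [Equiv.swap_apply_of_ne_of_ne]
  have e3 : (v ∘ Equiv.swap 0 1) 3 = v 3 := by simp [Equiv.swap_apply_of_ne_of_ne]
  have e4 : (v ∘ Equiv.swap 0 1) 4 = v 4 := by simp [Equiv.swap_apply_of_ne_of_ne]
  rwa [e0, e2, e3, e4] at this

/-- A rational normal curve of singular points is impossible. -/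
theorem not_rational_curve (h : IsBidegenerate T v) (k1 k2 k3 l1 l2 l3 : k)
    (hp1 : T (v 0) (v 2) (v 3) = k2 + k3) (hp2 : T (v 0) (v 3) (v 4) = k1 + k3)
    (hp3 : T (v 0) (v 2) (v 4) = k1 + k2)
    (hq1 : T (v 1) (v 2) (v 3) = l2 + l3) (hq2 : T (v 1) (v 3) (v 4) = l1 + l3)
    (hq3 : T (v 1) (v 2) (v 4) = l1 + l2)
    (hk : k1 * k2 + k2 * k3 + k1 * k3 = 0) (hl : l1 * l2 + l2 * l3 + l1 * l3 = 0)
    (hr : T (v 2) (v 3) (v 4) = (k2 + k3) * l1 + (k1 + k3) * l2 + (k1 + k2) * l3)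
    (h1 : k1 = 0 → l1 ≠ 0) (h2 : k2 = 0 → l2 ≠ 0) (h3 : k3 = 0 → l3 ≠ 0) : False := by
  have hroot : ∀ a b s : k, (a = 0 → b ≠ 0) → s * a + b = 0 → s = -b / a := by
    intro a b s hab hs
    have ha : a ≠ 0 := fun ha => hab ha (by simpa [ha] using hs)
    rw [eq_div_iff ha]; linear_combination hs
  have hfin : (Set.univ : Set k) ⊆ ({-l1 / k1, -l2 / k2, -l3 / k3} : Set k) ∪
      Set.range (fun i => h.basis.repr (v i) 0 / h.basis.repr (v i) 1) := by
    intro s _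
    set P := s * k1 + l1 with hP
    set Q := s * k2 + l2 with hQ
    set R := s * k3 + l3 with hR
    by_cases hP0 : P = 0
    · exact Or.inl (Or.inl (hroot _ _ _ h1 hP0))
    by_cases hQ0 : Q = 0
    · exact Or.inl (Or.inr (Or.inl (hroot _ _ _ h2 hQ0)))
    by_cases hR0 : R = 0
    · exact Or.inl (Or.inr (Or.inr (hroot _ _ _ h3 hR0)))
    right
    have hT := h.apply_two_three (-(s * (P * Q * R))) (-(P * Q * R)) (s * (P * R)) (s * (P * Q))
      (s * (Q * R))
    simp only [hp1, hp2, hp3, hq1, hq2, hq3, hr] at hT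
    set x := (-(s * (P * Q * R))) • v 0 + (-(P * Q * R)) • v 1 + (s * (P * R)) • v 2 +
      (s * (P * Q)) • v 3 + (s * (Q * R)) • v 4 with hx
    obtain ⟨t0, t1, t2, t3, t4⟩ := hT
    have hK : P * Q + Q * R + P * R =
        s * ((k2 + k3) * l1 + (k1 + k3) * l2 + (k1 + k2) * l3) := by
      linear_combination s ^ 2 * hk + hl
    have hxx : T x x = 0 := by
      apply h.ext_dual
      · rw [t0]; simp only [LinearMap.zero_apply]
        linear_combination (-2 * s * (P * Q * R)) * hK + 4 * s ^ 3 * (P * Q * R) * hk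
      · rw [t1]; simp only [LinearMap.zero_apply]
        linear_combination (-2 * s ^ 2 * (P * Q * R)) * hK + 4 * s ^ 2 * (P * Q * R) * hl
      · rw [t2]; simp only [LinearMap.zero_apply]
        linear_combination (-2 * s * P * Q ^ 2 * R) * hK
      · rw [t3]; simp only [LinearMap.zero_apply]
        linear_combination (-2 * s * P * Q * R ^ 2) * hK
      · rw [t4]; simp only [LinearMap.zero_apply]
        linear_combination (-2 * s * P ^ 2 * Q * R) * hK
    obtain ⟨i, hi⟩ := h.all x hxx
    obtain ⟨c, hc⟩ := Submodule.mem_span_singleton.1 hi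
    have hrep : ∀ j, h.basis.repr x j = ![-(s * (P * Q * R)), -(P * Q * R), s * (P * R),
        s * (P * Q), s * (Q * R)] j := by
      intro j
      have : x = ∑ j, ![-(s * (P * Q * R)), -(P * Q * R), s * (P * R),
        s * (P * Q), s * (Q * R)] j • h.basis j := by
        rw [Fin.sum_univ_five, h.basis_coe]; rfl
      rw [this, Basis.repr_sum_self]
    have r0 := hrep 0
    have r1 := hrep 1
    rw [← hc] at r0 r1
    simp only [map_smul, Finsupp.smul_apply, smul_eq_mul, Matrix.cons_val] at r0 r1
    have hPQR : P * Q * R ≠ 0 := mul_ne_zero (mul_ne_zero hP0 hQ0) hR0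
    refine ⟨i, ?_⟩
    have hne : h.basis.repr (v i) 1 ≠ 0 := fun h0 => hPQR (by
      rw [h0, mul_zero] at r1; exact neg_eq_zero.1 r1.symm)
    have hc0 : c ≠ 0 := fun h0 => hPQR (by
      rw [h0, zero_mul] at r1; exact neg_eq_zero.1 r1.symm)
    simp only
    rw [div_eq_iff hne]
    apply mul_left_cancel₀ hc0
    linear_combination r0 - s * r1
  exact (Set.infinite_univ (α := k)) (Set.Finite.subset
    ((Set.toFinite _).union (Set.finite_range _)) hfin)

end IsBidegenerate

end Bidegenerate

end CubicThreefold

namespace CubicThreefold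

open Module

section Bidegenerate

variable {k V : Type*} [Field k] [AddCommGroup V] [Module k V]

namespace IsBidegenerate

variable {T : V →ₗ[k] V →ₗ[k] V →ₗ[k] k} {v : Fin 6 → V}
variable [IsAlgClosed k] [CharZero k] [FiniteDimensional k V]

theorem not_proportional (h : IsBidegenerate T v) (hr : T (v 2) (v 3) (v 4) = 0) {s t : k}
    (hst : s ≠ 0 ∨ t ≠ 0)
    (h1 : s * T (v 0) (v 2) (v 3) + t * T (v 1) (v 2) (v 3) = 0)
    (h2 : s * T (v 0) (v 3) (v 4) + t * T (v 1) (v 3) (v 4) = 0)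
    (h3 : s * T (v 0) (v 2) (v 4) + t * T (v 1) (v 2) (v 4) = 0) : False := by
  have hc : ∀ x y : k, s * x + t * y = 0 → ∃ m, x = m * t ∧ y = m * (-s) := by
    intro x y hxy
    rcases hst with hs | ht
    · exact ⟨-(s⁻¹ * y), by field_simp; linear_combination hxy, by field_simp⟩
    · exact ⟨t⁻¹ * x, by field_simp, by field_simp; linear_combination hxy⟩
  obtain ⟨m1, a1, b1⟩ := hc _ _ h1
  obtain ⟨m2, a2, b2⟩ := hc _ _ h2
  obtain ⟨m3, a3, b3⟩ := hc _ _ h3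
  have hv : ∀ i j : Fin 5, h.basis.repr (![v 0, v 1, v 2, v 3, v 4] j) i =
      if j = i then 1 else 0 := fun i j => by
    rw [← h.basis_coe, Basis.repr_self, Finsupp.single_apply]
  have c00 : h.basis.repr (v 0) 0 = 1 := hv 0 0
  have c01 : h.basis.repr (v 1) 0 = 0 := hv 0 1
  have c02 : h.basis.repr (v 2) 0 = 0 := hv 0 2
  have c03 : h.basis.repr (v 3) 0 = 0 := hv 0 3
  have c04 : h.basis.repr (v 4) 0 = 0 := hv 0 4
  have c10 : h.basis.repr (v 0) 1 = 0 := hv 1 0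
  have c11 : h.basis.repr (v 1) 1 = 1 := hv 1 1
  have c12 : h.basis.repr (v 2) 1 = 0 := hv 1 2
  have c13 : h.basis.repr (v 3) 1 = 0 := hv 1 3
  have c14 : h.basis.repr (v 4) 1 = 0 := hv 1 4
  refine h.not_gradient_mem_triple (h.linearIndependent_triple (i := 2) (j := 3) (l := 4)
    (by decide) (by decide) (by decide)) (t • h.basis.coord 0 - s • h.basis.coord 1)
    ⟨0, by simp [h.sing]⟩ ⟨0, by simp [h.sing]⟩ ⟨0, by simp [h.sing]⟩ ⟨m1, ?_⟩ ⟨m3, ?_⟩ ⟨m2, ?_⟩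
  all_goals
    apply h.ext_dual <;>
    simp [c00, c01, c02, c03, c04, c10, c11, c12, c13, c14, h.apply_self, h.apply_self', h.symm.swap_left (v 2) (v 0),
      h.symm.swap_left (v 3) (v 0), h.symm.swap_left (v 4) (v 0), h.symm.swap_left (v 2) (v 1),
      h.symm.swap_left (v 3) (v 1), h.symm.swap_left (v 4) (v 1), h.symm.swap_left (v 3) (v 2),
      h.symm.swap_left (v 4) (v 2), h.symm.swap_left (v 4) (v 3),
      h.symm.swap_right _ (v 2) (v 0),
      h.symm.swap_right _ (v 3) (v 0), h.symm.swap_right _ (v 4) (v 0),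
      h.symm.swap_right _ (v 2) (v 1), h.symm.swap_right _ (v 3) (v 1),
      h.symm.swap_right _ (v 4) (v 1), h.symm.swap_right _ (v 3) (v 2),
      h.symm.swap_right _ (v 4) (v 2), h.symm.swap_right _ (v 4) (v 3), hr, a1, a2, a3, b1, b2,
      b3]

/-- The four remaining singular points are coplanar, and they are the base points of the pencil
of conics cut out by the two tangent cones. -/
theorem exists_sixth (h : IsBidegenerate T v) : ∃ c2 c3 c4 : k, c2 ≠ 0 ∧ c3 ≠ 0 ∧ c4 ≠ 0 ∧
    v 5 = c2 • v 2 + c3 • v 3 + c4 • v 4 ∧ T (v 2) (v 3) (v 4) = 0 ∧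
    T (v 0) (v 2) (v 3) * c2 * c3 + T (v 0) (v 3) (v 4) * c3 * c4 +
      T (v 0) (v 2) (v 4) * c2 * c4 = 0 ∧
    T (v 1) (v 2) (v 3) * c2 * c3 + T (v 1) (v 3) (v 4) * c3 * c4 +
      T (v 1) (v 2) (v 4) * c2 * c4 = 0 := by
  obtain ⟨m0, m1, c2, c3, c4, h5⟩ := h.exists_coords (v 5)
  have hc2 : c2 ≠ 0 := by
    intro h0
    have := h.relation_three (i := 3) (j := 4) (l := 5) (by decide) (by decide) (by decide)
      (by decide) (by decide) (by decide) (by decide) (by decide) (by decide)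
      (a := m0) (b := m1) (c := c3) (d := c4) (e := -1) (by rw [h5, h0]; module)
    simp at this
  have hc3 : c3 ≠ 0 := by
    intro h0
    have := h.relation_three (i := 2) (j := 4) (l := 5) (by decide) (by decide) (by decide)
      (by decide) (by decide) (by decide) (by decide) (by decide) (by decide)
      (a := m0) (b := m1) (c := c2) (d := c4) (e := -1) (by rw [h5, h0]; module)
    simp at this
  have hc4 : c4 ≠ 0 := by
    intro h0
    have := h.relation_three (i := 2) (j := 3) (l := 5) (by decide) (by decide) (by decide)
      (by decide) (by decide) (by decide) (by decide) (by decide) (by decide)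
      (a := m0) (b := m1) (c := c2) (d := c3) (e := -1) (by rw [h5, h0]; module)
    simp at this
  have hs : c2 + c3 + c4 = 1 := by
    have := h.apply_eq_one 5 (by decide) (by decide)
    rw [h5] at this
    simpa [h.apply_self, h.apply_self', h.apply_eq_one 2 (by decide) (by decide),
      h.apply_eq_one 3 (by decide) (by decide), h.apply_eq_one 4 (by decide) (by decide)] using this
  obtain ⟨e0, e1, e2, e3, e4⟩ := h.apply_two_three m0 m1 c2 c3 c4
  rw [← h5] at e0 e1 e2 e3 e4
  simp only [h.sing, LinearMap.zero_apply, hs, mul_one, zero_eq_mul, two_ne_zero, false_or]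
    at e0 e1 e2 e3 e4
  have tp := h.tangent_relation
  have tq := h.tangent_relation'
  have hnp := fun hr s t hst => h.not_proportional hr (s := s) (t := t) hst
  have hcurve := h.not_rational_curve
  refine ⟨c2, c3, c4, hc2, hc3, hc4, ?_⟩
  generalize T (v 0) (v 2) (v 3) = p1 at *
  generalize T (v 0) (v 3) (v 4) = p2 at *
  generalize T (v 0) (v 2) (v 4) = p3 at *
  generalize T (v 1) (v 2) (v 3) = q1 at *
  generalize T (v 1) (v 3) (v 4) = q2 at *
  generalize T (v 1) (v 2) (v 4) = q3 at *
  generalize T (v 2) (v 3) (v 4) = r at *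
  obtain ⟨hr, f1, f2, f3⟩ := sixth_point_relations hs hc2 hc3 hc4 e0 e1 e2 e3 e4
  have hr0 : r = 0 := by
    by_contra hr0
    have hm0 : m0 ≠ 0 := fun h0 => by simp [h0, hr0, hc2, hc3, hc4] at hr
    have hm1 : m1 ≠ 0 := fun h0 => by simp [h0, hr0, hc2, hc3, hc4] at hr
    -- halves of the coordinates of the two points of the dual conic
    set k1 := (p2 + p3 - p1) / 2 with hk1
    set k2 := (p1 + p3 - p2) / 2 with hk2
    set k3 := (p1 + p2 - p3) / 2 with hk3
    set l1 := (q2 + q3 - q1) / 2 with hl1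
    set l2 := (q1 + q3 - q2) / 2 with hl2
    set l3 := (q1 + q2 - q3) / 2 with hl3
    have g1 : r * (c2 * c3) = -(m1 * l1 + m0 * k1) := by
      rw [hk1, hl1]; linear_combination f1 / 2
    have g2 : r * (c3 * c4) = -(m1 * l2 + m0 * k2) := by
      rw [hk2, hl2]; linear_combination f2 / 2
    have g3 : r * (c2 * c4) = -(m1 * l3 + m0 * k3) := by
      rw [hk3, hl3]; linear_combination f3 / 2
    have hk : k1 * k2 + k2 * k3 + k1 * k3 = 0 := by
      rw [hk1, hk2, hk3]; linear_combination -tp / 4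
    have hl : l1 * l2 + l2 * l3 + l1 * l3 = 0 := by
      rw [hl1, hl2, hl3]; linear_combination -tq / 4
    have P1 : p1 = k2 + k3 := by rw [hk2, hk3]; ring
    have P2 : p2 = k1 + k3 := by rw [hk1, hk3]; ring
    have P3 : p3 = k1 + k2 := by rw [hk1, hk2]; ring
    have Q1 : q1 = l2 + l3 := by rw [hl2, hl3]; ring
    have Q2 : q2 = l1 + l3 := by rw [hl1, hl3]; ring
    have Q3 : q3 = l1 + l2 := by rw [hl1, hl2]; ring
    have hrb : r = (k2 + k3) * l1 + (k1 + k3) * l2 + (k1 + k2) * l3 := by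
      apply mul_left_cancel₀ hm1
      rw [P1, P2, P3] at e0
      linear_combination r * e0 - (k2 + k3) * g1 - (k1 + k3) * g2 - (k1 + k2) * g3 + 2 * m0 * hk
    refine hcurve k1 k2 k3 l1 l2 l3 P1 P2 P3 Q1 Q2 Q3 hk hl hrb ?_ ?_ ?_
    · intro a b; rw [a, b] at g1; simp [hr0, hc2, hc3] at g1
    · intro a b; rw [a, b] at g2; simp [hr0, hc4, hc3] at g2
    · intro a b; rw [a, b] at g3; simp [hr0, hc4, hc2] at g3
  subst hr0
  have hm : m0 * m1 = 0 := by rw [← hr, zero_mul]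
  have hm0 : m0 = 0 := by
    by_contra h0
    have h1 : m1 = 0 := (mul_eq_zero.1 hm).resolve_left h0
    subst h1
    have k1 : p2 + p3 - p1 = 0 := by simpa [h0] using f1
    have k2 : p1 + p3 - p2 = 0 := by simpa [h0] using f2
    have k3 : p1 + p2 - p3 = 0 := by simpa [h0] using f3
    have a1 : 2 * p1 = 0 := by linear_combination k2 + k3
    have a2 : 2 * p2 = 0 := by linear_combination k1 + k3
    have a3 : 2 * p3 = 0 := by linear_combination k1 + k2
    exact hnp rfl 1 0 (Or.inl one_ne_zero) (by linear_combination a1 / 2)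
      (by linear_combination a2 / 2) (by linear_combination a3 / 2)
  subst hm0
  have hm1 : m1 = 0 := by
    by_contra h0
    have k1 : q2 + q3 - q1 = 0 := by simpa [h0] using f1
    have k2 : q1 + q3 - q2 = 0 := by simpa [h0] using f2
    have k3 : q1 + q2 - q3 = 0 := by simpa [h0] using f3
    have a1 : 2 * q1 = 0 := by linear_combination k2 + k3
    have a2 : 2 * q2 = 0 := by linear_combination k1 + k3
    have a3 : 2 * q3 = 0 := by linear_combination k1 + k2
    exact hnp rfl 0 1 (Or.inr one_ne_zero) (by linear_combination a1 / 2)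
      (by linear_combination a2 / 2) (by linear_combination a3 / 2)
  subst hm1
  refine ⟨by rw [h5]; module, rfl, by simpa using e0, by simpa using e1⟩

theorem not_degenerate_two (h : IsBidegenerate T v) : ¬ IsDegenerateAt T (v 2) := by
  rintro ⟨u, hu, hTu⟩
  obtain ⟨c2, c3, c4, hc2, hc3, hc4, -, hr, hp, hq⟩ := h.exists_sixth
  obtain ⟨a, b, x, y, z, rfl⟩ := h.exists_coords u
  have e0 := congrArg (fun φ => φ (v 0)) hTu
  have e1 := congrArg (fun φ => φ (v 1)) hTu
  have e3 := congrArg (fun φ => φ (v 3)) hTu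
  have e4 := congrArg (fun φ => φ (v 4)) hTu
  have h2 := h.apply_eq_one 2 (by decide) (by decide)
  simp only [map_add, map_smul, LinearMap.add_apply, LinearMap.smul_apply, h.apply_self,
      h.apply_self', h.sing, LinearMap.zero_apply, smul_eq_mul, mul_zero, mul_one,
      zero_add, add_zero, h.symm.swap_left (v 1) (v 0), h.symm.swap_left (v 2) (v 0),
      h.symm.swap_left (v 3) (v 0), h.symm.swap_left (v 4) (v 0), h.symm.swap_left (v 2) (v 1),
      h.symm.swap_left (v 3) (v 1), h.symm.swap_left (v 4) (v 1), h.symm.swap_left (v 3) (v 2),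
      h.symm.swap_left (v 4) (v 2), h.symm.swap_left (v 4) (v 3),
      h.symm.swap_right _ (v 2) (v 0),
      h.symm.swap_right _ (v 3) (v 0), h.symm.swap_right _ (v 4) (v 0),
      h.symm.swap_right _ (v 2) (v 1), h.symm.swap_right _ (v 3) (v 1),
      h.symm.swap_right _ (v 4) (v 1), h.symm.swap_right _ (v 3) (v 2),
      h.symm.swap_right _ (v 4) (v 2), h.symm.swap_right _ (v 4) (v 3), h2, hr] at e0 e1 e3 e4
  have hnp := fun s t hst => h.not_proportional hr (s := s) (t := t) hst
  generalize T (v 0) (v 2) (v 3) = p1 at *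
  generalize T (v 0) (v 3) (v 4) = p2 at *
  generalize T (v 0) (v 2) (v 4) = p3 at *
  generalize T (v 1) (v 2) (v 3) = q1 at *
  generalize T (v 1) (v 3) (v 4) = q2 at *
  generalize T (v 1) (v 2) (v 4) = q3 at *
  have hD : p1 * q3 - p3 * q1 ≠ 0 := by
    intro hD
    have key : ∀ s t : k, s * p1 + t * q1 = 0 → s * p3 + t * q3 = 0 → s * p2 + t * q2 = 0 := by
      intro s t h1 h3
      have : c3 * c4 * (s * p2 + t * q2) = 0 := by
        linear_combination s * hp + t * hq - c2 * c3 * h1 - c2 * c4 * h3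
      exact (mul_eq_zero.1 this).resolve_left (mul_ne_zero hc3 hc4)
    by_cases h1 : p1 = 0
    · by_cases h3 : p3 = 0
      · have a1 : (1 : k) * p1 + 0 * q1 = 0 := by simp [h1]
        have a3 : (1 : k) * p3 + 0 * q3 = 0 := by simp [h3]
        exact hnp _ _ (Or.inl one_ne_zero) a1 (key _ _ a1 a3) a3
      · have a1 : q3 * p1 + -p3 * q1 = 0 := by linear_combination hD
        have a3 : q3 * p3 + -p3 * q3 = 0 := by ring
        exact hnp _ _ (Or.inr (neg_ne_zero.2 h3)) a1 (key _ _ a1 a3) a3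
    · have a1 : q1 * p1 + -p1 * q1 = 0 := by ring
      have a3 : q1 * p3 + -p1 * q3 = 0 := by linear_combination -hD
      exact hnp _ _ (Or.inr (neg_ne_zero.2 h1)) a1 (key _ _ a1 a3) a3
  have ha : a = 0 := by
    have : (p1 * q3 - p3 * q1) * a = 0 := by linear_combination q3 * e3 - q1 * e4
    exact (mul_eq_zero.1 this).resolve_left hD
  have hb : b = 0 := by
    have : (p1 * q3 - p3 * q1) * b = 0 := by linear_combination p1 * e4 - p3 * e3
    exact (mul_eq_zero.1 this).resolve_left hD
  subst ha hb
  have hy : y = 0 := by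
    have : (p1 * q3 - p3 * q1) * y = 0 := by linear_combination q3 * e0 - p3 * e1
    exact (mul_eq_zero.1 this).resolve_left hD
  have hz : z = 0 := by
    have : (p1 * q3 - p3 * q1) * z = 0 := by linear_combination p1 * e1 - q1 * e0
    exact (mul_eq_zero.1 this).resolve_left hD
  subst hy hz
  exact hu (Submodule.mem_span_singleton.2 ⟨x, by module⟩)

/-- All other singular points are nodes. -/
theorem not_degenerate (h : IsBidegenerate T v) {i : Fin 6} (h0 : i ≠ 0) (h1 : i ≠ 1) :
    ¬ IsDegenerateAt T (v i) := by
  have := (h.comp_perm_of_fix (Equiv.swap 2 i)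
    (Equiv.swap_apply_of_ne_of_ne (by decide) h0.symm)
    (Equiv.swap_apply_of_ne_of_ne (by decide) h1.symm)).not_degenerate_two
  simpa using this

end IsBidegenerate

end Bidegenerate

end CubicThreefold

namespace CubicThreefold

open Module

section Bidegenerate

variable {k V : Type*} [Field k] [AddCommGroup V] [Module k V]

/-- The cubic does not vanish on the radical of the tangent cone at `v`. -/
def IsCuspidalAt (T : V →ₗ[k] V →ₗ[k] V →ₗ[k] k) (v : V) : Prop :=
  ∃ u, u ∉ Submodule.span k {v} ∧ T v u = 0 ∧ T u u u ≠ 0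

/-- Coordinates adapted to a degenerate singular vector `v`: the cubic is
`y₁ y₂ l + y₁ Q₁ + y₂ Q₂` with `Q₁ = a²` and `Q₂ = b²` up to scalars modulo `l`. -/
structure IsAdapted (T : V →ₗ[k] V →ₗ[k] V →ₗ[k] k) (v v' o e n : V) : Prop where
  indep : LinearIndependent k ![v, v', o, e, n]
  sing : T v v = 0
  sing' : T v' v' = 0
  apply_o : T v v' o = 1
  apply_e : T v v' e = 0
  apply_n : T v v' n = 0
  plane : ∀ x ∈ Submodule.span k {o, e, n}, ∀ y ∈ Submodule.span k {o, e, n},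
    ∀ z ∈ Submodule.span k {o, e, n}, T x y z = 0
  oo : T v o o = 0
  oo' : T v' o o = 0
  nn : T v n n = 0
  ne : T v n e = 0
  ee : T v e e ≠ 0
  nn' : T v' n n ≠ 0
  ne' : T v' n e = 0
  ee' : T v' e e = 0
  oe : T v o n = 0 → T v o e ≠ 0

theorem exists_isotropic_of_sq_eq {A B D : k} (h : B ^ 2 = A * D) :
    ∃ s t : k, (s ≠ 0 ∨ t ≠ 0) ∧ A * s + B * t = 0 ∧ B * s + D * t = 0 := by
  by_cases hA : A = 0
  · have hB : B = 0 := by simpa [hA] using h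
    exact ⟨1, 0, Or.inl one_ne_zero, by simp [hA], by simp [hB]⟩
  · exact ⟨-B, A, Or.inr hA, by ring, by linear_combination -h⟩

theorem exists_eq_mul_of_isotropic {A B D s t : k} (hst : s ≠ 0 ∨ t ≠ 0)
    (h1 : A * s + B * t = 0) (h2 : B * s + D * t = 0) :
    ∃ m, A = m * t ^ 2 ∧ B = -(m * (s * t)) ∧ D = m * s ^ 2 := by
  by_cases ht : t = 0
  · have hs : s ≠ 0 := by tauto
    have hA : A = 0 := by simpa [ht, hs] using h1
    have hB : B = 0 := by simpa [ht, hs] using h2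
    exact ⟨D / s ^ 2, by simp [ht, hA], by simp [ht, hB], by field_simp⟩
  · refine ⟨A / t ^ 2, by field_simp, by field_simp; linear_combination h1, ?_⟩
    field_simp
    linear_combination t * h2 - s * h1

namespace IsBidegenerate

variable {T : V →ₗ[k] V →ₗ[k] V →ₗ[k] k} {v : Fin 6 → V}
variable [IsAlgClosed k] [CharZero k] [FiniteDimensional k V]

theorem apply_plane (h : IsBidegenerate T v) {x y z : V}
    (hx : x ∈ Submodule.span k {v 2, v 3, v 4}) (hy : y ∈ Submodule.span k {v 2, v 3, v 4})
    (hz : z ∈ Submodule.span k {v 2, v 3, v 4}) : T x y z = 0 := by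
  obtain ⟨_, _, _, -, -, -, -, hr, -, -⟩ := h.exists_sixth
  obtain ⟨a1, a2, a3, rfl⟩ := Submodule.mem_span_triple.1 hx
  obtain ⟨b1, b2, b3, rfl⟩ := Submodule.mem_span_triple.1 hy
  obtain ⟨c1, c2, c3, rfl⟩ := Submodule.mem_span_triple.1 hz
  simp [h.apply_self, h.apply_self', h.sing, h.symm.swap_left (v 3) (v 2),
      h.symm.swap_left (v 4) (v 2), h.symm.swap_left (v 4) (v 3),
      h.symm.swap_right _ (v 3) (v 2),
      h.symm.swap_right _ (v 4) (v 2), h.symm.swap_right _ (v 4) (v 3), hr]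

theorem exists_isAdapted (h : IsBidegenerate T v) :
    ∃ e n : V, e ∈ Submodule.span k {v 2, v 3, v 4} ∧ n ∈ Submodule.span k {v 2, v 3, v 4} ∧
      IsAdapted T (v 0) (v 1) (v 2) e n := by
  obtain ⟨c2, c3, c4, hc2, hc3, hc4, -, hr, hp, hq⟩ := h.exists_sixth
  have hnp := fun s t hst => h.not_proportional hr (s := s) (t := t) hst
  have tp := h.tangent_relation
  have tq := h.tangent_relation'
  have hplane := fun x hx y hy z hz => h.apply_plane (x := x) (y := y) (z := z) hx hy hz
  have hmem : ∀ a b c : k, a • v 2 + b • v 3 + c • v 4 ∈ Submodule.span k {v 2, v 3, v 4} :=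
    fun a b c => Submodule.mem_span_triple.2 ⟨a, b, c, rfl⟩
  set p1 := T (v 0) (v 2) (v 3) with hp1
  set p2 := T (v 0) (v 3) (v 4) with hp2
  set p3 := T (v 0) (v 2) (v 4) with hp3
  set q1 := T (v 1) (v 2) (v 3) with hq1
  set q2 := T (v 1) (v 3) (v 4) with hq2
  set q3 := T (v 1) (v 2) (v 4) with hq3
  obtain ⟨s, t, hst, s1, s2⟩ := exists_isotropic_of_sq_eq (A := -2 * p1) (B := p1 + p2 - p3)
    (D := -2 * p2) (by linear_combination tp)
  obtain ⟨s', t', hst', s1', s2'⟩ := exists_isotropic_of_sq_eq (A := -2 * q1) (B := q1 + q2 - q3)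
    (D := -2 * q2) (by linear_combination tq)
  obtain ⟨m, a1, a2, a3⟩ := exists_eq_mul_of_isotropic hst s1 s2
  obtain ⟨m', a1', a2', a3'⟩ := exists_eq_mul_of_isotropic hst' s1' s2'
  have hm : m ≠ 0 := fun hm => by
    simp only [hm, zero_mul, neg_zero] at a1 a2 a3
    exact hnp 1 0 (Or.inl one_ne_zero) (by linear_combination -a1 / 2)
      (by linear_combination -a3 / 2) (by linear_combination -a1 / 2 - a3 / 2 - a2)
  have hm' : m' ≠ 0 := fun hm => by
    simp only [hm, zero_mul, neg_zero] at a1' a2' a3'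
    exact hnp 0 1 (Or.inr one_ne_zero) (by linear_combination -a1' / 2)
      (by linear_combination -a3' / 2) (by linear_combination -a1' / 2 - a3' / 2 - a2')
  have hdet : s * t' - s' * t ≠ 0 := by
    intro hdet
    -- a common kernel vector would make the two pencils proportional
    have b1 : -2 * q1 * s + (q1 + q2 - q3) * t = 0 := by
      rw [a1', a2']; linear_combination m' * t' * hdet
    have b2 : (q1 + q2 - q3) * s + -2 * q2 * t = 0 := by
      rw [a2', a3']; linear_combination -m' * s' * hdet
    obtain ⟨m'', b1, b2, b3⟩ := exists_eq_mul_of_isotropic hst b1 b2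
    have x1 : m'' * p1 + -m * q1 = 0 := by linear_combination m * b1 / 2 - m'' * a1 / 2
    have x2 : m'' * p2 + -m * q2 = 0 := by linear_combination m * b3 / 2 - m'' * a3 / 2
    refine hnp m'' (-m) (Or.inr (neg_ne_zero.2 hm)) x1 x2 ?_
    linear_combination x1 + x2 + m * b2 - m'' * a2
  set n := s • v 2 + (t - s) • v 3 + (-t) • v 4 with hn
  set e := s' • v 2 + (t' - s') • v 3 + (-t') • v 4 with he
  have h2 := h.apply_eq_one 2 (by decide) (by decide)
  have h3 := h.apply_eq_one 3 (by decide) (by decide)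
  have h4 := h.apply_eq_one 4 (by decide) (by decide)
  have h2m : v 2 ∈ Submodule.span k {v 2, v 3, v 4} := Submodule.subset_span (by simp)
  have hspan : Submodule.span k {v 2, e, n} ≤ Submodule.span k {v 2, v 3, v 4} := by
    rw [Submodule.span_le]
    rintro x (rfl | rfl | rfl)
    exacts [h2m, hmem _ _ _, hmem _ _ _]
  have hval : ∀ i : Fin 6, ∀ x y x' y' : k,
      T (v i) (x • v 2 + (y - x) • v 3 + (-y) • v 4) (x' • v 2 + (y' - x') • v 3 + (-y') • v 4) =
      (-2 * T (v i) (v 2) (v 3)) * x * x' +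
      (T (v i) (v 2) (v 3) + T (v i) (v 3) (v 4) - T (v i) (v 2) (v 4)) * (x * y' + y * x') +
      (-2 * T (v i) (v 3) (v 4)) * y * y' := by
    intro i x y x' y'
    simp only [map_add, map_smul, LinearMap.add_apply, LinearMap.smul_apply, h.apply_self,
      smul_eq_mul, h.symm.swap_right _ (v 3) (v 2),
      h.symm.swap_right _ (v 4) (v 2), h.symm.swap_right _ (v 4) (v 3)]
    ring
  have hee : T (v 0) e e = m * (s * t' - s' * t) ^ 2 := by
    rw [hval, ← hp1, ← hp2, ← hp3, a1, a2, a3]; ring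
  have hnn' : T (v 1) n n = m' * (s * t' - s' * t) ^ 2 := by
    rw [hval, ← hq1, ← hq2, ← hq3, a1', a2', a3']; ring
  have hnn : T (v 0) n n = 0 := by
    rw [hval, ← hp1, ← hp2, ← hp3, a1, a2, a3]; ring
  have hne : T (v 0) n e = 0 := by
    rw [hval, ← hp1, ← hp2, ← hp3, a1, a2, a3]; ring
  have hee' : T (v 1) e e = 0 := by
    rw [hval, ← hq1, ← hq2, ← hq3, a1', a2', a3']; ring
  have hne' : T (v 1) n e = 0 := by
    rw [hval, ← hq1, ← hq2, ← hq3, a1', a2', a3']; ring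
  refine ⟨e, n, hmem _ _ _, hmem _ _ _, ?_, h.sing _, h.sing _, h2, ?_, ?_,
    fun x hx y hy z hz => hplane x (hspan hx) y (hspan hy) z (hspan hz), h.apply_self _ _,
    h.apply_self _ _, hnn, hne, ?_, ?_, hne', hee', ?_⟩
  · rw [Fintype.linearIndependent_iff]
    intro g hg
    have h5 := Fintype.linearIndependent_iff.1 h.linearIndependent_five
      ![g 0, g 1, g 2 + g 3 * s' + g 4 * s, g 3 * (t' - s') + g 4 * (t - s),
        -(g 3 * t' + g 4 * t)] (by
        rw [← hg]
        simp only [Fin.sum_univ_five, Matrix.cons_val, hn, he]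
        module)
    have i0 := h5 0
    have i1 := h5 1
    have i2 := h5 2
    have i3 := h5 3
    have i4 := h5 4
    simp only [Matrix.cons_val] at i0 i1 i2 i3 i4
    have j3 : g 3 = 0 := by
      have : (s * t' - s' * t) * g 3 = 0 := by linear_combination -(s - t) * i4 + t * i3
      exact (mul_eq_zero.1 this).resolve_left hdet
    have j4 : g 4 = 0 := by
      have : (s * t' - s' * t) * g 4 = 0 := by linear_combination -(t' - s') * i4 - t' * i3
      exact (mul_eq_zero.1 this).resolve_left hdet
    have j2 : g 2 = 0 := by simpa [j3, j4] using i2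
    intro i
    fin_cases i
    exacts [i0, i1, j2, j3, j4]
  · simp [he, h2, h3, h4]
  · simp [hn, h2, h3, h4]
  · rw [hee]; exact mul_ne_zero hm (pow_ne_zero _ hdet)
  · rw [hnn']; exact mul_ne_zero hm' (pow_ne_zero _ hdet)
  · intro hon hoe
    simp only [hn, he, map_add, map_smul, h.apply_self, smul_eq_mul, mul_zero, zero_add,
      ← hp1, ← hp3] at hon hoe
    have y1 : p1 = p3 := by
      have : (s * t' - s' * t) * (p1 - p3) = 0 := by
        linear_combination s * hoe - s' * hon
      exact sub_eq_zero.1 ((mul_eq_zero.1 this).resolve_left hdet)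
    have y2 : p1 = 0 := by
      have : (s * t' - s' * t) * p1 = 0 := by
        linear_combination t * hoe - t' * hon
      exact (mul_eq_zero.1 this).resolve_left hdet
    have y3 : p3 = 0 := by rw [← y1, y2]
    have y4 : p2 = 0 := by
      have : p2 * (c3 * c4) = 0 := by rw [y2, y3] at hp; linear_combination hp
      exact (mul_eq_zero.1 this).resolve_right (mul_ne_zero hc3 hc4)
    exact hnp 1 0 (Or.inl one_ne_zero) (by simp [y2]) (by simp [y4]) (by simp [y3])

end IsBidegenerate

namespace IsAdapted

variable {T : V →ₗ[k] V →ₗ[k] V →ₗ[k] k} {v v' o e n : V}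
variable [CharZero k] [FiniteDimensional k V]

theorem isCuspidalAt_iff (hV : finrank k V = 5) (hT : IsSymmTrilinear T)
    (h : IsAdapted T v v' o e n) : IsCuspidalAt T v ↔ T v o n ≠ 0 := by
  let b := basisOfLinearIndependentOfCardEqFinrank h.indep (by simp [hV])
  have hb : ⇑b = ![v, v', o, e, n] := by simp [b]
  have hn : n ∈ Submodule.span k {o, e, n} := Submodule.subset_span (by simp)
  have hvz : ∀ z, T v v z = 0 := fun z => by rw [h.sing]; rfl
  have hvz' : ∀ z, T v' v' z = 0 := fun z => by rw [h.sing']; rfl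
  have s1 : ∀ x, T x v v = 0 := fun x => by rw [hT.swap_left, hT.swap_right, hvz]
  have s2 : ∀ x, T v x v = 0 := fun x => by rw [hT.swap_right, hvz]
  have s3 : ∀ x, T x v' v' = 0 := fun x => by rw [hT.swap_left, hT.swap_right, hvz']
  have s4 : ∀ x, T v' x v' = 0 := fun x => by rw [hT.swap_right, hvz']
  set g := T v o n with hg
  have key : ∀ x c : k, T (x • v + c • (n - g • v')) (x • v + c • (n - g • v'))
      (x • v + c • (n - g • v')) = c ^ 3 * (-3 * g * T v' n n) := by
    intro x c
    simp only [map_add, map_smul, map_sub, LinearMap.add_apply, LinearMap.smul_apply,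
      LinearMap.sub_apply, hvz, hvz', s1, s2, s3, s4, h.plane n hn n hn n hn, hT.swap_left n v,
      hT.swap_left v' v, hT.swap_left n v', hT.swap_right _ n v, hT.swap_right _ v' v,
      hT.swap_right _ n v', h.nn, h.apply_n, smul_eq_mul]
    ring
  have hker : T v (n - g • v') = 0 := by
    apply b.ext
    intro i
    rw [hb]
    fin_cases i <;>
    simp [s2, s4, hT.swap_right v n v', h.apply_n, h.apply_o, h.apply_e, hT.swap_right v n o,
      ← hg, h.ne, h.nn, s3]
  have hcoord : ∀ u, T v u = 0 → ∃ x c : k, u = x • v + c • (n - g • v') := by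
    intro u hu
    obtain ⟨x, y, l, a, c, rfl⟩ : ∃ x y l a c : k,
        u = x • v + y • v' + l • o + a • e + c • n := by
      refine ⟨b.repr u 0, b.repr u 1, b.repr u 2, b.repr u 3, b.repr u 4, ?_⟩
      have := b.sum_repr u
      rw [Fin.sum_univ_five, hb] at this
      exact this.symm
    have i1 := congrArg (fun φ => φ v') hu
    have i2 := congrArg (fun φ => φ o) hu
    have i3 := congrArg (fun φ => φ e) hu
    simp only [map_add, map_smul, LinearMap.add_apply, LinearMap.smul_apply, hvz, s2, s3,
      hT.swap_right v o v', hT.swap_right v e v', hT.swap_right v n v', h.apply_o, h.apply_e,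
      h.apply_n, LinearMap.zero_apply, hT.swap_right v e o, hT.swap_right v n o, h.oo,
      ← hg, h.ne, smul_eq_mul, mul_zero, mul_one, add_zero, zero_add] at i1 i2 i3
    have ha : a = 0 := by
      rw [i1, zero_mul, zero_add] at i3
      exact (mul_eq_zero.1 i3).resolve_right h.ee
    have hy : y = -(c * g) := by rw [ha] at i2; linear_combination i2
    exact ⟨x, c, by rw [i1, ha, hy]; module⟩
  constructor
  · rintro ⟨u, -, hu, hu3⟩ h0
    obtain ⟨x, c, rfl⟩ := hcoord u hu
    rw [key, h0] at hu3
    simp at hu3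
  · intro h0
    refine ⟨n - g • v', fun hm => ?_, hker, ?_⟩
    · obtain ⟨c, hc⟩ := Submodule.mem_span_singleton.1 hm
      have := Fintype.linearIndependent_iff.1 h.indep ![-c, -g, 0, 0, 1] (by
        simp only [Fin.sum_univ_five, Matrix.cons_val]
        rw [neg_smul, hc]; module) 4
      simp at this
    · have := key 0 1
      simp only [zero_smul, one_smul, zero_add] at this
      rw [this]
      simp [h0, h.nn']

end IsAdapted

end Bidegenerate

end CubicThreefold

namespace CubicThreefold

open MvPowerSeries

section FormalCoordinates

variable {k : Type*} [Field k] {n : ℕ}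

/-- The ideal of `k⟦X₁, …, Xₙ⟧` generated by the variables. -/
noncomputable def varIdeal (k : Type*) [Field k] (n : ℕ) : Ideal (MvPowerSeries (Fin n) k) :=
  Ideal.span (Set.range X)

theorem mem_varIdeal_iff {f : MvPowerSeries (Fin n) k} :
    f ∈ varIdeal k n ↔ ∃ h : Fin n → MvPowerSeries (Fin n) k, f = ∑ i, X i * h i := by
  rw [varIdeal, Ideal.mem_span_range_iff_exists_fun]
  constructor
  · rintro ⟨c, rfl⟩; exact ⟨c, Finset.sum_congr rfl fun _ _ => mul_comm _ _⟩
  · rintro ⟨c, rfl⟩; exact ⟨c, Finset.sum_congr rfl fun _ _ => mul_comm _ _⟩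

theorem mem_varIdeal_of_constantCoeff {f : MvPowerSeries (Fin n) k} (hf : constantCoeff f = 0) :
    f ∈ varIdeal k n := by
  classical
  let g : Fin n → MvPowerSeries (Fin n) k := fun i m =>
    if m i ≠ 0 ∧ ∀ j < i, m j = 0 then coeff m f else 0
  have hg : ∀ i m, coeff m (g i) = if m i ≠ 0 ∧ ∀ j < i, m j = 0 then coeff m f else 0 :=
    fun _ _ => rfl
  have hd : ∀ i, ∃ h, g i = X i * h := fun i => X_dvd_iff.2 fun m hm => by
    rw [hg, if_neg fun h => h.1 hm]
  choose h hh using hd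
  refine mem_varIdeal_iff.2 ⟨h, ?_⟩
  simp_rw [← hh]
  ext m
  rw [map_sum]
  simp_rw [hg]
  by_cases hm : m = 0
  · subst hm
    simpa using hf
  · have hex : (Finset.univ.filter fun i : Fin n => m i ≠ 0).Nonempty := by
      obtain ⟨i, hi⟩ := Finsupp.ne_iff.1 hm
      exact ⟨i, by simpa using hi⟩
    set i₀ := (Finset.univ.filter fun i : Fin n => m i ≠ 0).min' hex with hi₀
    have hmem : m i₀ ≠ 0 := by simpa using Finset.min'_mem _ hex
    have hlt : ∀ j < i₀, m j = 0 := fun j hj => by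
      by_contra hne
      exact absurd (Finset.min'_le (Finset.univ.filter fun i : Fin n => m i ≠ 0) j (by simpa using hne))
        (not_le.2 hj)
    rw [Finset.sum_eq_single i₀, if_pos ⟨hmem, hlt⟩]
    · intro j _ hj
      rw [if_neg]
      rintro ⟨h1, h2⟩
      rcases lt_or_gt_of_ne hj with h | h
      · exact h1 (hlt j h)
      · exact hmem (h2 i₀ h)
    · simp

theorem constantCoeff_of_mem_varIdeal {f : MvPowerSeries (Fin n) k} (hf : f ∈ varIdeal k n) :
    constantCoeff f = 0 := by
  obtain ⟨h, rfl⟩ := mem_varIdeal_iff.1 hf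
  simp

theorem mem_varIdeal_sq {f : MvPowerSeries (Fin n) k} (hf : constantCoeff f = 0)
    (hd : ∀ i, constantCoeff (pderiv k i f) = 0) : f ∈ varIdeal k n ^ 2 := by
  obtain ⟨h, rfl⟩ := mem_varIdeal_iff.1 (mem_varIdeal_of_constantCoeff hf)
  refine Ideal.sum_mem _ fun i _ => ?_
  rw [pow_two]
  refine Ideal.mul_mem_mul (Ideal.subset_span ⟨i, rfl⟩) (mem_varIdeal_of_constantCoeff ?_)
  have := hd i
  rw [map_sum, map_sum, Finset.sum_eq_single i] at this
  · simpa using this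
  · intro j _ hj
    simp [pderiv_X_of_ne hj]
  · simp

theorem le_order_of_mem_varIdeal_pow {f : MvPowerSeries (Fin n) k} {d : ℕ}
    (hf : f ∈ varIdeal k n ^ d) : (d : ℕ∞) ≤ f.order := by
  induction d generalizing f with
  | zero => simp
  | succ d ih =>
    rw [pow_succ'] at hf
    refine Submodule.mul_induction_on hf (fun x hx y hy => ?_) (fun x y hx hy => ?_)
    · refine le_trans ?_ le_order_mul
      rw [Nat.cast_succ, add_comm]
      exact add_le_add (one_le_order_iff_constCoeff_eq_zero.2 (constantCoeff_of_mem_varIdeal hx))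
        (ih hy)
    · exact (le_min hx hy).trans min_order_le_add

theorem eq_zero_of_forall_le_order {f : MvPowerSeries (Fin n) k} (h : ∀ d : ℕ, (d : ℕ∞) ≤ f.order) :
    f = 0 := by
  rw [← order_eq_top_iff]
  exact ENat.eq_top_iff_forall_ge.2 h

/-- A substitution that is the identity to first order is bijective. -/
theorem bijective_subst_of_sub_X_mem {z : Fin n → MvPowerSeries (Fin n) k}
    (hz : ∀ i, z i - X i ∈ varIdeal k n ^ 2) (hs : HasSubst z) :
    Function.Bijective (substAlgHom (R := k) hs) := by
  set θ := substAlgHom (R := k) hs with hθ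
  have hz1 : ∀ i, constantCoeff (z i) = 0 := fun i => by
    have h1 := constantCoeff_of_mem_varIdeal (Ideal.pow_le_self two_ne_zero (hz i))
    simpa using h1
  have hX : ∀ i, (X i : MvPowerSeries (Fin n) k) ∈ varIdeal k n := fun i =>
    Ideal.subset_span ⟨i, rfl⟩
  have h0 : ∀ f, θ f - f ∈ varIdeal k n := by
    intro f
    have hc : f = C (constantCoeff f) + (f - C (constantCoeff f)) := by ring
    obtain ⟨h, hh⟩ := mem_varIdeal_iff.1
      (mem_varIdeal_of_constantCoeff (f := f - C (constantCoeff f)) (by simp))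
    have hC : θ (C (constantCoeff f)) = C (constantCoeff f) := by
      simpa [MvPowerSeries.algebraMap_apply] using θ.commutes (constantCoeff f)
    have : θ f - f = ∑ i, z i * θ (h i) - ∑ i, X i * h i := by
      conv_lhs => rw [hc, hh]
      rw [map_add, map_sum, hC]
      simp only [map_mul, hθ, substAlgHom_X]
      ring
    rw [this]
    refine Ideal.sub_mem _ (Ideal.sum_mem _ fun i _ => Ideal.mul_mem_right _ _
      (mem_varIdeal_of_constantCoeff (hz1 i))) (Ideal.sum_mem _ fun i _ =>
      Ideal.mul_mem_right _ _ (hX i))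
  have h1 : ∀ f ∈ varIdeal k n, θ f - f ∈ varIdeal k n ^ 2 := by
    intro f hf
    obtain ⟨h, rfl⟩ := mem_varIdeal_iff.1 hf
    rw [map_sum, ← Finset.sum_sub_distrib]
    refine Ideal.sum_mem _ fun i _ => ?_
    have : θ (X i * h i) - X i * h i = (z i - X i) * θ (h i) + X i * (θ (h i) - h i) := by
      rw [map_mul, hθ, substAlgHom_X]; ring
    rw [this]
    refine Ideal.add_mem _ (Ideal.mul_mem_right _ _ (hz i)) ?_
    rw [pow_two]
    exact Ideal.mul_mem_mul (hX i) (h0 _)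
  have hd : ∀ d : ℕ, ∀ f ∈ varIdeal k n ^ d, θ f - f ∈ varIdeal k n ^ (d + 1) := by
    intro d
    induction d with
    | zero => intro f _; simpa using h0 f
    | succ d ih =>
      intro f hf
      rw [pow_succ'] at hf
      refine Submodule.mul_induction_on hf (fun x hx y hy => ?_) (fun x y hx hy => ?_)
      · have : θ (x * y) - x * y = (θ x - x) * θ y + x * (θ y - y) := by rw [map_mul]; ring
        rw [this]
        have hy' : θ y ∈ varIdeal k n ^ d := by
          have := Ideal.add_mem _ (Ideal.pow_le_pow_right (Nat.le_succ d) (ih y hy)) hy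
          simpa using this
        refine Ideal.add_mem _ ?_ ?_
        · rw [show d + 1 + 1 = 2 + d by ring, pow_add]
          exact Ideal.mul_mem_mul (h1 x hx) hy'
        · rw [pow_succ']
          exact Ideal.mul_mem_mul hx (ih y hy)
      · have : θ (x + y) - (x + y) = (θ x - x) + (θ y - y) := by rw [map_add]; ring
        rw [this]
        exact Ideal.add_mem _ hx hy
  let t : ℕ → MvPowerSeries (Fin n) k → MvPowerSeries (Fin n) k := fun d f =>
    (fun g => g - θ g)^[d] f
  have ht : ∀ d f, t (d + 1) f = t d f - θ (t d f) := fun d f =>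
    Function.iterate_succ_apply' _ _ _
  have htm : ∀ d f, t d f ∈ varIdeal k n ^ d := by
    intro d f
    induction d with
    | zero => simp
    | succ d ih =>
      rw [ht]
      have := Ideal.neg_mem_iff _ |>.2 (hd d _ ih)
      simpa using this
  constructor
  · rw [injective_iff_map_eq_zero]
    intro f hf
    have : ∀ d, t d f = f := by
      intro d
      induction d with
      | zero => rfl
      | succ d ih => rw [ht, ih, hf, sub_zero]
    exact eq_zero_of_forall_le_order fun d => by
      rw [← this d]
      exact le_order_of_mem_varIdeal_pow (htm d f)
  · intro f
    have hco : ∀ d f, ∀ e : Fin n →₀ ℕ, e.degree < d → coeff e (t d f) = 0 := fun d f e he =>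
      coeff_of_lt_order (lt_of_lt_of_le (by exact_mod_cast he)
        (le_order_of_mem_varIdeal_pow (htm d f)))
    let s : MvPowerSeries (Fin n) k := fun e => ∑ d ∈ Finset.range (e.degree + 1), coeff e (t d f)
    have hs' : ∀ e, coeff e s = ∑ d ∈ Finset.range (e.degree + 1), coeff e (t d f) := fun _ => rfl
    have hrem : ∀ N : ℕ, (N : ℕ∞) ≤ (s - ∑ d ∈ Finset.range N, t d f).order := by
      intro N
      refine le_order fun e he => ?_
      have he' : e.degree + 1 ≤ N := by exact_mod_cast he
      rw [map_sub, map_sum, hs', sub_eq_zero]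
      refine Finset.sum_subset (Finset.range_mono he') fun d _ hd => hco d f e ?_
      simpa using hd
    have hpart : ∀ N : ℕ, θ (∑ d ∈ Finset.range N, t d f) = f - t N f := by
      intro N
      induction N with
      | zero => simp [t]
      | succ N ih => rw [Finset.sum_range_succ, map_add, ih, ht]; ring
    have hord : ∀ g : MvPowerSeries (Fin n) k, g.order ≤ (θ g).order := by
      intro g
      refine le_trans ?_ ((le_order_subst hs g).trans_eq (by rw [hθ, coe_substAlgHom]))
      refine le_mul_of_one_le_left zero_le (le_iInf fun i => ?_)
      exact one_le_order_iff_constCoeff_eq_zero.2 (hz1 i)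
    refine ⟨s, sub_eq_zero.1 (eq_zero_of_forall_le_order fun N => ?_)⟩
    have : θ s - f = θ (s - ∑ d ∈ Finset.range N, t d f) + -(t N f) := by
      rw [map_sub, hpart]; ring
    rw [this]
    refine le_trans (le_min ((hrem N).trans (hord _)) ?_) min_order_le_add
    rw [order_neg]
    exact le_order_of_mem_varIdeal_pow (htm N f)

/-- The linear part of a tuple of power series. -/
noncomputable def linearPart (z : Fin n → MvPowerSeries (Fin n) k) : Matrix (Fin n) (Fin n) k :=
  Matrix.of fun i j => constantCoeff (pderiv k j (z i))

theorem exists_algEquiv_of_linearPart_eq_one {z : Fin n → MvPowerSeries (Fin n) k}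
    (hz : ∀ i, constantCoeff (z i) = 0) (hJ : linearPart z = 1) :
    ∃ σ : MvPowerSeries (Fin n) k ≃ₐ[k] MvPowerSeries (Fin n) k, ∀ i, σ (X i) = z i := by
  have hs : HasSubst z := hasSubst_of_constantCoeff_zero hz
  refine ⟨AlgEquiv.ofBijective (substAlgHom hs) (bijective_subst_of_sub_X_mem (fun i => ?_) hs),
    fun i => substAlgHom_X hs i⟩
  refine mem_varIdeal_sq (by simp [hz]) fun j => ?_
  have := congrFun (congrFun hJ i) j
  simp only [linearPart, Matrix.of_apply, Matrix.one_apply] at this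
  rw [map_sub, map_sub, this, pderiv_X]
  by_cases h : i = j
  · simp [h]
  · simp [h]

theorem exists_algEquiv_of_isUnit_linear (A : Matrix (Fin n) (Fin n) k) (hA : IsUnit A.det) :
    ∃ σ : MvPowerSeries (Fin n) k ≃ₐ[k] MvPowerSeries (Fin n) k,
      ∀ i, σ (X i) = ∑ j, A i j • X j := by
  have hs : ∀ B : Matrix (Fin n) (Fin n) k,
      HasSubst (fun i => ∑ j, B i j • (X j : MvPowerSeries (Fin n) k)) := fun B =>
    hasSubst_of_constantCoeff_zero fun i => by simp
  have hcomp : ∀ B D : Matrix (Fin n) (Fin n) k, B * D = 1 →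
      (substAlgHom (R := k) (hs D)).comp (substAlgHom (R := k) (hs B)) = AlgHom.id k _ := by
    intro B D hBD
    ext1 f
    have := substAlgHom_comp_substAlgHom_apply (R := k) (hs B) (hs D) f
    rw [AlgHom.comp_apply, this, AlgHom.id_apply, substAlgHom_apply]
    have hX : (fun i => substAlgHom (R := k) (hs D)
        (∑ j, B i j • (X j : MvPowerSeries (Fin n) k))) = X := by
      funext i
      rw [map_sum]
      simp only [map_smul, substAlgHom_X, Finset.smul_sum, smul_smul]
      rw [Finset.sum_comm]
      simp only [← Finset.sum_smul, ← Matrix.mul_apply, hBD, Matrix.one_apply]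
      simp
    rw [hX, subst_self]
    rfl
  exact ⟨AlgEquiv.ofAlgHom (substAlgHom (hs A)) (substAlgHom (hs A⁻¹))
    (hcomp _ _ (Matrix.nonsing_inv_mul A hA)) (hcomp _ _ (Matrix.mul_nonsing_inv A hA)),
    fun i => substAlgHom_X (hs A) i⟩

/-- The formal inverse function theorem. -/
theorem exists_algEquiv_of_isUnit_linearPart {z : Fin n → MvPowerSeries (Fin n) k}
    (hz : ∀ i, constantCoeff (z i) = 0) (hJ : IsUnit (linearPart z).det) :
    ∃ σ : MvPowerSeries (Fin n) k ≃ₐ[k] MvPowerSeries (Fin n) k, ∀ i, σ (X i) = z i := by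
  set J := linearPart z with hJdef
  obtain ⟨τ, hτ⟩ := exists_algEquiv_of_isUnit_linear J hJ
  let w : Fin n → MvPowerSeries (Fin n) k := fun i => ∑ j, J⁻¹ i j • z j
  obtain ⟨ρ, hρ⟩ := exists_algEquiv_of_linearPart_eq_one (z := w) (fun i => by simp [w, hz]) (by
    ext i j
    rw [← Matrix.nonsing_inv_mul J hJ, Matrix.mul_apply]
    simp [linearPart, w, hJdef])
  refine ⟨τ.trans ρ, fun i => ?_⟩
  rw [AlgEquiv.trans_apply, hτ, map_sum]
  simp only [map_smul, hρ, w, Finset.smul_sum, smul_smul]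
  rw [Finset.sum_comm]
  simp only [← Finset.sum_smul, ← Matrix.mul_apply, Matrix.mul_nonsing_inv J hJ, Matrix.one_apply]
  simp

end FormalCoordinates

end CubicThreefold

namespace CubicThreefold

open MvPowerSeries

section NormalForms

variable {k : Type*} [Field k] [CharZero k] {n : ℕ}

theorem exists_pow_eq_of_constantCoeff_eq_one {u : MvPowerSeries (Fin n) k}
    (hu : constantCoeff u = 1) {m : ℕ} (hm : m ≠ 0) :
    ∃ w : MvPowerSeries (Fin n) k, w ^ m = u ∧ constantCoeff w = 1 := by
  have hs : PowerSeries.HasSubst (u - 1) :=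
    PowerSeries.HasSubst.of_constantCoeff_zero (by simp [hu])
  let b : PowerSeries k := PowerSeries.binomialSeries k ((1 : ℚ) / m)
  have hb : ∀ d : ℕ, b ^ d = PowerSeries.binomialSeries k ((d : ℚ) / m) := by
    intro d
    induction d with
    | zero => simp
    | succ d ih => rw [pow_succ, ih, ← PowerSeries.binomialSeries_add]; push_cast; ring_nf
  have hbm : b ^ m = 1 + PowerSeries.X := by
    have h1 : ((m : ℚ) / m) = ((1 : ℕ) : ℚ) := by
      rw [div_self (Nat.cast_ne_zero.2 hm), Nat.cast_one]
    rw [hb, h1, PowerSeries.binomialSeries_nat, pow_one]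
  have h1 : (1 : PowerSeries k).subst (u - 1) = (1 : MvPowerSeries (Fin n) k) := by
    rw [← PowerSeries.coe_substAlgHom hs, map_one]
  refine ⟨b.subst (u - 1), ?_, ?_⟩
  · rw [← PowerSeries.subst_pow hs, hbm, PowerSeries.subst_add hs, PowerSeries.subst_X hs, h1]
    ring
  · have hb0 : b = 1 + (b - 1) := by ring
    rw [hb0, PowerSeries.subst_add hs, h1, map_add, map_one, add_eq_left]
    exact PowerSeries.constantCoeff_subst_eq_zero (by simp [hu]) _ (by simp [b])

theorem exists_pow_eq_of_constantCoeff_ne_zero [IsAlgClosed k] {u : MvPowerSeries (Fin n) k}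
    (hu : constantCoeff u ≠ 0) {m : ℕ} (hm : m ≠ 0) :
    ∃ w : MvPowerSeries (Fin n) k, w ^ m = u ∧ constantCoeff w ≠ 0 := by
  obtain ⟨c, hc⟩ := IsAlgClosed.exists_pow_nat_eq (constantCoeff u) (Nat.pos_of_ne_zero hm)
  have hc0 : c ≠ 0 := fun h => hu (by rw [← hc, h, zero_pow hm])
  obtain ⟨w, hw, hw1⟩ := exists_pow_eq_of_constantCoeff_eq_one
    (u := C (constantCoeff u)⁻¹ * u) (by simp [hu]) hm
  refine ⟨C c * w, ?_, by simp [hw1, hc0]⟩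
  rw [mul_pow, hw, ← map_pow, hc, ← mul_assoc, ← map_mul, mul_inv_cancel₀ hu, map_one, one_mul]

/-- Completing squares over the local ring `k⟦X⟧`. -/
theorem exists_sum_sq {p : ℕ} (h : Matrix (Fin p) (Fin p) (MvPowerSeries (Fin n) k))
    (h1 : ∀ i j, constantCoeff (h i j) = (1 : Matrix (Fin p) (Fin p) k) i j)
    (y : Fin p → MvPowerSeries (Fin n) k) :
    ∃ t : Matrix (Fin p) (Fin p) (MvPowerSeries (Fin n) k),
      (∀ i j, constantCoeff (t i j) = (1 : Matrix (Fin p) (Fin p) k) i j) ∧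
      ∑ i, ∑ j, h i j * y i * y j = ∑ i, (∑ j, t i j * y j) ^ 2 := by
  induction p with
  | zero => exact ⟨1, fun i => i.elim0, by simp⟩
  | succ p ih =>
    obtain ⟨w, hw, hw1⟩ := exists_pow_eq_of_constantCoeff_eq_one (u := h 0 0) (by simp [h1])
      two_ne_zero
    have hwu : w * w⁻¹ = 1 := MvPowerSeries.mul_inv_cancel _ (by simp [hw1])
    let b : Fin p → MvPowerSeries (Fin n) k := fun j => C (1 / 2) * w⁻¹ * (h 0 j.succ + h j.succ 0)
    have hb0 : ∀ j, constantCoeff (b j) = 0 := fun j => by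
      simp [b, h1, Matrix.one_apply, (Fin.succ_ne_zero j).symm]
    obtain ⟨t, ht1, ht⟩ := ih (Matrix.of fun i j => h i.succ j.succ - b i * b j) (fun i j => by
      simp [h1, hb0, Matrix.one_apply]) (fun j => y j.succ)
    refine ⟨Matrix.of (Fin.cons (Fin.cons w b) fun i => Fin.cons 0 (t i)), ?_, ?_⟩
    · intro i j
      refine Fin.cases ?_ (fun i => ?_) i <;> refine Fin.cases ?_ (fun j => ?_) j
      · simp [hw1]
      · simp [hb0, Matrix.one_apply, (Fin.succ_ne_zero j).symm]
      · simp [Matrix.one_apply]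
      · simp [ht1, Matrix.one_apply]
    · have hC : (C (1 / 2) : MvPowerSeries (Fin n) k) * 2 = 1 := by
        rw [← map_ofNat C 2, ← map_mul]; simp
      have hb2 : ∀ j, 2 * w * b j = h 0 j.succ + h j.succ 0 := fun j => by
        simp only [b]
        linear_combination (w * w⁻¹ * (h 0 j.succ + h j.succ 0)) * hC +
          (h 0 j.succ + h j.succ 0) * hwu
      have hsq : (∑ j : Fin p, b j * y j.succ) ^ 2 =
          ∑ i : Fin p, ∑ j : Fin p, b i * b j * y i.succ * y j.succ := by
        rw [pow_two, Finset.sum_mul_sum]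
        exact Finset.sum_congr rfl fun i _ => Finset.sum_congr rfl fun j _ => by ring
      have hlin : 2 * w * y 0 * ∑ j : Fin p, b j * y j.succ =
          ∑ j : Fin p, h 0 j.succ * y 0 * y j.succ + ∑ j : Fin p, h j.succ 0 * y j.succ * y 0 := by
        rw [Finset.mul_sum, ← Finset.sum_add_distrib]
        exact Finset.sum_congr rfl fun j _ => by linear_combination y 0 * y j.succ * hb2 j
      simp only [Fin.sum_univ_succ (n := p), Matrix.of_apply, Fin.cons_zero, Fin.cons_succ, zero_mul,
        zero_add, ← ht, sub_mul, Finset.sum_sub_distrib, Finset.sum_add_distrib]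
      rw [← hsq]
      linear_combination -(y 0 ^ 2) * hw - hlin

/-- The formal Morse lemma. -/
theorem exists_algEquiv_sum_sq (c : Fin n → Fin n → MvPowerSeries (Fin n) k)
    (hc : ∀ i j, constantCoeff (c i j) = 0) :
    ∃ θ : MvPowerSeries (Fin n) k ≃ₐ[k] MvPowerSeries (Fin n) k,
      θ (∑ i, X i ^ 2 + ∑ i, ∑ j, c i j * X i * X j) = ∑ i, X i ^ 2 := by
  obtain ⟨t, ht1, ht⟩ := exists_sum_sq (n := n) (1 + Matrix.of c)
    (fun i j => by by_cases h : i = j <;> simp [hc, Matrix.one_apply, h]) X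
  obtain ⟨σ, hσ⟩ := exists_algEquiv_of_linearPart_eq_one
    (z := fun i => ∑ j, t i j * X j) (fun i => by simp) (by
      ext i j
      simp only [linearPart, Matrix.of_apply, map_sum, Derivation.leibniz, smul_eq_mul, map_add,
        map_mul, constantCoeff_X, zero_mul, add_zero, ht1]
      rw [Finset.sum_eq_single j]
      · simp
      · intro l _ hl
        simp [pderiv_X_of_ne hl]
      · simp)
  refine ⟨σ.symm, ?_⟩
  rw [AlgEquiv.symm_apply_eq, map_sum]
  simp only [map_pow, hσ, ← ht, Matrix.add_apply, Matrix.of_apply, add_mul,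
    Finset.sum_add_distrib]
  congr 1
  refine Finset.sum_congr rfl fun i _ => ?_
  rw [Finset.sum_eq_single i]
  · simp [pow_two]
  · intro j _ hj
    simp [Matrix.one_apply, hj.symm]
  · simp

/-- A power series of the form `p q + a² + b^(m+1) u`, where `p, q, a, b` are formal coordinates
and `u` is a unit, defines a singularity of type `A_m`. -/
theorem exists_algEquiv_normalForm [IsAlgClosed k] {p q a b u g : MvPowerSeries (Fin 4) k} (m : ℕ)
    (hg : g = p * q + a ^ 2 + b ^ (m + 1) * u) (hu : constantCoeff u ≠ 0)
    (hp : constantCoeff p = 0) (hq : constantCoeff q = 0) (ha : constantCoeff a = 0)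
    (hb : constantCoeff b = 0) (hdet : IsUnit (linearPart ![p, q, a, b]).det) :
    ∃ θ : MvPowerSeries (Fin 4) k ≃ₐ[k] MvPowerSeries (Fin 4) k,
      θ g = X 0 ^ 2 + X 1 ^ 2 + X 2 ^ 2 + X 3 ^ (m + 1) := by
  obtain ⟨w, hw, hw0⟩ := exists_pow_eq_of_constantCoeff_ne_zero hu (Nat.succ_ne_zero m)
  obtain ⟨i, hi⟩ := IsAlgClosed.exists_pow_nat_eq (-1 : k) (n := 2) (by norm_num)
  have hi0 : i ≠ 0 := fun h => by simp [h] at hi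
  let A : Matrix (Fin 4) (Fin 4) k :=
    !![1 / 2, 1 / 2, 0, 0; i / 2, -(i / 2), 0, 0; 0, 0, 1, 0; 0, 0, 0, constantCoeff w]
  have hA : A.det = -(i / 2) * constantCoeff w := by
    have h12 : (1 : Fin 4).succAbove (2 : Fin 3) = 3 := rfl
    simp [A, Matrix.det_succ_row_zero, Fin.sum_univ_succ, h12]
    ring
  obtain ⟨σ, hσ⟩ := exists_algEquiv_of_isUnit_linearPart
    (z := ![C (1 / 2) * (p + q), C (i / 2) * (p - q), a, b * w])
    (by
      intro j
      fin_cases j <;> simp [hp, hq, ha, hb]) (by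
      have : linearPart ![C (1 / 2) * (p + q), C (i / 2) * (p - q), a, b * w] =
          A * linearPart ![p, q, a, b] := by
        ext r s
        fin_cases r <;>
        simp [linearPart, A, Matrix.mul_apply, Fin.sum_univ_succ, hb, hp, hq] <;> ring
      rw [this, Matrix.det_mul, hA]
      refine IsUnit.mul (IsUnit.mk0 _ ?_) hdet
      simp [hi0, hw0])
  refine ⟨σ.symm, ?_⟩
  rw [AlgEquiv.symm_apply_eq]
  simp only [map_add, map_pow, hσ, Matrix.cons_val]
  have h1 : (C (1 / 2) : MvPowerSeries (Fin 4) k) ^ 2 * 4 = 1 := by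
    rw [← map_ofNat C 4, ← map_pow, ← map_mul]; norm_num
  have h2 : (C (i / 2) : MvPowerSeries (Fin 4) k) ^ 2 * 4 = -1 := by
    rw [← map_ofNat C 4, ← map_pow, ← map_mul, div_pow, hi, ← map_one C, ← map_neg]; norm_num
  have h3 : (C (i / 2) : MvPowerSeries (Fin 4) k) ^ 2 = - C (1 / 2) ^ 2 := by
    rw [← map_pow, ← map_pow, ← map_neg, div_pow, hi]; congr 1; ring
  rw [hg, ← hw, Nat.succ_eq_add_one]
  linear_combination -(p * q) * h1 - (p - q) ^ 2 * h3

end NormalForms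

end CubicThreefold

namespace CubicThreefold

open Module

section PolarForm

open MvPolynomial

variable {k : Type*} [Field k] {n : ℕ}

theorem pderiv_comm (i j : Fin n) (f : MvPolynomial (Fin n) k) :
    pderiv i (pderiv j f) = pderiv j (pderiv i f) := by
  have h : ⁅pderiv (R := k) i, pderiv (R := k) j⁆ = 0 := by
    apply MvPolynomial.derivation_ext
    intro l
    rw [Derivation.commutator_apply]
    by_cases h1 : i = l <;> by_cases h2 : j = l <;> simp [pderiv_X, Pi.single_apply, h1, h2]
  have := congrArg (fun D => D f) h
  rwa [Derivation.commutator_apply, Derivation.zero_apply, sub_eq_zero] at this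

/-- The trilinear form with coefficients the third partial derivatives of `f` at the origin. -/
noncomputable def polarForm (f : MvPolynomial (Fin n) k) :
    (Fin n → k) →ₗ[k] (Fin n → k) →ₗ[k] (Fin n → k) →ₗ[k] k :=
  (Matrix.toLinearMap₂' k).toLinearMap ∘ₗ Fintype.linearCombination k
    (fun i => Matrix.of fun j l => constantCoeff (pderiv i (pderiv j (pderiv l f))))

theorem polarForm_apply (f : MvPolynomial (Fin n) k) (x y z : Fin n → k) :
    polarForm f x y z = ∑ i, ∑ j, ∑ l, x i * y j * z l *
      constantCoeff (pderiv i (pderiv j (pderiv l f))) := by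
  simp only [polarForm, LinearMap.comp_apply, LinearEquiv.coe_coe, Matrix.toLinearMap₂'_apply,
    Fintype.linearCombination_apply, Matrix.sum_apply, Matrix.smul_apply, Matrix.of_apply,
    smul_eq_mul, Finset.mul_sum]
  conv_rhs => rw [Finset.sum_comm]
  refine Finset.sum_congr rfl fun j _ => ?_
  rw [Finset.sum_comm]
  exact Finset.sum_congr rfl fun i _ => Finset.sum_congr rfl fun l _ => by ring

theorem isSymmTrilinear_polarForm (f : MvPolynomial (Fin n) k) :
    IsSymmTrilinear (polarForm f) where
  swap_left x y := by
    refine LinearMap.ext fun z => ?_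
    simp only [polarForm_apply]
    rw [Finset.sum_comm]
    refine Finset.sum_congr rfl fun j _ => Finset.sum_congr rfl fun i _ =>
      Finset.sum_congr rfl fun l _ => ?_
    rw [pderiv_comm i j]
    ring
  swap_right x y z := by
    simp only [polarForm_apply]
    refine Finset.sum_congr rfl fun i _ => ?_
    rw [Finset.sum_comm]
    refine Finset.sum_congr rfl fun j _ => Finset.sum_congr rfl fun l _ => ?_
    rw [pderiv_comm l j]
    ring

variable {f : MvPolynomial (Fin n) k}

theorem two_mul_eval_pderiv (hf : f.IsHomogeneous 3) (x : Fin n → k) (l : Fin n) :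
    2 * eval x (pderiv l f) = polarForm f x x (Pi.single l 1) := by
  have h2 := congrArg (eval x) (hf.pderiv (i := l)).sum_X_mul_pderiv
  simp only [map_sum, map_mul, eval_X, nsmul_eq_mul, map_natCast] at h2
  have h1 : ∀ j, eval x (pderiv j (pderiv l f)) =
      ∑ i, x i * constantCoeff (pderiv i (pderiv j (pderiv l f))) := by
    intro j
    have h3 := congrArg (eval x) ((hf.pderiv (i := l)).pderiv (i := j)).sum_X_mul_pderiv
    simp only [map_sum, map_mul, eval_X, nsmul_eq_mul, map_natCast] at h3
    norm_num at h3
    rw [← h3]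
    refine Finset.sum_congr rfl fun i _ => ?_
    have h4 := ((hf.pderiv (i := l)).pderiv (i := j)).pderiv (i := i)
    have h5 : (pderiv i (pderiv j (pderiv l f))).totalDegree = 0 := by
      simpa using h4.totalDegree_le
    rw [totalDegree_eq_zero_iff_eq_C] at h5
    rw [h5]
    simp [constantCoeff_eq]
  norm_num at h2
  rw [← h2, polarForm_apply, Finset.sum_comm]
  simp only [h1, Finset.mul_sum]
  refine Finset.sum_congr rfl fun j _ => Finset.sum_congr rfl fun i _ => ?_
  rw [Finset.sum_eq_single l]
  · simp; ring
  · intro m _ hm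
    simp [hm]
  · simp

theorem six_mul_eval (hf : f.IsHomogeneous 3) (x : Fin n → k) :
    6 * eval x f = polarForm f x x x := by
  have h := congrArg (eval x) hf.sum_X_mul_pderiv
  simp only [map_sum, map_mul, eval_X, nsmul_eq_mul, map_natCast] at h
  have h1 : polarForm f x x x = ∑ l, x l * (2 * eval x (pderiv l f)) := by
    conv_lhs => rw [LinearMap.pi_apply_eq_sum_univ (polarForm f x x) x]
    refine Finset.sum_congr rfl fun l _ => ?_
    rw [two_mul_eval_pderiv hf, smul_eq_mul]
    congr 2
    ext j
    simp [Pi.single_apply, eq_comm]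
  rw [h1]
  push_cast at h
  calc 6 * eval x f = 2 * (3 * eval x f) := by ring
    _ = _ := by rw [← h, Finset.mul_sum]; exact Finset.sum_congr rfl fun l _ => by ring

theorem eval_eq_zero_iff [CharZero k] (hf : f.IsHomogeneous 3) (x : Fin n → k) :
    eval x f = 0 ↔ polarForm f x x x = 0 := by
  rw [← six_mul_eval hf]; simp

theorem forall_eval_pderiv_eq_zero_iff [CharZero k] (hf : f.IsHomogeneous 3) (x : Fin n → k) :
    (∀ i, eval x (pderiv i f) = 0) ↔ polarForm f x x = 0 := by
  constructor
  · intro h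
    refine LinearMap.pi_ext' fun i => ?_
    ext
    simp [← two_mul_eval_pderiv hf, h]
  · intro h i
    have := two_mul_eval_pderiv hf x i
    rw [h, LinearMap.zero_apply] at this
    simpa using this

end PolarForm

theorem IsSymmTrilinear.ext_of_diag {k V : Type*} [Field k] [CharZero k] [AddCommGroup V]
    [Module k V] {S T : V →ₗ[k] V →ₗ[k] V →ₗ[k] k} (hS : IsSymmTrilinear S)
    (hT : IsSymmTrilinear T) (h : ∀ x, S x x x = T x x x) : S = T := by
  have key : ∀ {T : V →ₗ[k] V →ₗ[k] V →ₗ[k] k}, IsSymmTrilinear T → ∀ x y z,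
      6 * T x y z = T (x + y + z) (x + y + z) (x + y + z) - T (x + y) (x + y) (x + y) -
        T (y + z) (y + z) (y + z) - T (x + z) (x + z) (x + z) + T x x x + T y y y + T z z z := by
    intro T hT x y z
    simp only [map_add, LinearMap.add_apply, hT.swap_left y x, hT.swap_left z x, hT.swap_left z y,
      hT.swap_right x z y, hT.swap_right y y x, hT.swap_right x y x, hT.swap_right y z x,
      hT.swap_right x z x, hT.swap_right y z y, hT.swap_right z z x, hT.swap_right z z y]
    ring
  ext x y z
  have h1 := key hS x y z
  simp only [h] at h1
  rw [← key hT x y z] at h1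
  simpa using h1

section SingularPoints

open MvPolynomial

variable {k : Type*} [Field k] [CharZero k] {n : ℕ} {f : MvPolynomial (Fin (n + 1)) k}

theorem mk_mem_hypersurface_iff (hf : f.IsHomogeneous 3) {x : Fin (n + 1) → k} (hx : x ≠ 0) :
    Projectivization.mk k x hx ∈ hypersurface f ↔ polarForm f x x x = 0 := by
  obtain ⟨a, ha⟩ := Projectivization.exists_smul_eq_mk_rep k x hx
  rw [hypersurface, Set.mem_ofPred_eq, eval_eq_zero_iff hf, ← ha]
  simp [Units.smul_def]

theorem mk_mem_singularPoints_iff (hf : f.IsHomogeneous 3) {x : Fin (n + 1) → k} (hx : x ≠ 0) :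
    Projectivization.mk k x hx ∈ singularPoints f ↔ polarForm f x x = 0 := by
  obtain ⟨a, ha⟩ := Projectivization.exists_smul_eq_mk_rep k x hx
  rw [singularPoints, Set.mem_ofPred_eq, forall_eval_pderiv_eq_zero_iff hf,
    mk_mem_hypersurface_iff hf, ← ha]
  constructor
  · intro h
    simpa [Units.smul_def] using h.2
  · intro h
    simp [Units.smul_def, h]

theorem exists_isSixSingular {f : MvPolynomial (Fin 5) k} (hf : f.IsHomogeneous 3)
    (hsing : (singularPoints f).ncard = 6) :
    ∃ v : Fin 6 → Fin 5 → k, IsSixSingular (polarForm f) v := by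
  have hfin : Finite (singularPoints f) :=
    (Set.finite_of_ncard_ne_zero (by omega)).to_subtype
  let e := Finite.equivFinOfCardEq hsing
  have hmk : ∀ i, Projectivization.mk k (e.symm i).1.rep (e.symm i).1.rep_nonzero = (e.symm i).1 :=
    fun i => Projectivization.mk_rep _
  refine ⟨fun i => (e.symm i).1.rep, isSymmTrilinear_polarForm f, fun i => ?_, fun i j hij => ?_,
    fun x hx => ?_⟩
  · rw [← mk_mem_singularPoints_iff hf (e.symm i).1.rep_nonzero, hmk]
    exact (e.symm i).2
  · rw [LinearIndependent.pair_iff' (e.symm i).1.rep_nonzero]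
    intro a ha
    have ha0 : a ≠ 0 := by
      rintro rfl
      exact (e.symm j).1.rep_nonzero (by rw [← ha, zero_smul])
    apply hij
    apply e.symm.injective
    apply Subtype.ext
    rw [← hmk i, ← hmk j, eq_comm, Projectivization.mk_eq_mk_iff']
    exact ⟨a, ha⟩
  · by_cases hx0 : x = 0
    · exact ⟨0, by simp [hx0]⟩
    · refine ⟨e ⟨_, (mk_mem_singularPoints_iff hf hx0).2 hx⟩, ?_⟩
      rw [Equiv.symm_apply_apply, Submodule.mem_span_singleton]
      obtain ⟨a, ha⟩ := Projectivization.exists_smul_eq_mk_rep k x hx0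
      refine ⟨(a⁻¹ : kˣ), ?_⟩
      change ((a⁻¹ : kˣ) : k) • (Projectivization.mk k x hx0).rep = x
      rw [← ha, Units.smul_def, smul_smul]
      simp

end SingularPoints

section Automorphisms

open MvPolynomial

variable {k : Type*} [Field k]

theorem dvd_of_forall_eval_eq_zero [IsAlgClosed k] {n : ℕ} {p q : MvPolynomial (Fin n) k}
    (hp : Squarefree p) (h : ∀ x, eval x p = 0 → eval x q = 0) : p ∣ q := by
  have h1 : q ∈ vanishingIdeal k (zeroLocus k (Ideal.span {p})) := by
    rw [mem_vanishingIdeal_iff]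
    intro x hx
    rw [mem_zeroLocus_iff] at hx
    have := h x (by simpa using hx p (Ideal.mem_span_singleton_self p))
    simpa using this
  rw [vanishingIdeal_zeroLocus_eq_radical] at h1
  obtain ⟨m, hm⟩ := h1
  rw [Ideal.mem_span_singleton] at hm
  rcases eq_or_ne m 0 with rfl | hm0
  · rw [pow_zero] at hm
    exact (isUnit_of_dvd_one hm).dvd
  · exact (hp.dvd_pow_iff_dvd hm0).1 hm

variable [IsAlgClosed k] [CharZero k] {f : MvPolynomial (Fin 5) k}

theorem squarefree_of_isSixSingular (hf : f.IsHomogeneous 3) {v : Fin 6 → Fin 5 → k}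
    (hv : IsSixSingular (polarForm f) v) : Squarefree f := by
  have hf0 : f ≠ 0 := by
    rintro rfl
    refine hv.not_gradient_mem ⊤ (by simp) 0 fun x _ => ⟨0, ?_⟩
    ext z
    simp [polarForm_apply]
  rw [squarefree_iff_irreducible_sq_not_dvd_of_ne_zero hf0]
  intro q hq ⟨h, hh⟩
  have hs : ∀ x, eval x q = 0 → polarForm f x x = 0 := by
    intro x hx
    rw [← forall_eval_pderiv_eq_zero_iff hf]
    intro i
    rw [hh]
    simp [Derivation.leibniz, hx]
  have hl : ∀ i, ∃ l : Fin 5 → k, l ≠ 0 ∧ ∑ j, l j * v i j = 0 := by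
    intro i
    by_cases h0 : v i 0 = 0
    · exact ⟨Pi.single 0 1, by simp, by simp [h0, Fin.sum_univ_succ]⟩
    · exact ⟨![- v i 1, v i 0, 0, 0, 0], fun h => h0 (by simpa using congrFun h 1),
        by simp [Fin.sum_univ_succ]; ring⟩
  choose l hl0 hl using hl
  let P : Fin 6 → MvPolynomial (Fin 5) k := fun i => ∑ j, C (l i j) * X j
  have hP : ∀ i x, eval x (P i) = ∑ j, l i j * x j := fun i x => by simp [P]
  have hdvd : q ∣ ∏ i, P i := by
    refine dvd_of_forall_eval_eq_zero hq.squarefree fun x hx => ?_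
    obtain ⟨i, hi⟩ := hv.all x (hs x hx)
    obtain ⟨c, rfl⟩ := Submodule.mem_span_singleton.1 hi
    rw [map_prod]
    refine Finset.prod_eq_zero (Finset.mem_univ i) ?_
    rw [hP]
    calc ∑ j, l i j * (c • v i) j = c * ∑ j, l i j * v i j := by
          rw [Finset.mul_sum]
          exact Finset.sum_congr rfl fun j _ => by simp; ring
      _ = 0 := by rw [hl, mul_zero]
  obtain ⟨i, -, r, hr⟩ := (hq.prime.dvd_finsetProd_iff _).1 hdvd
  have hPi0 : P i ≠ 0 := by
    intro h0
    apply hl0 i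
    funext j
    have := hP i (Pi.single j 1)
    rw [h0, map_zero] at this
    simpa [Pi.single_apply] using this.symm
  have hr0 : r ≠ 0 := by rintro rfl; exact hPi0 (by rw [hr, mul_zero])
  have hdeg : (P i).totalDegree ≤ 1 := by
    refine totalDegree_finsetSum_le fun j _ => ?_
    refine (totalDegree_mul _ _).trans ?_
    simp
  rw [hr, totalDegree_mul_of_isDomain hq.ne_zero hr0] at hdeg
  have hq1 : q.totalDegree ≠ 0 := by
    intro h0
    rw [totalDegree_eq_zero_iff_eq_C] at h0
    apply hq.not_isUnit
    rw [h0]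
    refine (IsUnit.mk0 (coeff 0 q) fun hc => hq.ne_zero ?_).map C
    rw [h0, hc, C_0]
  have hrC : r.totalDegree = 0 := by omega
  rw [totalDegree_eq_zero_iff_eq_C] at hrC
  have hc0 : coeff 0 r ≠ 0 := fun hc => hr0 (by rw [hrC, hc, C_0])
  let L : Dual k (Fin 5 → k) := Fintype.linearCombination k (l i)
  refine hv.not_gradient_mem (LinearMap.ker L) ?_ 0 fun x hx => ⟨0, ?_⟩
  · have h1 := LinearMap.finrank_range_add_finrank_ker L
    have h2 : finrank k (LinearMap.range L) ≤ 1 := by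
      simpa using Submodule.finrank_le (LinearMap.range L)
    rw [Module.finrank_fin_fun] at h1
    omega
  · rw [smul_zero]
    apply hs
    have h1 : eval x (P i) = 0 := by
      rw [hP]
      rw [LinearMap.mem_ker, Fintype.linearCombination_apply] at hx
      rw [← hx]
      exact Finset.sum_congr rfl fun j _ => by simp [mul_comm]
    rw [hr, map_mul, hrC, eval_C] at h1
    simpa [hc0] using h1

/-- The linear substitution `x ↦ A x`. -/
noncomputable def linearSubst {n : ℕ} (A : Matrix (Fin n) (Fin n) k) (f : MvPolynomial (Fin n) k) :
    MvPolynomial (Fin n) k :=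
  aeval (fun i => ∑ j, C (A i j) * X j) f

theorem eval_linearSubst {n : ℕ} (A : Matrix (Fin n) (Fin n) k) (f : MvPolynomial (Fin n) k)
    (x : Fin n → k) : eval x (linearSubst A f) = eval (A.mulVec x) f := by
  rw [linearSubst, ← coe_aeval_eq_eval, ← coe_aeval_eq_eval]
  change aeval x (aeval _ f) = aeval _ f
  rw [← AlgHom.comp_apply, comp_aeval]
  congr 2
  funext i
  simp [Matrix.mulVec, dotProduct]

theorem smul_mk (A : GL (Fin 5) k) {x : Fin 5 → k} (hx : x ≠ 0) :
    Matrix.ProjGenLinGroup.mk A • (Projectivization.mk k x hx : ProjSpace k 4) =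
      Projectivization.mk k (A • x) ((smul_ne_zero_iff_ne A).2 hx) :=
  Projectivization.PGL.mk_smul_mk A hx

theorem exists_polarForm_smul (hf : f.IsHomogeneous 3) {v : Fin 6 → Fin 5 → k}
    (hv : IsSixSingular (polarForm f) v) {A : GL (Fin 5) k}
    (hA : Matrix.ProjGenLinGroup.mk A ∈ aut f) :
    ∃ c : k, c ≠ 0 ∧ ∀ x y z, polarForm f (A • x) (A • y) (A • z) = c * polarForm f x y z := by
  have hsq := squarefree_of_isSixSingular hf hv
  have hmem : ∀ x, eval x f = 0 ↔ eval (A • x) f = 0 := by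
    intro x
    by_cases hx : x = 0
    · simp [hx]
    · rw [eval_eq_zero_iff hf, eval_eq_zero_iff hf, ← mk_mem_hypersurface_iff hf hx,
        ← mk_mem_hypersurface_iff hf ((smul_ne_zero_iff_ne A).2 hx), ← smul_mk A hx,
        aut, MulAction.mem_stabilizer_set] at *
      exact (hA _).symm
  have hAx : ∀ x, A.1.mulVec x = A • x := fun x => rfl
  obtain ⟨h, hh⟩ := dvd_of_forall_eval_eq_zero (q := linearSubst A.1 f) hsq
    fun x hx => by
      rw [eval_linearSubst, hAx]
      exact (hmem x).1 hx
  have hsub0 : linearSubst A.1 f ≠ 0 := by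
    intro h0
    apply hsq.ne_zero
    apply MvPolynomial.funext
    intro x
    have := eval_linearSubst A.1 f (A⁻¹ • x)
    rw [h0, hAx, smul_inv_smul] at this
    simpa using this.symm
  have hh0 : h ≠ 0 := by rintro rfl; exact hsub0 (by rw [hh, mul_zero])
  have hdeg : (linearSubst A.1 f).totalDegree = 3 := by
    have : (linearSubst A.1 f).IsHomogeneous (1 * 3) :=
      hf.aeval _ fun i => IsHomogeneous.sum _ _ _ fun j _ => isHomogeneous_C_mul_X _ _
    simpa using this.totalDegree hsub0
  rw [hh, totalDegree_mul_of_isDomain hsq.ne_zero hh0, hf.totalDegree hsq.ne_zero] at hdeg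
  have hC : h.totalDegree = 0 := by omega
  rw [totalDegree_eq_zero_iff_eq_C] at hC
  refine ⟨coeff 0 h, fun h0 => hh0 (by rw [hC, h0, C_0]), ?_⟩
  let α : (Fin 5 → k) →ₗ[k] (Fin 5 → k) := A.1.mulVecLin
  have hT := isSymmTrilinear_polarForm f
  let S : (Fin 5 → k) →ₗ[k] (Fin 5 → k) →ₗ[k] (Fin 5 → k) →ₗ[k] k :=
    LinearMap.mk₂ k (fun x y => (polarForm f (α x) (α y)).comp α)
      (fun x y z => by ext; simp) (fun c x y => by ext; simp)
      (fun x y z => by ext; simp) (fun c x y => by ext; simp)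
  have hS : ∀ x y z, S x y z = polarForm f (A • x) (A • y) (A • z) := fun x y z => rfl
  have hSs : IsSymmTrilinear S := ⟨fun x y => by
    refine LinearMap.ext fun z => ?_
    rw [hS, hS, hT.swap_left], fun x y z => by rw [hS, hS, hT.swap_right]⟩
  have hTs : IsSymmTrilinear (coeff 0 h • polarForm f) := ⟨fun x y => by
    rw [LinearMap.smul_apply, LinearMap.smul_apply, LinearMap.smul_apply, LinearMap.smul_apply,
      hT.swap_left], fun x y z => by
    simp only [LinearMap.smul_apply]
    rw [hT.swap_right]⟩
  have := hSs.ext_of_diag hTs fun x => by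
    rw [hS, ← six_mul_eval hf, ← hAx, ← eval_linearSubst, hh, map_mul, hC]
    simp only [LinearMap.smul_apply, ← six_mul_eval hf, smul_eq_mul, eval_C, coeff_C]
    simp
    ring
  intro x y z
  rw [← hS, this]
  rfl

end Automorphisms

end CubicThreefold

namespace CubicThreefold

open Module

section LocalEquation

variable {k : Type*} [Field k] {f : MvPolynomial (Fin 5) k}

theorem exists_generalLinearGroup_col (w : Fin 5 → Fin 5 → k) (hw : LinearIndependent k w) :
    ∃ A : GL (Fin 5) k, A.1.col = w := by
  have h : IsUnit (Matrix.of w).transpose := by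
    rw [← Matrix.linearIndependent_cols_iff_isUnit]
    exact hw
  exact ⟨h.unit, rfl⟩

theorem smul_single_zero (A : GL (Fin 5) k) : A • (Pi.single 0 1 : Fin 5 → k) = A.1.col 0 :=
  Matrix.mulVec_single_one _ _

theorem smul_basePoint (A : GL (Fin 5) k) {v : Fin 5 → k} (hv : v ≠ 0) (h : A.1.col 0 = v) :
    A • basePoint k 4 = Projectivization.mk k v hv := by
  subst h
  rw [basePoint, Projectivization.smul_mk]
  congr 1
  exact smul_single_zero A

theorem polarForm_diag_add_smul {V : Type*} [AddCommGroup V] [Module k V]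
    {T : V →ₗ[k] V →ₗ[k] V →ₗ[k] k} (hT : IsSymmTrilinear T) {v : V} (hv : T v v = 0) (u : V) :
    T (v + u) (v + u) (v + u) = 3 * T v u u + T u u u := by
  have h1 : ∀ x, T v v x = 0 := fun x => by rw [hv]; rfl
  simp only [map_add, LinearMap.add_apply, h1, hT.swap_left u v, hT.swap_right v u v, hT.swap_right u u v]
  ring

theorem eval_localEquation (A : GL (Fin 5) k) (y : Fin 4 → k) :
    MvPolynomial.eval y (localEquation f A) =
      MvPolynomial.eval (A.1.col 0 + ∑ j : Fin 4, y j • A.1.col j.succ) f := by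
  rw [localEquation, ← MvPolynomial.coe_aeval_eq_eval, ← MvPolynomial.coe_aeval_eq_eval]
  change MvPolynomial.aeval y (MvPolynomial.aeval _ f) = MvPolynomial.aeval _ f
  rw [← AlgHom.comp_apply, MvPolynomial.comp_aeval]
  congr 2
  funext i
  simp [Matrix.col, mul_comm]

theorem six_mul_eval_localEquation (hf : f.IsHomogeneous 3) {A : GL (Fin 5) k}
    (h0 : polarForm f (A.1.col 0) (A.1.col 0) = 0) (y : Fin 4 → k) :
    6 * MvPolynomial.eval y (localEquation f A) =
      3 * polarForm f (A.1.col 0) (∑ j : Fin 4, y j • A.1.col j.succ)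
        (∑ j : Fin 4, y j • A.1.col j.succ) +
      polarForm f (∑ j : Fin 4, y j • A.1.col j.succ) (∑ j : Fin 4, y j • A.1.col j.succ)
        (∑ j : Fin 4, y j • A.1.col j.succ) := by
  rw [eval_localEquation, six_mul_eval hf,
    polarForm_diag_add_smul (isSymmTrilinear_polarForm f) h0]

variable [CharZero k]

open MvPowerSeries

theorem coe_localEquation (hf : f.IsHomogeneous 3) {A : GL (Fin 5) k}
    (h0 : polarForm f (A.1.col 0) (A.1.col 0) = 0) :
    (localEquation f A : MvPowerSeries (Fin 4) k) = ∑ i : Fin 4, ∑ j : Fin 4,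
      (C (polarForm f (A.1.col 0) (A.1.col i.succ) (A.1.col j.succ) / 2) +
        ∑ l : Fin 4, C (polarForm f (A.1.col i.succ) (A.1.col j.succ) (A.1.col l.succ) / 6) * X l) *
        X i * X j := by
  have h : localEquation f A = ∑ i : Fin 4, ∑ j : Fin 4,
      (MvPolynomial.C (polarForm f (A.1.col 0) (A.1.col i.succ) (A.1.col j.succ) / 2) +
        ∑ l : Fin 4, MvPolynomial.C
          (polarForm f (A.1.col i.succ) (A.1.col j.succ) (A.1.col l.succ) / 6) *
          MvPolynomial.X l) * MvPolynomial.X i * MvPolynomial.X j := by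
    apply MvPolynomial.funext
    intro y
    refine mul_left_cancel₀ (by norm_num : (6 : k) ≠ 0) ?_
    rw [six_mul_eval_localEquation hf h0]
    simp only [map_sum, map_smul, LinearMap.sum_apply, LinearMap.smul_apply, smul_eq_mul, map_mul,
      map_add, MvPolynomial.eval_C, MvPolynomial.eval_X]
    have hT := isSymmTrilinear_polarForm f
    simp only [Finset.mul_sum, ← Finset.sum_add_distrib, add_mul, mul_add, Finset.sum_mul]
    refine Finset.sum_congr rfl fun i _ => Finset.sum_congr rfl fun j _ => ?_
    rw [hT.swap_right _ (A.1.col j.succ)]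
    congr 1
    · ring
    · refine Finset.sum_congr rfl fun l _ => ?_
      rw [hT.swap_left _ (A.1.col j.succ), hT.swap_right _ (A.1.col l.succ),
        hT.swap_left _ (A.1.col i.succ)]
      ring
  rw [h]
  simp only [← MvPolynomial.coeToMvPowerSeries.ringHom_apply, map_sum, map_add, map_mul]
  simp only [MvPolynomial.coeToMvPowerSeries.ringHom_apply, MvPolynomial.coe_C, MvPolynomial.coe_X]

/-- A nondegenerate tangent cone gives a node. -/
theorem isTypeA_one_of_not_isDegenerateAt [IsAlgClosed k] (hf : f.IsHomogeneous 3) {v : Fin 5 → k}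
    (hv : v ≠ 0) (h0 : polarForm f v v = 0) (hd : ¬ IsDegenerateAt (polarForm f) v) :
    IsTypeA f 1 (Projectivization.mk k v hv) := by
  have hT := isSymmTrilinear_polarForm f
  obtain ⟨U, hU⟩ := Submodule.exists_isCompl (k ∙ v)
  have hrank : finrank k U = 4 := by
    have := Submodule.finrank_add_eq_of_isCompl hU
    rw [finrank_span_singleton hv, Module.finrank_fin_fun] at this
    omega
  let B : LinearMap.BilinForm k U := (polarForm f v).compl₁₂ U.subtype U.subtype
  have hB : ∀ x y : U, B x y = polarForm f v x y := fun x y => rfl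
  have : Invertible (2 : k) := invertibleOfNonzero two_ne_zero
  obtain ⟨b', hb'⟩ := LinearMap.BilinForm.exists_orthogonal_basis (B := B)
    ⟨fun x y => by simp only [hB, RingHom.id_apply]; exact hT.swap_right v x y⟩
  let b := b'.reindex (finCongr hrank)
  have hb : ∀ i j, i ≠ j → polarForm f v (b i) (b j) = 0 := by
    intro i j hij
    have := hb' (i := (finCongr hrank).symm i) (j := (finCongr hrank).symm j) (by simpa using hij)
    simpa [b, Function.onFun, hB] using this
  have hnz : ∀ i, polarForm f v (b i) (b i) ≠ 0 := by
    intro i hi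
    have hbi : polarForm f v (b i) = 0 := by
      refine LinearMap.ext fun x => ?_
      have hx : x ∈ (k ∙ v) ⊔ U := by rw [hU.sup_eq_top]; trivial
      obtain ⟨s, hs, u, hu, rfl⟩ := Submodule.mem_sup.1 hx
      obtain ⟨c, rfl⟩ := Submodule.mem_span_singleton.1 hs
      have h1 : polarForm f v (b i) v = 0 := by rw [hT.swap_right, h0]; rfl
      have h2 : B (b i) = 0 := b.ext fun j => by
        rw [hB]
        rcases eq_or_ne i j with rfl | hij
        · simpa using hi
        · simpa using hb i j hij
      have h3 : polarForm f v (b i) u = 0 := by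
        have := congrArg (fun φ => φ ⟨u, hu⟩) h2
        simpa [hB] using this
      simp [h1, h3]
    refine hd ⟨b i, fun hm => ?_, hbi⟩
    have := (Submodule.disjoint_def.1 hU.disjoint) _ hm (b i).2
    exact b.ne_zero i (Subtype.ext this)
  choose s hs using fun i => IsAlgClosed.exists_pow_nat_eq (2 / polarForm f v (b i) (b i))
    (n := 2) (by norm_num)
  have hs0 : ∀ i, s i ≠ 0 := fun i h => by
    have := hs i
    rw [h] at this
    have h2 : (2 : k) / polarForm f v (b i) (b i) ≠ 0 := div_ne_zero two_ne_zero (hnz i)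
    exact h2 (by rw [← this]; simp)
  let w : Fin 4 → Fin 5 → k := fun i => s i • (b i : Fin 5 → k)
  have hwi : LinearIndependent k w := by
    have h1 : LinearIndependent k (fun i => (b i : Fin 5 → k)) :=
      b.linearIndependent.map' U.subtype U.ker_subtype
    exact h1.units_smul fun i => Units.mk0 (s i) (hs0 i)
  have hwU : Submodule.span k (Set.range w) ≤ U := by
    rw [Submodule.span_le]
    rintro _ ⟨i, rfl⟩
    exact U.smul_mem _ (b i).2
  have hcons : LinearIndependent k (Fin.cons v w : Fin 5 → Fin 5 → k) := by
    rw [linearIndependent_finCons]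
    refine ⟨hwi, fun hm => hv ?_⟩
    exact (Submodule.disjoint_def.1 hU.disjoint) _ (Submodule.mem_span_singleton_self v) (hwU hm)
  obtain ⟨A, hA⟩ := exists_generalLinearGroup_col _ hcons
  refine ⟨A, smul_basePoint A hv (by rw [hA]; rfl), ?_⟩
  have hA0 : A.1.col 0 = v := by rw [hA]; rfl
  have hAs : ∀ i : Fin 4, A.1.col i.succ = w i := fun i => by rw [hA]; rfl
  obtain ⟨θ, hθ⟩ := exists_algEquiv_sum_sq (n := 4) (fun i j =>
    ∑ l : Fin 4, C (polarForm f (w i) (w j) (w l) / 6) * X l) (fun i j => by simp)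
  refine ⟨θ, ?_⟩
  rw [coe_localEquation hf (by rw [hA0, h0])]
  have hww : ∀ i j, (C (polarForm f v (w i) (w j) / 2) : MvPowerSeries (Fin 4) k) =
      if i = j then 1 else 0 := by
    intro i j
    split_ifs with hij
    · subst hij
      have : polarForm f v (w i) (w i) = s i ^ 2 * polarForm f v (b i) (b i) := by
        simp [w]; ring
      rw [this, hs, div_mul_cancel₀ _ (hnz i), div_self two_ne_zero, map_one]
    · have : polarForm f v (w i) (w j) = 0 := by simp [w, hb i j hij]
      simp [this]
  simp only [hA0, hAs, hww, add_mul, Finset.sum_add_distrib]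
  have hd : ∑ i : Fin 4, ∑ j : Fin 4, (if i = j then 1 else 0) * X i * X j =
      ∑ i : Fin 4, (X i ^ 2 : MvPowerSeries (Fin 4) k) := by
    simp [pow_two]
  rw [hd]
  have hn : (normalFormA k 1 : MvPowerSeries (Fin 4) k) = ∑ i : Fin 4, X i ^ 2 := by
    simp [normalFormA, Fin.sum_univ_four]
  rw [hn, hθ]

end LocalEquation

end CubicThreefold

namespace CubicThreefold

open Module

section AdaptedNormalForm

open MvPowerSeries

variable {k : Type*} [Field k] [CharZero k] [IsAlgClosed k]

theorem exists_algEquiv_adapted {P R β γ β' γ' : k} (hP : P ≠ 0) (hR : R ≠ 0)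
    (g : MvPowerSeries (Fin 4) k)
    (hg : g = X 0 * X 1 + C P * X 2 ^ 2 + X 1 * (C β * X 2 + C γ * X 3) +
      X 0 * (C R * X 3 ^ 2 + X 1 * (C β' * X 2 + C γ' * X 3))) :
    (γ ≠ 0 → ∃ θ : MvPowerSeries (Fin 4) k ≃ₐ[k] MvPowerSeries (Fin 4) k,
      θ g = X 0 ^ 2 + X 1 ^ 2 + X 2 ^ 2 + X 3 ^ (2 + 1)) ∧
    (γ = 0 → β ≠ 0 → ∃ θ : MvPowerSeries (Fin 4) k ≃ₐ[k] MvPowerSeries (Fin 4) k,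
      θ g = X 0 ^ 2 + X 1 ^ 2 + X 2 ^ 2 + X 3 ^ (3 + 1)) := by
  obtain ⟨r, hr⟩ := IsAlgClosed.exists_pow_nat_eq P (n := 2) (by norm_num)
  have hr0 : r ≠ 0 := fun h => hP (by rw [← hr, h]; simp)
  let t : k := β / (2 * P)
  let d : k := -(β ^ 2 / (4 * P))
  obtain ⟨ε, hε, hε1⟩ : ∃ ε : MvPowerSeries (Fin 4) k,
      ε * (1 + C β' * X 2 + C γ' * X 3) = 1 ∧ constantCoeff ε = 1 := by
    refine ⟨(1 + C β' * X 2 + C γ' * X 3)⁻¹, MvPowerSeries.inv_mul_cancel _ (by simp), by simp⟩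
  let q : MvPowerSeries (Fin 4) k := X 1 * (1 + C β' * X 2 + C γ' * X 3) + C R * X 3 ^ 2
  let p : MvPowerSeries (Fin 4) k :=
    X 0 + C d * ε ^ 2 * (q - 2 * C R * X 3 ^ 2) + C γ * ε * X 3
  let a : MvPowerSeries (Fin 4) k := C r * (X 2 + C t * X 1)
  have hl : X 1 = ε * (q - C R * X 3 ^ 2) := by
    simp only [q]
    linear_combination -X 1 * hε
  have e1 : (C r : MvPowerSeries (Fin 4) k) ^ 2 = C P := by rw [← map_pow, hr]
  have e2 : 2 * (C P : MvPowerSeries (Fin 4) k) * C t = C β := by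
    rw [← map_ofNat C 2, ← map_mul, ← map_mul]
    congr 1
    simp only [t]
    field_simp
  have e3 : (C P : MvPowerSeries (Fin 4) k) * C t ^ 2 + C d = 0 := by
    rw [← map_pow, ← map_mul, ← map_add, ← map_zero C]
    congr 1
    simp only [t, d]
    field_simp
    ring
  have key : g = p * q + a ^ 2 + X 3 ^ 3 * (C d * ε ^ 2 * C R ^ 2 * X 3 - C γ * ε * C R) := by
    have h1 : g = X 0 * q + a ^ 2 + C d * X 1 ^ 2 + C γ * X 3 * X 1 := by
      rw [hg]
      simp only [q, a]
      linear_combination -(X 2 + C t * X 1) ^ 2 * e1 - X 2 * X 1 * e2 - X 1 ^ 2 * e3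
    rw [h1, hl]
    simp only [p]
    ring
  have hq0 : constantCoeff q = 0 := by simp [q]
  have hp0 : constantCoeff p = 0 := by simp [p, hq0]
  have ha0 : constantCoeff a = 0 := by simp [a]
  have hlin : linearPart ![p, q, a, X 3] =
      !![1, d, 0, γ; 0, 1, 0, 0; 0, r * t, r, 0; 0, 0, 0, 1] := by
    ext i j
    fin_cases i <;> fin_cases j <;>
    simp [linearPart, p, q, a, pderiv_X, Derivation.leibniz, Derivation.leibniz_pow, hε1,
      Pi.single_apply]
  have hdet : IsUnit (linearPart ![p, q, a, X 3]).det := by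
    have h12 : (1 : Fin 4).succAbove (2 : Fin 3) = 3 := rfl
    rw [hlin]
    refine IsUnit.mk0 _ ?_
    simp [Matrix.det_succ_row_zero, Fin.sum_univ_succ, h12, hr0, Fin.succAbove]
  constructor
  · intro hγ
    refine exists_algEquiv_normalForm 2 key ?_ hp0 hq0 ha0 (by simp) hdet
    simp [hε1, hγ, hR]
  · intro hγ hβ
    refine exists_algEquiv_normalForm 3 (u := C d * ε ^ 2 * C R ^ 2) ?_ ?_ hp0 hq0 ha0 (by simp)
      hdet
    · rw [key, hγ, map_zero]; ring
    · simp [hε1, hR, d, hβ, hP]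

variable {f : MvPolynomial (Fin 5) k} {v v' o e n : Fin 5 → k}

theorem IsAdapted.isTypeA (hf : f.IsHomogeneous 3) (h : IsAdapted (polarForm f) v v' o e n)
    (hv : v ≠ 0) :
    (polarForm f v o n ≠ 0 → IsTypeA f 2 (Projectivization.mk k v hv)) ∧
    (polarForm f v o n = 0 → IsTypeA f 3 (Projectivization.mk k v hv)) := by
  have hT := isSymmTrilinear_polarForm f
  obtain ⟨A, hA⟩ := exists_generalLinearGroup_col _ h.indep
  have hA0 : A.1.col 0 = v := by rw [hA]; rfl
  have hA1 : A.1.col (Fin.succ 0) = v' := by rw [hA]; rfl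
  have hA2 : A.1.col (Fin.succ 1) = o := by rw [hA]; rfl
  have hA3 : A.1.col (Fin.succ 2) = e := by rw [hA]; rfl
  have hA4 : A.1.col (Fin.succ 3) = n := by rw [hA]; rfl
  have h0 : polarForm f (A.1.col 0) (A.1.col 0) = 0 := by rw [hA0, h.sing]
  have ho : o ∈ Submodule.span k {o, e, n} := Submodule.subset_span (by simp)
  have he : e ∈ Submodule.span k {o, e, n} := Submodule.subset_span (by simp)
  have hn : n ∈ Submodule.span k {o, e, n} := Submodule.subset_span (by simp)
  have hg : (localEquation f A : MvPowerSeries (Fin 4) k) =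
      X 0 * X 1 + C (polarForm f v e e / 2) * X 2 ^ 2 +
      X 1 * (C (polarForm f v o e) * X 2 + C (polarForm f v o n) * X 3) +
      X 0 * (C (polarForm f v' n n / 2) * X 3 ^ 2 +
        X 1 * (C (polarForm f v' o e) * X 2 + C (polarForm f v' o n) * X 3)) := by
    have : localEquation f A = MvPolynomial.X 0 * MvPolynomial.X 1 +
        MvPolynomial.C (polarForm f v e e / 2) * MvPolynomial.X 2 ^ 2 +
        MvPolynomial.X 1 * (MvPolynomial.C (polarForm f v o e) * MvPolynomial.X 2 +
          MvPolynomial.C (polarForm f v o n) * MvPolynomial.X 3) +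
        MvPolynomial.X 0 * (MvPolynomial.C (polarForm f v' n n / 2) * MvPolynomial.X 3 ^ 2 +
          MvPolynomial.X 1 * (MvPolynomial.C (polarForm f v' o e) * MvPolynomial.X 2 +
            MvPolynomial.C (polarForm f v' o n) * MvPolynomial.X 3)) := by
      apply MvPolynomial.funext
      intro y
      refine mul_left_cancel₀ (by norm_num : (6 : k) ≠ 0) ?_
      rw [six_mul_eval_localEquation hf h0]
      simp only [Fin.sum_univ_four, hA0, hA1, hA2, hA3, hA4]
      obtain ⟨w, hw, hwm⟩ : ∃ w, w = y 1 • o + y 2 • e + y 3 • n ∧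
        w ∈ Submodule.span k {o, e, n} :=
        ⟨_, rfl, Submodule.add_mem _ (Submodule.add_mem _ (Submodule.smul_mem _ _ ho)
          (Submodule.smul_mem _ _ he)) (Submodule.smul_mem _ _ hn)⟩
      have hu : y 0 • v' + y 1 • o + y 2 • e + y 3 • n = y 0 • v' + w := by rw [hw]; module
      have s1 : ∀ x, polarForm f v' v' x = 0 := fun x => by rw [h.sing']; rfl
      have s2 : ∀ x, polarForm f x v' v' = 0 := fun x => by rw [hT.swap_left, hT.swap_right, s1]
      have c1 : polarForm f v v' w = y 1 := by
        simp [hw, h.apply_o, h.apply_e, h.apply_n]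
      have c2 : polarForm f v w w =
          y 2 ^ 2 * polarForm f v e e + 2 * y 1 * (y 2 * polarForm f v o e +
            y 3 * polarForm f v o n) := by
        simp only [hw, map_add, map_smul, LinearMap.add_apply, LinearMap.smul_apply, smul_eq_mul,
          hT.swap_right v e o, hT.swap_right v n o, hT.swap_right v e n, h.oo, h.nn, h.ne]
        ring
      have c3 : polarForm f v' w w =
          y 3 ^ 2 * polarForm f v' n n + 2 * y 1 * (y 2 * polarForm f v' o e +
            y 3 * polarForm f v' o n) := by
        simp only [hw, map_add, map_smul, LinearMap.add_apply, LinearMap.smul_apply, smul_eq_mul,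
          hT.swap_right v' e o, hT.swap_right v' n o, hT.swap_right v' e n, h.oo', h.ee', h.ne']
        ring
      have c4 : polarForm f w w w = 0 := h.plane w hwm w hwm w hwm
      rw [hu]
      simp only [map_add, map_smul, LinearMap.add_apply, LinearMap.smul_apply, smul_eq_mul, s1, s2,
        hT.swap_right _ w v', hT.swap_left w v', c1, c2, c3, c4, map_mul, map_pow,
        MvPolynomial.eval_X, MvPolynomial.eval_C]
      ring
    rw [this]
    simp
  obtain ⟨k1, k2⟩ := exists_algEquiv_adapted (div_ne_zero h.ee two_ne_zero)
    (div_ne_zero h.nn' two_ne_zero) _ hg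
  have hN : ∀ m, (normalFormA k m : MvPowerSeries (Fin 4) k) =
      X 0 ^ 2 + X 1 ^ 2 + X 2 ^ 2 + X 3 ^ (m + 1) := fun m => by simp [normalFormA]
  constructor
  · intro hγ
    obtain ⟨θ, hθ⟩ := k1 hγ
    exact ⟨A, smul_basePoint A hv hA0, θ, by rw [hθ, hN]⟩
  · intro hγ
    obtain ⟨θ, hθ⟩ := k2 hγ (h.oe hγ)
    exact ⟨A, smul_basePoint A hv hA0, θ, by rw [hθ, hN]⟩

end AdaptedNormalForm

end CubicThreefold

namespace CubicThreefold

open Module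

section Hessian

open MvPowerSeries

variable {k : Type*} [Field k]

theorem constantCoeff_algEquiv_eq_zero {n : ℕ}
    (θ : MvPowerSeries (Fin n) k ≃ₐ[k] MvPowerSeries (Fin n) k) {z : MvPowerSeries (Fin n) k}
    (hz : constantCoeff z = 0) : constantCoeff (θ z) = 0 := by
  by_contra h
  have h1 : IsUnit (θ z) := MvPowerSeries.isUnit_iff_constantCoeff.2 (IsUnit.mk0 _ h)
  have h2 := MvPowerSeries.isUnit_iff_constantCoeff.1 ((MulEquiv.isUnit_map θ).1 h1)
  exact h2.ne_zero hz

theorem constantCoeff_pderiv_of_mem_varIdeal_sq {n : ℕ} {z : MvPowerSeries (Fin n) k}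
    (hz : z ∈ varIdeal k n ^ 2) (i : Fin n) : constantCoeff (pderiv k i z) = 0 := by
  rw [pow_two] at hz
  refine Submodule.mul_induction_on hz (fun x hx y hy => ?_) (fun x y hx hy => ?_)
  · simp [Derivation.leibniz, constantCoeff_of_mem_varIdeal hx, constantCoeff_of_mem_varIdeal hy]
  · rw [map_add, map_add, hx, hy, add_zero]

theorem algEquiv_mem_varIdeal_sq {n : ℕ}
    (θ : MvPowerSeries (Fin n) k ≃ₐ[k] MvPowerSeries (Fin n) k) {z : MvPowerSeries (Fin n) k}
    (hz : z ∈ varIdeal k n ^ 2) : θ z ∈ varIdeal k n ^ 2 := by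
  have h1 : ∀ x ∈ varIdeal k n, θ x ∈ varIdeal k n := fun x hx =>
    mem_varIdeal_of_constantCoeff
      (constantCoeff_algEquiv_eq_zero θ (constantCoeff_of_mem_varIdeal hx))
  rw [pow_two] at hz ⊢
  refine Submodule.mul_induction_on hz (fun x hx y hy => ?_) (fun x y hx hy => ?_)
  · rw [map_mul]
    exact Ideal.mul_mem_mul (h1 x hx) (h1 y hy)
  · rw [map_add]
    exact Ideal.add_mem _ hx hy

theorem isUnit_det_linearPart_algEquiv {n : ℕ}
    (θ : MvPowerSeries (Fin n) k ≃ₐ[k] MvPowerSeries (Fin n) k) :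
    IsUnit (linearPart fun i => θ (X i)).det := by
  rw [isUnit_iff_ne_zero]
  intro h0
  obtain ⟨c, hc0, hc⟩ := Matrix.exists_vecMul_eq_zero_iff.2 h0
  have hmem : ∑ i, c i • θ (X i) ∈ varIdeal k n ^ 2 := by
    refine mem_varIdeal_sq ?_ fun j => ?_
    · simp [constantCoeff_algEquiv_eq_zero]
    · have := congrFun hc j
      simpa [Matrix.vecMul, dotProduct, linearPart] using this
  have h1 := algEquiv_mem_varIdeal_sq θ.symm hmem
  apply hc0
  funext j
  have h2 := constantCoeff_pderiv_of_mem_varIdeal_sq h1 j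
  simpa [pderiv_X, Pi.single_apply] using h2

theorem exists_hessian_of_associated [CharZero k] {f : MvPolynomial (Fin 5) k}
    (hf : f.IsHomogeneous 3) {A : GL (Fin 5) k}
    (h0 : polarForm f (A.1.col 0) (A.1.col 0) = 0)
    (θ : MvPowerSeries (Fin 4) k ≃ₐ[k] MvPowerSeries (Fin 4) k) {m : ℕ} (hm : 1 ≤ m)
    (hθ : Associated (θ (localEquation f A : MvPowerSeries (Fin 4) k))
      (normalFormA k m : MvPowerSeries (Fin 4) k)) :
    ∃ (Z : Matrix (Fin 4) (Fin 4) k) (s c : k), IsUnit Z.det ∧ (s = 0 ↔ 2 ≤ m) ∧ c ≠ 0 ∧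
      ∀ (y : Fin 4 → k) (b : Fin 4),
        c * polarForm f (A.1.col 0) (∑ j, y j • A.1.col j.succ) (A.1.col b.succ) =
          ∑ i, ![1, 1, 1, s] i * Z.mulVec y i * Z i b := by
  have hT := isSymmTrilinear_polarForm f
  obtain ⟨u, hu⟩ := hθ
  let z : Fin 4 → MvPowerSeries (Fin 4) k := fun i => θ.symm (X i)
  have hz : ∀ i, constantCoeff (z i) = 0 := fun i => constantCoeff_algEquiv_eq_zero _ (by simp)
  let σ := constantCoeff (θ.symm (X 3 ^ (m - 1)))
  have hσ : σ = 0 ↔ 2 ≤ m := by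
    simp only [σ, map_pow]
    change constantCoeff (z 3) ^ (m - 1) = 0 ↔ _
    rw [hz]
    constructor
    · intro h
      by_contra hlt
      have : m - 1 = 0 := by omega
      rw [this] at h
      simp at h
    · intro h
      exact zero_pow (by omega)
  have hU : constantCoeff (θ.symm u) ≠ 0 := by
    have : IsUnit (θ.symm (u : MvPowerSeries (Fin 4) k)) := u.isUnit.map θ.symm
    exact (MvPowerSeries.isUnit_iff_constantCoeff.1 this).ne_zero
  refine ⟨linearPart z, σ, constantCoeff (θ.symm u) / 2, isUnit_det_linearPart_algEquiv θ.symm, hσ,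
    div_ne_zero hU two_ne_zero, fun y b => ?_⟩
  let D : Derivation k (MvPowerSeries (Fin 4) k) (MvPowerSeries (Fin 4) k) :=
    ∑ a, y a • pderiv k a
  have hDapp : ∀ x, D x = ∑ a, y a • pderiv k a x := fun x => by
    simp [D, Fin.sum_univ_four]
  have hDX : ∀ i, D (X i) = C (y i) := fun i => by
    rw [hDapp, Finset.sum_eq_single i]
    · rw [pderiv_X_self, smul_eq_C_mul, mul_one]
    · intro a _ ha
      rw [pderiv_X_of_ne ha.symm, smul_zero]
    · simp
  have hDz : ∀ i, constantCoeff (D (z i)) = (linearPart z).mulVec y i := fun i => by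
    rw [hDapp]
    simp [Matrix.mulVec, dotProduct, linearPart, mul_comm]
  have hbz : ∀ i, constantCoeff (pderiv k b (z i)) = linearPart z i b := fun i => rfl
  have hN : (localEquation f A : MvPowerSeries (Fin 4) k) * θ.symm u =
      z 0 * z 0 + z 1 * z 1 + z 2 * z 2 + z 3 * z 3 * θ.symm (X 3 ^ (m - 1)) := by
    have h1 := congrArg θ.symm hu
    rw [map_mul, AlgEquiv.symm_apply_apply] at h1
    rw [h1]
    have h2 : m + 1 = 2 + (m - 1) := by omega
    simp [normalFormA, h2, pow_add, z, pow_two]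
  have hbX : ∀ i, constantCoeff (pderiv k b (X i : MvPowerSeries (Fin 4) k)) =
      if i = b then 1 else 0 := fun i => by
    by_cases h : i = b
    · subst h; simp
    · simp [pderiv_X_of_ne h, h]
  obtain ⟨r, hr, hg⟩ : ∃ r : Fin 4 → Fin 4 → MvPowerSeries (Fin 4) k,
      (∀ i j, constantCoeff (r i j) =
        polarForm f (A.1.col 0) (A.1.col i.succ) (A.1.col j.succ) / 2) ∧
      (localEquation f A : MvPowerSeries (Fin 4) k) = ∑ i, ∑ j, r i j * X i * X j :=
    ⟨_, fun i j => by simp, coe_localEquation hf h0⟩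
  have hgD : ∀ d : Derivation k (MvPowerSeries (Fin 4) k) (MvPowerSeries (Fin 4) k),
      constantCoeff (d (localEquation f A : MvPowerSeries (Fin 4) k)) = 0 := by
    intro d
    rw [hg]
    simp [Derivation.leibniz]
  have hg0 : constantCoeff (localEquation f A : MvPowerSeries (Fin 4) k) = 0 := by
    rw [hg]; simp
  have hgH : constantCoeff (pderiv k b (D (localEquation f A : MvPowerSeries (Fin 4) k))) =
      polarForm f (A.1.col 0) (∑ j, y j • A.1.col j.succ) (A.1.col b.succ) := by
    rw [hg]
    simp only [map_sum, Derivation.leibniz, smul_eq_mul, map_add, map_mul, constantCoeff_X, hDX,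
      zero_mul, mul_zero, zero_add, add_zero, constantCoeff_C, hbX, pderiv_C, hr, map_zero,
      Finset.sum_add_distrib, map_smul, LinearMap.sum_apply, LinearMap.smul_apply]
    simp only [mul_ite, ite_mul, mul_one, one_mul, mul_zero, zero_mul, Finset.sum_ite_eq',
      Finset.mem_univ, if_true, Finset.sum_ite_eq, Finset.sum_ite_irrel, Finset.sum_const_zero,
      hT.swap_right _ (A.1.col b.succ)]
    rw [zero_add, ← Finset.sum_add_distrib]
    exact Finset.sum_congr rfl fun i _ => by ring
  have hE := congrArg (fun x => constantCoeff (pderiv k b (D x))) hN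
  simp only [Derivation.leibniz, smul_eq_mul, map_add, map_mul, hg0, hgD, hgH, hz, hDz, hbz,
    zero_mul, mul_zero, zero_add, add_zero] at hE
  change _ = _ + σ * _ at hE
  generalize polarForm f (A.1.col 0) _ _ = t at hE ⊢
  simp only [Fin.sum_univ_four, Matrix.cons_val]
  linear_combination hE / 2

theorem linearIndependent_col (A : GL (Fin 5) k) : LinearIndependent k A.1.col :=
  Matrix.linearIndependent_cols_iff_isUnit.2 A.isUnit

theorem eq_zero_of_apply_col (A : GL (Fin 5) k) (l : Dual k (Fin 5 → k)) (h0 : l (A.1.col 0) = 0)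
    (h : ∀ j : Fin 4, l (A.1.col j.succ) = 0) : l = 0 := by
  let b := basisOfLinearIndependentOfCardEqFinrank (linearIndependent_col A) (by simp)
  have hb : ⇑b = A.1.col := by simp [b]
  refine b.ext fun i => ?_
  rw [hb]
  exact Fin.cases h0 h i

theorem sum_col_mem_span_iff (A : GL (Fin 5) k) (y : Fin 4 → k) :
    ∑ j, y j • A.1.col j.succ ∈ Submodule.span k {A.1.col 0} ↔ y = 0 := by
  constructor
  · intro h
    obtain ⟨c, hc⟩ := Submodule.mem_span_singleton.1 h
    have := Fintype.linearIndependent_iff.1 (linearIndependent_col A) (Fin.cons (-c) y) (by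
      rw [Fin.sum_univ_succ]
      simp only [Fin.cons_zero, Fin.cons_succ, ← hc]
      module)
    funext j
    simpa using this j.succ
  · rintro rfl
    simp

theorem exists_eq_add_sum_col (A : GL (Fin 5) k) (u : Fin 5 → k) :
    ∃ (c : k) (y : Fin 4 → k), u = c • A.1.col 0 + ∑ j, y j • A.1.col j.succ := by
  let b := basisOfLinearIndependentOfCardEqFinrank (linearIndependent_col A) (by simp)
  have hb : ⇑b = A.1.col := by simp [b]
  refine ⟨b.repr u 0, fun j => b.repr u j.succ, ?_⟩
  have := b.sum_repr u
  rw [Fin.sum_univ_succ, hb] at this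
  exact this.symm

variable [CharZero k] {f : MvPolynomial (Fin 5) k}

theorem isDegenerateAt_col_iff_of_associated (hf : f.IsHomogeneous 3) {A : GL (Fin 5) k}
    (h0 : polarForm f (A.1.col 0) (A.1.col 0) = 0)
    (θ : MvPowerSeries (Fin 4) k ≃ₐ[k] MvPowerSeries (Fin 4) k) {m : ℕ} (hm : 1 ≤ m)
    (hθ : Associated (θ (localEquation f A : MvPowerSeries (Fin 4) k))
      (normalFormA k m : MvPowerSeries (Fin 4) k)) :
    IsDegenerateAt (polarForm f) (A.1.col 0) ↔ 2 ≤ m := by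
  have hT := isSymmTrilinear_polarForm f
  have h00 : ∀ x, polarForm f (A.1.col 0) x (A.1.col 0) = 0 := fun x => by
    rw [hT.swap_right, h0]; rfl
  obtain ⟨Z, s, c, hZ, hs, hc, hH⟩ := exists_hessian_of_associated hf h0 θ hm hθ
  constructor
  · rintro ⟨u, hu, hu0⟩
    by_contra hm2
    have hs0 : s ≠ 0 := fun h => hm2 (hs.1 h)
    obtain ⟨d, y, rfl⟩ := exists_eq_add_sum_col A u
    apply hu
    have hy : polarForm f (A.1.col 0) (∑ j, y j • A.1.col j.succ) = 0 := by
      rwa [map_add, map_smul, h0, smul_zero, zero_add] at hu0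
    suffices y = 0 by
      rw [this]
      simpa using Submodule.smul_mem _ d (Submodule.mem_span_singleton_self (A.1.col 0))
    have h1 : Matrix.vecMul (fun i => ![1, 1, 1, s] i * Z.mulVec y i) Z = 0 := by
      funext b
      have := hH y b
      rw [hy, LinearMap.zero_apply, mul_zero] at this
      rw [Matrix.vecMul, dotProduct, ← this]
      rfl
    have h2 := Matrix.eq_zero_of_vecMul_eq_zero hZ.ne_zero h1
    refine Matrix.eq_zero_of_mulVec_eq_zero hZ.ne_zero (funext fun i => ?_)
    have h3 := congrFun h2 i
    refine (mul_eq_zero.1 h3).resolve_left ?_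
    fin_cases i <;> simp [hs0]
  · intro hm2
    have hs0 := hs.2 hm2
    let y := Z⁻¹.mulVec (Pi.single 3 1)
    have hZy : Z.mulVec y = Pi.single 3 1 := by
      simp only [y]
      rw [Matrix.mulVec_mulVec, Matrix.mul_nonsing_inv _ hZ, Matrix.one_mulVec]
    refine ⟨∑ j, y j • A.1.col j.succ, fun hmem => ?_, eq_zero_of_apply_col A _ (h00 _) fun b => ?_⟩
    · rw [sum_col_mem_span_iff] at hmem
      rw [hmem, Matrix.mulVec_zero] at hZy
      simpa using congrFun hZy 3
    · have := hH y b
      rw [hZy] at this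
      simpa [Fin.sum_univ_four, hs0, hc] using this

theorem isDegenerateAt_iff_of_isTypeA (hf : f.IsHomogeneous 3) {v : Fin 5 → k} (hv : v ≠ 0)
    (h0 : polarForm f v v = 0) {m : ℕ} (hm : 1 ≤ m)
    (h : IsTypeA f m (Projectivization.mk k v hv)) : IsDegenerateAt (polarForm f) v ↔ 2 ≤ m := by
  obtain ⟨A, hA, θ, hθ⟩ := h
  have hA0 : A.1.col 0 ≠ 0 := (linearIndependent_col A).ne_zero 0
  rw [smul_basePoint A hA0 rfl, Projectivization.mk_eq_mk_iff'] at hA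
  obtain ⟨c, hc⟩ := hA
  have hc0 : c ≠ 0 := by rintro rfl; exact hA0 (by rw [← hc, zero_smul])
  have h00 : polarForm f (A.1.col 0) (A.1.col 0) = 0 := by rw [← hc]; simp [h0]
  rw [← isDegenerateAt_col_iff_of_associated hf h00 θ hm hθ]
  constructor
  · intro h
    rw [← hc]
    exact h.smul hc0
  · intro h
    have : v = c⁻¹ • A.1.col 0 := by rw [← hc, smul_smul, inv_mul_cancel₀ hc0, one_smul]
    rw [this]
    exact h.smul (inv_ne_zero hc0)

theorem isTypeA_one_iff [IsAlgClosed k] (hf : f.IsHomogeneous 3) {v : Fin 5 → k} (hv : v ≠ 0)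
    (h0 : polarForm f v v = 0) :
    IsTypeA f 1 (Projectivization.mk k v hv) ↔ ¬ IsDegenerateAt (polarForm f) v :=
  ⟨fun h hd => by simpa using (isDegenerateAt_iff_of_isTypeA hf hv h0 le_rfl h).1 hd,
    isTypeA_one_of_not_isDegenerateAt hf hv h0⟩

end Hessian

end CubicThreefold

namespace CubicThreefold

open Module

section HomogeneousMaps

open MvPolynomial

variable {k : Type*} [Field k] {n : ℕ}

/-- The function `φ` is given by a homogeneous polynomial of degree `d`. -/
def IsHomogeneousMap (d : ℕ) (φ : (Fin n → k) → k) : Prop :=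
  ∃ P : MvPolynomial (Fin n) k, P.IsHomogeneous d ∧ ∀ x, eval x P = φ x

namespace IsHomogeneousMap

variable {d e : ℕ} {φ ψ : (Fin n → k) → k}

theorem mul (h : IsHomogeneousMap d φ) (h' : IsHomogeneousMap e ψ) :
    IsHomogeneousMap (d + e) fun x => φ x * ψ x := by
  obtain ⟨P, hP, hP'⟩ := h
  obtain ⟨Q, hQ, hQ'⟩ := h'
  exact ⟨P * Q, hP.mul hQ, fun x => by rw [map_mul, hP', hQ']⟩

theorem add (h : IsHomogeneousMap d φ) (h' : IsHomogeneousMap d ψ) :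
    IsHomogeneousMap d fun x => φ x + ψ x := by
  obtain ⟨P, hP, hP'⟩ := h
  obtain ⟨Q, hQ, hQ'⟩ := h'
  exact ⟨P + Q, hP.add hQ, fun x => by rw [map_add, hP', hQ']⟩

theorem sum {ι : Type*} {s : Finset ι} {φ : ι → (Fin n → k) → k}
    (h : ∀ i ∈ s, IsHomogeneousMap d (φ i)) : IsHomogeneousMap d fun x => ∑ i ∈ s, φ i x := by
  classical
  induction s using Finset.induction_on with
  | empty => exact ⟨0, isHomogeneous_zero _ _ _, fun x => by simp⟩
  | insert a s ha ih =>
    simp only [Finset.sum_insert ha]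
    exact (h a (Finset.mem_insert_self a s)).add
      (ih fun i hi => h i (Finset.mem_insert_of_mem hi))

theorem const_mul (c : k) (h : IsHomogeneousMap d φ) : IsHomogeneousMap d fun x => c * φ x := by
  obtain ⟨P, hP, hP'⟩ := h
  refine ⟨C c * P, ?_, fun x => by rw [map_mul, hP', eval_C]⟩
  simpa using (isHomogeneous_C (Fin n) c).mul hP

theorem neg (h : IsHomogeneousMap d φ) : IsHomogeneousMap d fun x => -φ x := by
  simpa using h.const_mul (-1)

theorem sub (h : IsHomogeneousMap d φ) (h' : IsHomogeneousMap d ψ) :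
    IsHomogeneousMap d fun x => φ x - ψ x := by
  simpa [sub_eq_add_neg] using h.add h'.neg

theorem apply (i : Fin n) : IsHomogeneousMap 1 fun x : Fin n → k => x i :=
  ⟨X i, isHomogeneous_X _ _, fun x => by simp⟩

theorem linear (l : (Fin n → k) →ₗ[k] k) : IsHomogeneousMap 1 fun x => l x := by
  have h : (fun x => l x) = fun x : Fin n → k => ∑ i, l (Pi.single i 1) * x i := by
    funext x
    rw [LinearMap.pi_apply_eq_sum_univ l x]
    refine Finset.sum_congr rfl fun i _ => ?_
    rw [smul_eq_mul, mul_comm]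
    congr 2
    ext j
    simp [Pi.single_apply, eq_comm]
  rw [h]
  exact sum fun i _ => (apply i).const_mul _

theorem bilinear (B : (Fin n → k) →ₗ[k] (Fin n → k) →ₗ[k] k) :
    IsHomogeneousMap 2 fun x => B x x := by
  have h : (fun x => B x x) = fun x : Fin n → k => ∑ i, x i * B (Pi.single i 1) x := by
    funext x
    have := LinearMap.pi_apply_eq_sum_univ (B.flip x) x
    rw [LinearMap.flip_apply] at this
    rw [this]
    refine Finset.sum_congr rfl fun i _ => ?_
    rw [smul_eq_mul, LinearMap.flip_apply]
    congr 3
    ext j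
    simp [Pi.single_apply, eq_comm]
  rw [h]
  exact sum fun i _ => (apply i).mul (linear _)

theorem trilinear (T : (Fin n → k) →ₗ[k] (Fin n → k) →ₗ[k] (Fin n → k) →ₗ[k] k) :
    IsHomogeneousMap 3 fun x => T x x x := by
  have h : (fun x => T x x x) = fun x : Fin n → k => ∑ i, x i * T (Pi.single i 1) x x := by
    funext x
    have := LinearMap.pi_apply_eq_sum_univ ((T.flip x).flip x) x
    rw [LinearMap.flip_apply, LinearMap.flip_apply] at this
    rw [this]
    refine Finset.sum_congr rfl fun i _ => ?_
    rw [smul_eq_mul, LinearMap.flip_apply, LinearMap.flip_apply]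
    congr 4
    ext j
    simp [Pi.single_apply, eq_comm]
  rw [h]
  exact sum fun i _ => (apply i).mul (bilinear _)

theorem map_smul (h : IsHomogeneousMap d φ) (a : k) (x : Fin n → k) :
    φ (a • x) = a ^ d * φ x := by
  obtain ⟨P, hP, hP'⟩ := h
  rw [← hP', ← hP', eval_eq', eval_eq', Finset.mul_sum]
  refine Finset.sum_congr rfl fun m hm => ?_
  have hd : ∑ i, m i = d := by
    have := hP (mem_support_iff.1 hm)
    rw [Finsupp.weight_apply, Finsupp.sum_fintype _ _ (by simp)] at this
    simpa using this
  simp only [Pi.smul_apply, smul_eq_mul, mul_pow, Finset.prod_mul_distrib,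
    Finset.prod_pow_eq_pow_sum, hd]
  ring

end IsHomogeneousMap

end HomogeneousMaps

theorem exists_monoidHom_of_rel {G M : Type*} [Group G] [Monoid M] (R : G → M → Prop)
    (ex : ∀ g, ∃ m, R g m) (uniq : ∀ g m m', R g m → R g m' → m = m') (one : R 1 1)
    (mul : ∀ g h m n, R g m → R h n → R (g * h) (m * n)) :
    ∃ φ : G →* Mˣ, ∀ g, R g (φ g) := by
  choose ρ hρ using ex
  let ψ : G →* M :=
    { toFun := ρ
      map_one' := uniq _ _ _ (hρ 1) one
      map_mul' := fun g h => uniq _ _ _ (hρ (g * h)) (mul _ _ _ _ (hρ g) (hρ h)) }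
  exact ⟨ψ.toHomUnits, hρ⟩

section Linearizable

variable {k : Type*} [Field k] [IsAlgClosed k] [CharZero k] {f : MvPolynomial (Fin 5) k}

/-- The rational map given by homogeneous coordinate functions. -/
theorem exists_ratMap {n m d : ℕ} (F : (Fin (n + 1) → k) → Fin (m + 1) → k)
    (hF : ∀ i, IsHomogeneousMap d fun x => F x i) :
    ∃ Φ : RatMap k n m, ∀ x (hx : x ≠ 0) y (hy : y ≠ 0),
      Φ.Maps (Projectivization.mk k x hx) (Projectivization.mk k y hy) ↔
        ∃ c : k, c ≠ 0 ∧ F x = c • y := by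
  choose P hP hPe using hF
  refine ⟨⟨d, P, hP⟩, fun x hx y hy => ?_⟩
  obtain ⟨a, ha⟩ := Projectivization.exists_smul_eq_mk_rep k x hx
  have hval : (fun i => MvPolynomial.eval (Projectivization.mk k x hx).rep (P i)) =
      (a : k) ^ d • F x := by
    funext i
    rw [hPe, ← ha]
    exact IsHomogeneousMap.map_smul ⟨P i, hP i, hPe i⟩ (a : k) x
  have had : (a : k) ^ d ≠ 0 := pow_ne_zero _ a.ne_zero
  simp only [RatMap.Maps, hval, Projectivization.mk_eq_mk_iff']
  constructor
  · rintro ⟨h, c, hc⟩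
    refine ⟨((a : k) ^ d)⁻¹ * c, mul_ne_zero (inv_ne_zero had) ?_, ?_⟩
    · rintro rfl
      exact h (by rw [← hc, zero_smul])
    · rw [mul_smul, hc, smul_smul, inv_mul_cancel₀ had, one_smul]
  · rintro ⟨c, hc, hFx⟩
    refine ⟨?_, (a : k) ^ d * c, by rw [hFx, mul_smul]⟩
    rw [hFx, smul_smul]
    exact smul_ne_zero (mul_ne_zero had hc) hy

theorem isLinearizable_of {d e : ℕ} (hf : f.IsHomogeneous 3)
    (F : (Fin 5 → k) → Fin 4 → k) (H : (Fin 4 → k) → Fin 5 → k)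
    (hF : ∀ i, IsHomogeneousMap d fun x => F x i) (hH : ∀ i, IsHomogeneousMap e fun x => H x i)
    (hHX : ∀ y, polarForm f (H y) (H y) (H y) = 0)
    (hHF : ∀ x, polarForm f x x x = 0 → ∃ c : k, H (F x) = c • x)
    (hFH : ∀ y, ∃ c : k, F (H y) = c • y)
    (hne : ∃ y, F (H y) ≠ 0 ∧ H y ≠ 0)
    (ρ : aut f →* GL (Fin 4) k)
    (hρ : ∀ g : aut f, ∃ A : GL (Fin 5) k, Matrix.ProjGenLinGroup.mk A = (g : PGL(Fin 5, k)) ∧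
      ∀ x, ∃ c : k, F (A • x) = c • ρ g • F x) :
    IsLinearizable (hypersurface f) (aut f) := by
  obtain ⟨Φ, hΦ⟩ := exists_ratMap F hF
  obtain ⟨Ψ, hΨ⟩ := exists_ratMap H hH
  have hmk : ∀ {n : ℕ} (p : ProjSpace k n), ∃ x, ∃ hx : x ≠ 0, p = Projectivization.mk k x hx :=
    fun p => ⟨p.rep, p.rep_nonzero, (Projectivization.mk_rep p).symm⟩
  refine ⟨3, ρ, Φ, Ψ, ⟨?_, ?_, ?_, ?_⟩, ?_⟩
  · obtain ⟨y, hy, hHy⟩ := hne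
    obtain ⟨c, hc⟩ := hFH y
    have hc0 : c ≠ 0 := by rintro rfl; exact hy (by rw [hc, zero_smul])
    have hy0 : y ≠ 0 := by rintro rfl; exact hy (by rw [hc, smul_zero])
    exact ⟨Projectivization.mk k (H y) hHy, (mk_mem_hypersurface_iff hf hHy).2 (hHX y),
      Projectivization.mk k y hy0, (hΦ _ _ _ _).2 ⟨c, hc0, hc⟩,
      (hΨ _ _ _ _).2 ⟨1, one_ne_zero, by rw [one_smul]⟩⟩
  · intro q p hqp
    obtain ⟨y, hy, rfl⟩ := hmk q
    obtain ⟨x, hx, rfl⟩ := hmk p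
    obtain ⟨c, hc, hH⟩ := (hΨ _ _ _ _).1 hqp
    rw [mk_mem_hypersurface_iff hf]
    have := hHX y
    rw [hH] at this
    simpa [hc] using this
  · intro p hp q p' hpq hqp
    obtain ⟨x, hx, rfl⟩ := hmk p
    obtain ⟨y, hy, rfl⟩ := hmk q
    obtain ⟨x', hx', rfl⟩ := hmk p'
    obtain ⟨c, hc, hFx⟩ := (hΦ _ _ _ _).1 hpq
    obtain ⟨c', hc', hHy⟩ := (hΨ _ _ _ _).1 hqp
    obtain ⟨b, hb⟩ := hHF x ((mk_mem_hypersurface_iff hf hx).1 hp)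
    have h1 : H (F x) = c ^ e • H y := by
      rw [hFx]; exact funext fun i => (hH i).map_smul c y
    rw [h1, hHy, smul_smul] at hb
    rw [Projectivization.mk_eq_mk_iff']
    refine ⟨(c ^ e * c')⁻¹ * b, ?_⟩
    rw [mul_smul, ← hb, smul_smul, inv_mul_cancel₀ (mul_ne_zero (pow_ne_zero _ hc) hc'), one_smul]
  · intro q p q' hqp hpq
    obtain ⟨y, hy, rfl⟩ := hmk q
    obtain ⟨x, hx, rfl⟩ := hmk p
    obtain ⟨y', hy', rfl⟩ := hmk q'
    obtain ⟨c, hc, hHy⟩ := (hΨ _ _ _ _).1 hqp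
    obtain ⟨c', hc', hFx⟩ := (hΦ _ _ _ _).1 hpq
    obtain ⟨b, hb⟩ := hFH y
    have h1 : F (H y) = c ^ d • F x := by
      rw [hHy]; exact funext fun i => (hF i).map_smul c x
    rw [h1, hFx, smul_smul] at hb
    rw [Projectivization.mk_eq_mk_iff']
    refine ⟨(c ^ d * c')⁻¹ * b, ?_⟩
    rw [mul_smul, ← hb, smul_smul, inv_mul_cancel₀ (mul_ne_zero (pow_ne_zero _ hc) hc'), one_smul]
  · intro g p hp q q' hpq hgpq
    obtain ⟨A, hA, hFA⟩ := hρ g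
    obtain ⟨x, hx, rfl⟩ := hmk p
    obtain ⟨y, hy, rfl⟩ := hmk q
    obtain ⟨y', hy', rfl⟩ := hmk q'
    have hgx : g • (Projectivization.mk k x hx : ProjSpace k 4) =
        Projectivization.mk k (A • x) ((smul_ne_zero_iff_ne A).2 hx) := by
      rw [← smul_mk A hx, hA]; rfl
    rw [hgx] at hgpq
    obtain ⟨c, hc, hFx⟩ := (hΦ _ _ _ _).1 hpq
    obtain ⟨c', hc', hFAx⟩ := (hΦ _ _ _ _).1 hgpq
    obtain ⟨b, hb⟩ := hFA x
    rw [Projectivization.smul_mk, Projectivization.mk_eq_mk_iff']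
    refine ⟨c'⁻¹ * (b * c), ?_⟩
    rw [hFAx, hFx] at hb
    have h2 : ρ g • (c • y) = c • ρ g • y := Matrix.mulVec_smul _ _ _
    rw [h2] at hb
    rw [mul_smul, mul_smul, ← hb, smul_smul, inv_mul_cancel₀ hc', one_smul]

end Linearizable

end CubicThreefold

namespace CubicThreefold

open Module

section FixedPoint

variable {k : Type*} [Field k] [IsAlgClosed k] [CharZero k] {f : MvPolynomial (Fin 5) k}

theorem exists_smul_eq_of_mk_eq_mk {A B : GL (Fin 5) k}
    (h : Matrix.ProjGenLinGroup.mk A = Matrix.ProjGenLinGroup.mk B) :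
    ∃ c : kˣ, ∀ x : Fin 5 → k, B • x = c • (A • x) := by
  obtain ⟨c, rfl⟩ := Matrix.ProjGenLinGroup.mk_eq_mk_iff.1 h
  refine ⟨c, fun x => ?_⟩
  rw [mul_smul]
  have : Matrix.GeneralLinearGroup.scalar (Fin 5) c • x = c • x := by
    change Matrix.mulVec _ _ = _
    simp [Units.smul_def]
  rw [this]
  exact Matrix.mulVec_smul _ _ _

theorem exists_mk_eq_smul (A : GL (Fin 5) k) (c : kˣ) :
    ∃ B : GL (Fin 5) k, Matrix.ProjGenLinGroup.mk B = Matrix.ProjGenLinGroup.mk A ∧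
      ∀ x : Fin 5 → k, B • x = c • (A • x) := by
  refine ⟨A * Matrix.GeneralLinearGroup.scalar (Fin 5) c,
    (Matrix.ProjGenLinGroup.mk_eq_mk_iff.2 ⟨c, rfl⟩).symm, fun x => ?_⟩
  rw [mul_smul]
  have : Matrix.GeneralLinearGroup.scalar (Fin 5) c • x = c • x := by
    change Matrix.mulVec _ _ = _
    simp [Units.smul_def]
  rw [this]
  exact Matrix.mulVec_smul _ _ _

theorem eq_of_forall_smul_eq {A B : GL (Fin 5) k} (h : ∀ x : Fin 5 → k, A • x = B • x) : A = B := by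
  apply Units.ext
  apply Matrix.mulVec_injective
  funext x
  exact h x

theorem exists_projection {v : Fin 5 → k} (hv : v ≠ 0) :
    ∃ (π : (Fin 5 → k) →ₗ[k] (Fin 4 → k)) (σ : (Fin 4 → k) →ₗ[k] (Fin 5 → k)),
      (∀ y, π (σ y) = y) ∧ π v = 0 ∧ ∀ x, ∃ s : k, x = s • v + σ (π x) := by
  obtain ⟨U, hU⟩ := Submodule.exists_isCompl (k ∙ v)
  have hrank : finrank k U = 4 := by
    have := Submodule.finrank_add_eq_of_isCompl hU
    rw [finrank_span_singleton hv, Module.finrank_fin_fun] at this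
    omega
  let e : U ≃ₗ[k] (Fin 4 → k) := LinearEquiv.ofFinrankEq _ _ (by simp [hrank])
  let p := U.projectionOnto (k ∙ v) hU.symm
  refine ⟨e.toLinearMap ∘ₗ p, U.subtype ∘ₗ e.symm.toLinearMap, fun y => ?_, ?_, fun x => ?_⟩
  · simp [p]
  · simp [p]
  · have hx : x - p x ∈ k ∙ v := by
      rw [← Submodule.ker_projectionOnto hU.symm, LinearMap.mem_ker, map_sub, sub_eq_zero]
      exact (Submodule.projectionOnto_apply_left hU.symm (p x)).symm
    obtain ⟨s, hs⟩ := Submodule.mem_span_singleton.1 hx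
    exact ⟨s, by simp [hs, p]⟩

/-- Projection from a fixed singular point linearizes the action. -/
theorem isLinearizable_of_fixed (hf : f.IsHomogeneous 3) {v : Fin 5 → k} (hv : v ≠ 0)
    (h0 : polarForm f v v = 0) (hv0 : polarForm f v ≠ 0)
    (hfix : ∀ A : GL (Fin 5) k, Matrix.ProjGenLinGroup.mk A ∈ aut f → ∃ c : k, A • v = c • v) :
    IsLinearizable (hypersurface f) (aut f) := by
  have hT := isSymmTrilinear_polarForm f
  obtain ⟨π, σ, hπσ, hπv, hσπ⟩ := exists_projection hv
  let Q : (Fin 4 → k) → k := fun y => polarForm f v (σ y) (σ y)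
  let K : (Fin 4 → k) → k := fun y => polarForm f (σ y) (σ y) (σ y)
  have hQ : IsHomogeneousMap 2 Q :=
    IsHomogeneousMap.bilinear ((polarForm f v).compl₁₂ σ σ)
  have hK : IsHomogeneousMap 3 K := by
    have := IsHomogeneousMap.trilinear (n := 4) (k := k)
      (LinearMap.mk₂ k (fun x y => (polarForm f (σ x) (σ y)).comp σ)
      (fun x y z => by ext; simp) (fun c x y => by ext; simp)
      (fun x y z => by ext; simp) (fun c x y => by ext; simp))
    exact this
  have hdiag : ∀ s r y, polarForm f (s • v + r • σ y) (s • v + r • σ y) (s • v + r • σ y) =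
      r ^ 2 * (3 * s * Q y + r * K y) := by
    intro s r y
    rw [polarForm_diag_add_smul hT (by simp [h0])]
    simp [Q, K]
    ring
  let H : (Fin 4 → k) → Fin 5 → k := fun y => (-K y) • v + (3 * Q y) • σ y
  let R : aut f → Matrix (Fin 4) (Fin 4) k → Prop := fun g M =>
    ∃ A : GL (Fin 5) k, Matrix.ProjGenLinGroup.mk A = (g : PGL(Fin 5, k)) ∧ A • v = v ∧
      ∀ x, π (A • x) = M.mulVec (π x)
  obtain ⟨ρ, hρ⟩ := exists_monoidHom_of_rel R
    (by
      intro g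
      obtain ⟨A, hA⟩ := Matrix.ProjGenLinGroup.mk_surjective (g : PGL(Fin 5, k))
      obtain ⟨c, hc⟩ := hfix A (by rw [hA]; exact g.2)
      have hc0 : c ≠ 0 := by
        rintro rfl
        rw [zero_smul] at hc
        exact (smul_ne_zero_iff_ne A).2 hv hc
      obtain ⟨B, hB, hBx⟩ := exists_mk_eq_smul A (Units.mk0 c hc0)⁻¹
      have hBv : B • v = v := by
        rw [hBx, hc, Units.smul_def, smul_smul]
        simp [hc0]
      refine ⟨LinearMap.toMatrix' (π ∘ₗ B.1.mulVecLin ∘ₗ σ), B, by rw [hB, hA], hBv, fun x => ?_⟩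
      obtain ⟨s, hs⟩ := hσπ x
      rw [← Matrix.toLin'_apply, Matrix.toLin'_toMatrix']
      conv_lhs => rw [hs]
      rw [smul_add]
      have : B • (s • v) = s • (B • v) := Matrix.mulVec_smul _ _ _
      rw [this, hBv, map_add, map_smul, hπv, smul_zero, zero_add]
      rfl)
    (by
      rintro g M M' ⟨A, hA, hAv, hAx⟩ ⟨B, hB, hBv, hBx⟩
      obtain ⟨c, hc⟩ := exists_smul_eq_of_mk_eq_mk (hA.trans hB.symm)
      have hAB : A = B := by
        refine eq_of_forall_smul_eq fun x => ?_
        have hc1 : (c : k) = 1 := by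
          have := hc v
          rw [hAv, hBv, Units.smul_def] at this
          exact smul_left_injective k hv (by simpa using this.symm)
        rw [hc x, show c = 1 from Units.ext hc1, one_smul]
      subst hAB
      apply Matrix.mulVec_injective
      funext y
      rw [← hπσ y, ← hAx, ← hBx])
    ⟨1, by simp, one_smul _ _, fun x => by rw [one_smul, Matrix.one_mulVec]⟩
    (by
      rintro g h M N ⟨A, hA, hAv, hAx⟩ ⟨B, hB, hBv, hBx⟩
      refine ⟨A * B, by rw [map_mul, hA, hB]; rfl, by rw [mul_smul, hBv, hAv], fun x => ?_⟩
      rw [mul_smul, hAx, hBx, Matrix.mulVec_mulVec])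
  have hFH : ∀ y, π (H y) = (3 * Q y) • y := fun y => by
    simp [H, hπv, hπσ]
  refine isLinearizable_of (d := 1) (e := 3) hf (fun x => π x) H
    (fun i => IsHomogeneousMap.linear (LinearMap.proj i ∘ₗ π)) (fun i => ?_) (fun y => ?_)
    (fun x hx => ?_) (fun y => ⟨_, hFH y⟩) ?_ ρ fun g => ?_
  · have h1 : IsHomogeneousMap 3 fun y => -K y * v i := by
      simpa [mul_comm] using hK.neg.const_mul (v i)
    have h2 : IsHomogeneousMap 3 fun y => 3 * Q y * σ y i :=
      (hQ.const_mul 3).mul (IsHomogeneousMap.linear (LinearMap.proj i ∘ₗ σ))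
    exact h1.add h2
  · rw [hdiag]
    ring
  · obtain ⟨s, hs⟩ := hσπ x
    refine ⟨3 * Q (π x), ?_⟩
    have h1 := hdiag s 1 (π x)
    rw [one_smul, ← hs, hx] at h1
    have h2 : -K (π x) = 3 * Q (π x) * s := by linear_combination h1
    calc H (π x) = (3 * Q (π x)) • (s • v + σ (π x)) := by
          simp only [H, h2]
          module
      _ = _ := by rw [← hs]
  · have hex : ∃ y, Q y ≠ 0 := by
      by_contra! hall
      apply hv0
      have h1 : ∀ x, polarForm f v x x = 0 := by
        intro x
        obtain ⟨s, hs⟩ := hσπ x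
        have h00 : ∀ z, polarForm f v v z = 0 := fun z => by rw [h0]; rfl
        rw [hs]
        simp only [map_add, map_smul, LinearMap.add_apply, LinearMap.smul_apply, h00,
          hT.swap_right v _ v]
        simpa using hall (π x)
      refine LinearMap.ext fun x => LinearMap.ext fun z => ?_
      have h2 := h1 (x + z)
      simp only [map_add, LinearMap.add_apply, h1, hT.swap_right v z x] at h2
      have h3 : 2 * polarForm f v x z = 0 := by linear_combination h2
      simpa using h3
    obtain ⟨y, hy⟩ := hex
    have hy0 : y ≠ 0 := by rintro rfl; exact hy (by simp [Q])
    have h1 : π (H y) ≠ 0 := by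
      rw [hFH]
      exact smul_ne_zero (mul_ne_zero three_ne_zero hy) hy0
    exact ⟨y, h1, fun h => h1 (by rw [h, map_zero])⟩
  · obtain ⟨A, hA, -, hAx⟩ := hρ g
    exact ⟨A, hA, fun x => ⟨1, by rw [one_smul]; exact hAx x⟩⟩

end FixedPoint

end CubicThreefold

namespace CubicThreefold

open Module

section Swap

variable {k : Type*} [Field k] [IsAlgClosed k] [CharZero k] {f : MvPolynomial (Fin 5) k}

/-- `A` fixes both lines `⟨v⟩`, `⟨v'⟩` and `s = 1`, or it interchanges them and `s = -1`. -/
def HasSign (v v' : Fin 5 → k) (A : GL (Fin 5) k) (s : k) : Prop :=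
  (s = 1 ∧ ∃ a b : k, A • v = a • v ∧ A • v' = b • v') ∨
    (s = -1 ∧ ∃ a b : k, A • v = a • v' ∧ A • v' = b • v)

theorem gl_smul_smul (A : GL (Fin 5) k) (c : k) (x : Fin 5 → k) : A • (c • x) = c • (A • x) :=
  Matrix.mulVec_smul _ _ _

theorem HasSign.mul {v v' : Fin 5 → k} {A B : GL (Fin 5) k} {s t : k} (hA : HasSign v v' A s)
    (hB : HasSign v v' B t) : HasSign v v' (A * B) (s * t) := by
  rcases hA with ⟨rfl, a, b, h1, h2⟩ | ⟨rfl, a, b, h1, h2⟩ <;>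
  rcases hB with ⟨rfl, c, d, h3, h4⟩ | ⟨rfl, c, d, h3, h4⟩
  · exact Or.inl ⟨by ring, c * a, d * b, by rw [mul_smul, h3, gl_smul_smul, h1, smul_smul],
      by rw [mul_smul, h4, gl_smul_smul, h2, smul_smul]⟩
  · exact Or.inr ⟨by ring, c * b, d * a, by rw [mul_smul, h3, gl_smul_smul, h2, smul_smul],
      by rw [mul_smul, h4, gl_smul_smul, h1, smul_smul]⟩
  · exact Or.inr ⟨by ring, c * a, d * b, by rw [mul_smul, h3, gl_smul_smul, h1, smul_smul],
      by rw [mul_smul, h4, gl_smul_smul, h2, smul_smul]⟩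
  · exact Or.inl ⟨by ring, c * b, d * a, by rw [mul_smul, h3, gl_smul_smul, h2, smul_smul],
      by rw [mul_smul, h4, gl_smul_smul, h1, smul_smul]⟩

theorem HasSign.unique {v v' : Fin 5 → k} (hv : LinearIndependent k ![v, v']) {A : GL (Fin 5) k}
    {s t : k} (h : HasSign v v' A s) (h' : HasSign v v' A t) : s = t := by
  have key : ∀ a b : k, A • v = a • v → A • v = b • v' → False := by
    intro a b h1 h2
    have h3 := LinearIndependent.pair_iff.1 hv a (-b) (by rw [neg_smul, ← h1, h2, add_neg_cancel])
    rw [h3.1, zero_smul] at h1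
    exact (smul_ne_zero_iff_ne A).2 (hv.ne_zero 0) h1
  rcases h with ⟨rfl, a, b, h1, h2⟩ | ⟨rfl, a, b, h1, h2⟩ <;>
  rcases h' with ⟨rfl, c, d, h3, h4⟩ | ⟨rfl, c, d, h3, h4⟩
  · rfl
  · exact (key _ _ h1 h3).elim
  · exact (key _ _ h3 h1).elim
  · rfl

/-- The action is linearized by the birational map `(y₁, y₂, w) ↦ (y₁ y₂ w, y₂ Q₂(w) - y₁ Q₁(w))`. -/
theorem isLinearizable_of_isAdapted (hf : f.IsHomogeneous 3) {v v' o e n : Fin 5 → k}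
    (h : IsAdapted (polarForm f) v v' o e n)
    (hc : ∀ A : GL (Fin 5) k, Matrix.ProjGenLinGroup.mk A ∈ aut f → ∃ c : k, c ≠ 0 ∧
      ∀ x y z, polarForm f (A • x) (A • y) (A • z) = c * polarForm f x y z)
    (hS : ∀ A : GL (Fin 5) k, Matrix.ProjGenLinGroup.mk A ∈ aut f → ∃ s, HasSign v v' A s)
    (hW : ∀ A : GL (Fin 5) k, Matrix.ProjGenLinGroup.mk A ∈ aut f →
      ∀ w ∈ Submodule.span k {o, e, n}, A • w ∈ Submodule.span k {o, e, n}) :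
    IsLinearizable (hypersurface f) (aut f) := by
  have hT := isSymmTrilinear_polarForm f
  set T := polarForm f with hTdef
  let B := basisOfLinearIndependentOfCardEqFinrank h.indep (by simp)
  have hB : ⇑B = ![v, v', o, e, n] := by simp [B]
  have hvv' : LinearIndependent k ![v, v'] := by
    rw [LinearIndependent.pair_iff]
    intro s t hst
    have := Fintype.linearIndependent_iff.1 h.indep ![s, t, 0, 0, 0] (by
      simpa [Fin.sum_univ_five] using hst)
    exact ⟨this 0, this 1⟩
  have hv0 : v ≠ 0 := hvv'.ne_zero 0
  have hv0' : v' ≠ 0 := hvv'.ne_zero 1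
  let E : Fin 4 → k := Pi.single 3 1
  let ω : (Fin 4 → k) →ₗ[k] (Fin 5 → k) := (LinearMap.proj 0).smulRight o +
    (LinearMap.proj 1).smulRight e + (LinearMap.proj 2).smulRight n
  let π : (Fin 5 → k) →ₗ[k] (Fin 4 → k) := LinearMap.pi ![B.coord 2, B.coord 3, B.coord 4, 0]
  have hω : ∀ t, ω t = t 0 • o + t 1 • e + t 2 • n := fun t => rfl
  have hωW : ∀ t, ω t ∈ Submodule.span k {o, e, n} := fun t => by
    rw [hω]
    exact Submodule.mem_span_triple.2 ⟨_, _, _, rfl⟩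
  have hωE : ω E = 0 := by simp [hω, E]
  have hB0 : B 0 = v := by rw [hB]; rfl
  have hB1 : B 1 = v' := by rw [hB]; rfl
  have hB2 : B 2 = o := by rw [hB]; rfl
  have hB3 : B 3 = e := by rw [hB]; rfl
  have hB4 : B 4 = n := by rw [hB]; rfl
  have hcoord : ∀ i (a a' : k) t, B.coord i (a • v + a' • v' + ω t) =
      ![a, a', t 0, t 1, t 2] i := by
    intro i a a' t
    have : a • v + a' • v' + ω t = ∑ j, ![a, a', t 0, t 1, t 2] j • B j := by
      simp only [Fin.sum_univ_five, hB0, hB1, hB2, hB3, hB4, hω, Matrix.cons_val]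
      module
    rw [this, Basis.coord_apply, Basis.repr_sum_self]
  have hπ : ∀ (a a' : k) t, π (a • v + a' • v' + ω t) = t - t 3 • E := by
    intro a a' t
    funext i
    have : π (a • v + a' • v' + ω t) i =
      (![B.coord 2, B.coord 3, B.coord 4, 0] i : Dual k (Fin 5 → k)) (a • v + a' • v' + ω t) := rfl
    rw [this]
    fin_cases i <;> simp [hcoord, E, -Basis.coord_apply]
  have hdec : ∀ x, x = B.coord 0 x • v + B.coord 1 x • v' + ω (π x) := by
    intro x
    have := B.sum_repr x
    rw [Fin.sum_univ_five, hB0, hB1, hB2, hB3, hB4] at this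
    conv_lhs => rw [← this]
    have h1 : ω (π x) = B.repr x 2 • o + B.repr x 3 • e + B.repr x 4 • n := rfl
    rw [h1]
    simp only [Basis.coord_apply]
    module
  have hπ3 : ∀ x, π x 3 = 0 := fun x => rfl
  have hWω : ∀ w ∈ Submodule.span k {o, e, n}, w = ω (π w) := by
    intro w hw
    obtain ⟨r, s, t, rfl⟩ := Submodule.mem_span_triple.1 hw
    have h1 := hπ 0 0 ![r, s, t, 0]
    have h2 : (0 : k) • v + (0 : k) • v' + ω ![r, s, t, 0] = r • o + s • e + t • n := by
      rw [hω]; simp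
    rw [h2] at h1
    rw [h1, map_sub, map_smul, hωE, smul_zero, sub_zero, hω]
    simp
  have hvz : ∀ z, T v v z = 0 := fun z => by rw [h.sing]; rfl
  have hvz' : ∀ z, T v' v' z = 0 := fun z => by rw [h.sing']; rfl
  have s2 : ∀ x, T v x v = 0 := fun x => by rw [hT.swap_right, hvz]
  have s3 : ∀ x, T x v' v' = 0 := fun x => by rw [hT.swap_left, hT.swap_right, hvz']
  have s4 : ∀ x, T v' x v' = 0 := fun x => by rw [hT.swap_right, hvz']
  have s5 : ∀ x, T x v v = 0 := fun x => by rw [hT.swap_left, hT.swap_right, hvz]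
  have hL : ∀ t, T v v' (ω t) = t 0 := by
    intro t
    simp [hω, h.apply_o, h.apply_e, h.apply_n]
  have hLx : ∀ x, T v v' x = π x 0 := by
    intro x
    conv_lhs => rw [hdec x]
    simp only [map_add, map_smul, s2, s3, hL, smul_zero, zero_add]
  let q₁ : (Fin 4 → k) → k := fun t => T v (ω t) (ω t)
  let q₂ : (Fin 4 → k) → k := fun t => T v' (ω t) (ω t)
  have hq₁ : ∀ (c z : k) t, q₁ (c • t + z • E) = c ^ 2 * q₁ t := fun c z t => by
    simp [q₁, hωE]; ring
  have hq₂ : ∀ (c z : k) t, q₂ (c • t + z • E) = c ^ 2 * q₂ t := fun c z t => by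
    simp [q₂, hωE]; ring
  have hdiag : ∀ (a a' : k) t, T (a • v + a' • v' + ω t) (a • v + a' • v' + ω t)
      (a • v + a' • v' + ω t) = 6 * a * a' * t 0 + 3 * a * q₁ t + 3 * a' * q₂ t := by
    intro a a' t
    have hp : T (ω t) (ω t) (ω t) = 0 := h.plane _ (hωW t) _ (hωW t) _ (hωW t)
    simp only [map_add, map_smul, LinearMap.add_apply, LinearMap.smul_apply, hvz, hvz', s2, s3, s4,
      s5, hp, hT.swap_left v' v, hT.swap_left (ω t) v, hT.swap_left (ω t) v',
      hT.swap_right v (ω t) v', hT.swap_right v' (ω t) v, hT.swap_right (ω t) (ω t) v,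
      hT.swap_right (ω t) (ω t) v', hL, smul_eq_mul, q₁, q₂]
    ring
  let F : (Fin 5 → k) → Fin 4 → k := fun x =>
    (B.coord 0 x * B.coord 1 x) • π x +
      (B.coord 1 x * q₂ (π x) - B.coord 0 x * q₁ (π x)) • E
  let H : (Fin 4 → k) → Fin 5 → k := fun t =>
    (2 * q₂ t * (t 3 + 2 * t 0)) • v + (-2 * q₁ t * (t 3 - 2 * t 0)) • v' +
      ω ((t 3 ^ 2 - 4 * t 0 ^ 2) • t)
  have hF : ∀ (a a' : k) t, F (a • v + a' • v' + ω t) =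
      (a * a') • (t - t 3 • E) + (a' * q₂ t - a * q₁ t) • E := by
    intro a a' t
    have e1 : q₁ (t - t 3 • E) = q₁ t := by
      have := hq₁ 1 (-t 3) t
      rw [one_smul, neg_smul, ← sub_eq_add_neg] at this
      rw [this]; ring
    have e2 : q₂ (t - t 3 • E) = q₂ t := by
      have := hq₂ 1 (-t 3) t
      rw [one_smul, neg_smul, ← sub_eq_add_neg] at this
      rw [this]; ring
    simp only [F, hπ, hcoord, Matrix.cons_val_zero, Matrix.cons_val_one, e1, e2]
  have hq₁s : ∀ (c : k) t, q₁ (c • t) = c ^ 2 * q₁ t := fun c t => by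
    have := hq₁ c 0 t
    rwa [zero_smul, add_zero] at this
  have hq₂s : ∀ (c : k) t, q₂ (c • t) = c ^ 2 * q₂ t := fun c t => by
    have := hq₂ c 0 t
    rwa [zero_smul, add_zero] at this
  have hFH : ∀ t, F (H t) = (-4 * q₁ t * q₂ t * (t 3 ^ 2 - 4 * t 0 ^ 2) ^ 2) • t := by
    intro t
    simp only [H]
    rw [hF, hq₁s, hq₂s]
    simp only [Pi.smul_apply, smul_eq_mul]
    module
  have hQ1 : IsHomogeneousMap 2 q₁ := IsHomogeneousMap.bilinear ((T v).compl₁₂ ω ω)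
  have hQ2 : IsHomogeneousMap 2 q₂ := IsHomogeneousMap.bilinear ((T v').compl₁₂ ω ω)
  let R : aut f → Matrix (Fin 4) (Fin 4) k → Prop := fun g M =>
    ∃ A : GL (Fin 5) k, Matrix.ProjGenLinGroup.mk A = (g : PGL(Fin 5, k)) ∧
      (∀ x, T v v' (A • x) = T v v' x) ∧ ∃ s, HasSign v v' A s ∧
      ∀ x z, M.mulVec (π x + z • E) = π (A • x) + (s * z) • E
  have hπv : π v = 0 := by simpa using hπ 1 0 0
  have hπv' : π v' = 0 := by simpa using hπ 0 1 0
  have hπω : ∀ t, π (ω t) = t - t 3 • E := fun t => by simpa using hπ 0 0 t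
  have hπA : ∀ A s, HasSign v v' A s → ∀ x, π (A • x) = π (A • ω (π x)) := by
    intro A s hA x
    have h1 : A • x = B.coord 0 x • (A • v) + B.coord 1 x • (A • v') + A • ω (π x) := by
      conv_lhs => rw [hdec x]
      rw [smul_add, smul_add, gl_smul_smul, gl_smul_smul]
    rw [h1]
    rcases hA with ⟨-, a, b, h1, h2⟩ | ⟨-, a, b, h1, h2⟩ <;>
    simp [h1, h2, hπv, hπv', -Basis.coord_apply]
  have hA0 : ∀ (A : GL (Fin 5) k) (x : Fin 5 → k) (a : k) (y : Fin 5 → k), x ≠ 0 → A • x = a • y →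
      a ≠ 0 := by
    rintro A x a y hx hxy rfl
    rw [zero_smul] at hxy
    exact (smul_ne_zero_iff_ne A).2 hx hxy
  have hμ : ∀ A : GL (Fin 5) k, Matrix.ProjGenLinGroup.mk A ∈ aut f → ∃ μ : k, μ ≠ 0 ∧
      ∀ x, T v v' (A • x) = μ * T v v' x := by
    intro A hA
    obtain ⟨c, hc0, hcA⟩ := hc A hA
    obtain ⟨s, ⟨-, a, b, h1, h2⟩ | ⟨-, a, b, h1, h2⟩⟩ := hS A hA
    all_goals
      have ha := hA0 A _ _ _ hv0 h1
      have hb := hA0 A _ _ _ hv0' h2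
      refine ⟨c / (a * b), div_ne_zero hc0 (mul_ne_zero ha hb), fun x => ?_⟩
      have := hcA v v' x
      rw [h1, h2] at this
      simp only [map_smul, LinearMap.smul_apply, smul_eq_mul, hT.swap_left v' v] at this
      field_simp
      linear_combination this
  obtain ⟨ρ, hρ⟩ := exists_monoidHom_of_rel R
    (by
      intro g
      obtain ⟨A, hA⟩ := Matrix.ProjGenLinGroup.mk_surjective (g : PGL(Fin 5, k))
      obtain ⟨μ, hμ0, hμA⟩ := hμ A (by rw [hA]; exact g.2)
      obtain ⟨A', hA', hAx⟩ := exists_mk_eq_smul A (Units.mk0 μ hμ0)⁻¹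
      obtain ⟨s, hs⟩ := hS A' (by rw [hA', hA]; exact g.2)
      refine ⟨LinearMap.toMatrix' (π ∘ₗ A'.1.mulVecLin ∘ₗ ω +
        (s • LinearMap.proj (R := k) (φ := fun _ : Fin 4 => k) 3).smulRight E), A', by rw [hA', hA],
        fun x => ?_, s, hs, fun x z => ?_⟩
      · rw [hAx, Units.smul_def, map_smul, hμA]
        simp [hμ0]
      · rw [← Matrix.toLin'_apply, Matrix.toLin'_toMatrix', hπA A' s hs x]
        have h1 : ∀ t, A'.1.mulVecLin t = A' • t := fun t => rfl
        simp [hωE, h1, hπ3, E])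
    (by
      rintro g M M' ⟨A, hA, hAL, s, hs, hAM⟩ ⟨A', hA', hAL', s', hs', hAM'⟩
      obtain ⟨c, hc⟩ := exists_smul_eq_of_mk_eq_mk (hA.trans hA'.symm)
      have hAA : A = A' := by
        refine eq_of_forall_smul_eq fun x => ?_
        have hc1 : (c : k) = 1 := by
          have := hAL' o
          rw [hc, Units.smul_def, map_smul, hAL, h.apply_o] at this
          simpa using this
        rw [hc x, show c = 1 from Units.ext hc1, one_smul]
      subst hAA
      obtain rfl := hs.unique hvv' hs'
      apply Matrix.mulVec_injective
      funext y
      have hy : y = π (ω y) + y 3 • E := by rw [hπω]; module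
      rw [hy, hAM, hAM'])
    ⟨1, by simp, fun x => by rw [one_smul], 1, Or.inl ⟨rfl, 1, 1, by simp, by simp⟩,
      fun x z => by rw [one_smul, Matrix.one_mulVec, one_mul]⟩
    (by
      rintro g g' M M' ⟨A, hA, hAL, s, hs, hAM⟩ ⟨A', hA', hAL', s', hs', hAM'⟩
      refine ⟨A * A', by rw [map_mul, hA, hA']; rfl, fun x => by rw [mul_smul, hAL, hAL'],
        s * s', hs.mul hs', fun x z => ?_⟩
      rw [← Matrix.mulVec_mulVec, hAM', hAM, mul_smul A A' x, mul_assoc s s' z])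
  refine isLinearizable_of (d := 3) (e := 3) hf F H (fun i => ?_) (fun i => ?_) (fun y => ?_)
    (fun x hx => ?_) (fun y => ⟨_, hFH y⟩) ?_ ρ fun g => ?_
  · have hp : ∀ i, IsHomogeneousMap 1 fun x => π x i := fun i =>
      IsHomogeneousMap.linear (LinearMap.proj i ∘ₗ π)
    have hb : ∀ i, IsHomogeneousMap 1 fun x => B.coord i x := fun i => IsHomogeneousMap.linear _
    have h1 : IsHomogeneousMap 2 fun x => q₁ (π x) :=
      IsHomogeneousMap.bilinear ((T v).compl₁₂ (ω ∘ₗ π) (ω ∘ₗ π))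
    have h2 : IsHomogeneousMap 2 fun x => q₂ (π x) :=
      IsHomogeneousMap.bilinear ((T v').compl₁₂ (ω ∘ₗ π) (ω ∘ₗ π))
    have h3 : IsHomogeneousMap 3 fun x =>
        (B.coord 1 x * q₂ (π x) - B.coord 0 x * q₁ (π x)) * E i := by
      simpa only [mul_comm (E i)] using (((hb 1).mul h2).sub ((hb 0).mul h1)).const_mul (E i)
    exact (((hb 0).mul (hb 1)).mul (hp i)).add h3
  · have ha : ∀ c : k, IsHomogeneousMap 1 fun t : Fin 4 → k => t 3 + c * t 0 := fun c =>
      (IsHomogeneousMap.apply 3).add ((IsHomogeneousMap.apply 0).const_mul c)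
    have h1 : IsHomogeneousMap 3 fun t => v i * (2 * q₂ t * (t 3 + 2 * t 0)) :=
      ((hQ2.const_mul 2).mul (ha 2)).const_mul _
    have h2 : IsHomogeneousMap 3 fun t => v' i * (-2 * q₁ t * (t 3 + -2 * t 0)) :=
      ((hQ1.const_mul (-2)).mul (ha (-2))).const_mul _
    have h3 : IsHomogeneousMap 3 fun t => (t 3 + 2 * t 0) * (t 3 + -2 * t 0) * ω t i :=
      ((ha 2).mul (ha (-2))).mul (IsHomogeneousMap.linear (LinearMap.proj i ∘ₗ ω))
    have h4 : (fun t => H t i) = fun t => v i * (2 * q₂ t * (t 3 + 2 * t 0)) +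
        v' i * (-2 * q₁ t * (t 3 + -2 * t 0)) + (t 3 + 2 * t 0) * (t 3 + -2 * t 0) * ω t i := by
      funext t
      simp only [H, map_smul, Pi.add_apply, Pi.smul_apply, smul_eq_mul]
      ring
    rw [h4]
    exact (h1.add h2).add h3
  · rw [hdiag, hq₁s, hq₂s]
    simp only [Pi.smul_apply, smul_eq_mul]
    ring
  · obtain ⟨a, a', t, ht3, rfl⟩ : ∃ a a' t, t 3 = 0 ∧ x = a • v + a' • v' + ω t :=
      ⟨_, _, _, hπ3 x, hdec x⟩
    rw [hdiag] at hx
    have hx2 : 2 * (a * a') * t 0 = -(a * q₁ t) - a' * q₂ t := by linear_combination hx / 3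
    refine ⟨-4 * (a * a') ^ 2 * q₁ t * q₂ t, ?_⟩
    have hE0 : E 0 = 0 := by simp [E]
    have hE3 : E 3 = 1 := by simp [E]
    have h1 : F (a • v + a' • v' + ω t) = (a * a') • t + (a' * q₂ t - a * q₁ t) • E := by
      rw [hF, ht3, zero_smul, sub_zero]
    simp only [h1, H, hq₁, hq₂, map_smul, map_add, hωE, Pi.add_apply, Pi.smul_apply, hE0, hE3,
      smul_eq_mul, ht3, mul_zero, zero_add, mul_one, add_zero, smul_zero]
    have e1 : a' * q₂ t - a * q₁ t + 2 * (a * a' * t 0) = -2 * a * q₁ t := by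
      linear_combination hx2
    have e2 : a' * q₂ t - a * q₁ t - 2 * (a * a' * t 0) = 2 * a' * q₂ t := by
      linear_combination -hx2
    have e3 : (a' * q₂ t - a * q₁ t) ^ 2 - 4 * (a * a' * t 0) ^ 2 =
        -4 * (a * a') * q₁ t * q₂ t := by
      calc _ = (a' * q₂ t - a * q₁ t + 2 * (a * a' * t 0)) *
            (a' * q₂ t - a * q₁ t - 2 * (a * a' * t 0)) := by ring
        _ = _ := by rw [e1, e2]; ring
    rw [e1, e2, e3]
    module
  · have h1 : q₁ ![0, 1, 1, 1] = T v e e := by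
      simp [q₁, hω, h.nn, h.ne, hT.swap_right v e n]
    have h2 : q₂ ![0, 1, 1, 1] = T v' n n := by
      simp [q₂, hω, h.ee', h.ne', hT.swap_right v' e n]
    have h3 : F (H ![0, 1, 1, 1]) ≠ 0 := by
      rw [hFH, h1, h2]
      refine smul_ne_zero ?_ fun h0 => ?_
      · simp [h.ee, h.nn']
      · simpa using congrFun h0 1
    exact ⟨_, h3, fun h0 => h3 (by rw [h0]; simp [F])⟩
  · obtain ⟨A, hA, hAL, s, hs, hAM⟩ := hρ g
    refine ⟨A, hA, ?_⟩
    have hAaut : Matrix.ProjGenLinGroup.mk A ∈ aut f := by rw [hA]; exact g.2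
    obtain ⟨c, hc0, hcA⟩ := hc A hAaut
    have hAω : ∀ t, A • ω t = ω (π (A • ω t)) := fun t => hWω _ (hW A hAaut _ (hωW t))
    have hF0 : ∀ t, q₁ (π (A • ω t)) = T v (A • ω t) (A • ω t) := fun t => by
      simp only [q₁, ← hAω]
    have hF1 : ∀ t, q₂ (π (A • ω t)) = T v' (A • ω t) (A • ω t) := fun t => by
      simp only [q₂, ← hAω]
    have hAdec : ∀ x, A • x = B.coord 0 x • (A • v) + B.coord 1 x • (A • v') +
        ω (π (A • x)) := by
      intro x
      rw [hπA A s hs, ← hAω]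
      conv_lhs => rw [hdec x]
      rw [smul_add, smul_add, gl_smul_smul, gl_smul_smul]
    have hFx : ∀ x, ρ g • F x = (B.coord 0 x * B.coord 1 x) • π (A • x) +
        (s * (B.coord 1 x * q₂ (π x) - B.coord 0 x * q₁ (π x))) • E := by
      intro x
      have h1 := hAM ((B.coord 0 x * B.coord 1 x) • x)
        (B.coord 1 x * q₂ (π x) - B.coord 0 x * q₁ (π x))
      rw [map_smul, gl_smul_smul, map_smul] at h1
      exact h1
    have ho1 : T v v' (A • o) = 1 := by rw [hAL, h.apply_o]
    rcases hs with ⟨hs1, a, b, h1, h2⟩ | ⟨hs1, a, b, h1, h2⟩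
    · have ha := hA0 A _ _ _ hv0 h1
      have hb := hA0 A _ _ _ hv0' h2
      have hab : c = a * b := by
        have := hcA v v' o
        rw [h1, h2, h.apply_o] at this
        simp only [map_smul, LinearMap.smul_apply, smul_eq_mul, ho1] at this
        linear_combination -this
      have i1 : ∀ x, q₁ (π (A • x)) = b * q₁ (π x) := by
        intro x
        rw [hπA A s (Or.inl ⟨hs1, a, b, h1, h2⟩), hF0]
        have := hcA v (ω (π x)) (ω (π x))
        rw [h1, hab] at this
        simp only [map_smul, LinearMap.smul_apply, smul_eq_mul] at this
        exact mul_left_cancel₀ ha (by linear_combination this)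
      have i2 : ∀ x, q₂ (π (A • x)) = a * q₂ (π x) := by
        intro x
        rw [hπA A s (Or.inl ⟨hs1, a, b, h1, h2⟩), hF1]
        have := hcA v' (ω (π x)) (ω (π x))
        rw [h2, hab] at this
        simp only [map_smul, LinearMap.smul_apply, smul_eq_mul] at this
        exact mul_left_cancel₀ hb (by linear_combination this)
      intro x
      refine ⟨a * b, ?_⟩
      have h3 : A • x = (B.coord 0 x * a) • v + (B.coord 1 x * b) • v' + ω (π (A • x)) := by
        conv_lhs => rw [hAdec x, h1, h2, smul_smul, smul_smul]
      have h4 : F (A • x) = F ((B.coord 0 x * a) • v + (B.coord 1 x * b) • v' + ω (π (A • x))) :=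
        congrArg F h3
      rw [h4, hF, hFx, hs1, i1, i2, hπ3]
      module
    · have ha := hA0 A _ _ _ hv0 h1
      have hb := hA0 A _ _ _ hv0' h2
      have hab : c = a * b := by
        have := hcA v v' o
        rw [h1, h2, h.apply_o] at this
        simp only [map_smul, LinearMap.smul_apply, smul_eq_mul, hT.swap_left v' v, ho1] at this
        linear_combination -this
      have i1 : ∀ x, q₂ (π (A • x)) = b * q₁ (π x) := by
        intro x
        rw [hπA A s (Or.inr ⟨hs1, a, b, h1, h2⟩), hF1]
        have := hcA v (ω (π x)) (ω (π x))
        rw [h1, hab] at this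
        simp only [map_smul, LinearMap.smul_apply, smul_eq_mul] at this
        exact mul_left_cancel₀ ha (by linear_combination this)
      have i2 : ∀ x, q₁ (π (A • x)) = a * q₂ (π x) := by
        intro x
        rw [hπA A s (Or.inr ⟨hs1, a, b, h1, h2⟩), hF0]
        have := hcA v' (ω (π x)) (ω (π x))
        rw [h2, hab] at this
        simp only [map_smul, LinearMap.smul_apply, smul_eq_mul] at this
        exact mul_left_cancel₀ hb (by linear_combination this)
      intro x
      refine ⟨a * b, ?_⟩
      have h3 : A • x = (B.coord 1 x * b) • v + (B.coord 0 x * a) • v' + ω (π (A • x)) := by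
        conv_lhs => rw [hAdec x, h1, h2, smul_smul, smul_smul]
        rw [add_comm ((B.coord 0 x * a) • v')]
      have h4 : F (A • x) = F ((B.coord 1 x * b) • v + (B.coord 0 x * a) • v' + ω (π (A • x))) :=
        congrArg F h3
      rw [h4, hF, hFx, hs1, i1, i2, hπ3]
      module

end Swap

end CubicThreefold

namespace CubicThreefold

open Module

theorem IsSixSingular.exists_isBidegenerate {k V : Type*} [Field k] [AddCommGroup V] [Module k V]
    [IsAlgClosed k] [CharZero k] [FiniteDimensional k V] {T : V →ₗ[k] V →ₗ[k] V →ₗ[k] k}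
    {v : Fin 6 → V} (h : IsSixSingular T v) (hV : finrank k V = 5) {i j : Fin 6} (hij : i ≠ j)
    (hi : IsDegenerateAt T (v i)) (hj : IsDegenerateAt T (v j)) :
    ∃ w : Fin 6 → V, IsBidegenerate T w ∧ w 0 = v i := by
  let τ := Equiv.swap 0 i
  have hτ : τ 0 = i := Equiv.swap_apply_left _ _
  have hτ1 : i ≠ τ 1 := fun h0 => by
    have := τ.injective (hτ.trans h0)
    exact absurd this (by decide)
  let σ := τ.trans (Equiv.swap (τ 1) j)
  have h0 : σ 0 = i := by
    change Equiv.swap (τ 1) j (τ 0) = i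
    rw [hτ, Equiv.swap_apply_of_ne_of_ne hτ1 hij]
  have h1 : σ 1 = j := Equiv.swap_apply_left _ _
  have hnz : ∀ l : Fin 6, l ≠ 0 → l ≠ 1 → T (v i) (v j) (v (σ l)) ≠ 0 := by
    intro l hl0 hl1
    refine h.apply_apply_ne_zero hV hij ?_ ?_ hi hj
    · rw [← h0]; exact fun hh => hl0 (σ.injective hh).symm
    · rw [← h1]; exact fun hh => hl1 (σ.injective hh).symm
  let c : Fin 6 → k := fun l => if l = 0 ∨ l = 1 then 1 else (T (v i) (v j) (v (σ l)))⁻¹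
  have hc : ∀ l, c l ≠ 0 := by
    intro l
    simp only [c]
    split_ifs with hl
    · exact one_ne_zero
    · rw [not_or] at hl
      exact inv_ne_zero (hnz l hl.1 hl.2)
  have hc0 : c 0 = 1 := by simp [c]
  have hc1 : c 1 = 1 := by simp [c]
  refine ⟨fun l => c l • (v ∘ σ) l, ⟨(h.comp_perm σ).smul hc, hV, ?_, ?_, ?_⟩, ?_⟩
  · simpa [hc0, h0] using hi
  · simpa [hc1, h1] using hj
  · intro l hl0 hl1
    have : c l = (T (v i) (v j) (v (σ l)))⁻¹ := by simp [c, hl0, hl1]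
    simp [hc0, hc1, h0, h1, this, hnz l hl0 hl1]
  · simp [hc0, h0]

section Similitude

variable {k : Type*} [Field k] [IsAlgClosed k] [CharZero k] {f : MvPolynomial (Fin 5) k}
variable {A : GL (Fin 5) k} {c : k}

theorem polarForm_inv_smul (hc : c ≠ 0)
    (hA : ∀ x y z, polarForm f (A • x) (A • y) (A • z) = c * polarForm f x y z) (x y z : Fin 5 → k) :
    polarForm f (A⁻¹ • x) (A⁻¹ • y) (A⁻¹ • z) = c⁻¹ * polarForm f x y z := by
  have := hA (A⁻¹ • x) (A⁻¹ • y) (A⁻¹ • z)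
  simp only [smul_inv_smul] at this
  rw [this, ← mul_assoc, inv_mul_cancel₀ hc, one_mul]

theorem inv_smul_eq_of_smul_eq {x y : Fin 5 → k} {d : k} (hd : d ≠ 0) (h : A • x = d • y) :
    A⁻¹ • y = d⁻¹ • x := by
  rw [inv_smul_eq_iff, gl_smul_smul, h, smul_smul, inv_mul_cancel₀ hd, one_smul]

theorem apply_eq_zero_of_smul_eq
    (hA : ∀ x y z, polarForm f (A • x) (A • y) (A • z) = c * polarForm f x y z)
    {x y u : Fin 5 → k} {d : k} (hd : d ≠ 0) (h : A • x = d • y) (hu : polarForm f x u = 0) :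
    polarForm f y (A • u) = 0 := by
  refine LinearMap.ext fun z => ?_
  have h1 := hA x u (A⁻¹ • z)
  rw [smul_inv_smul, h, hu] at h1
  simpa [hd] using h1

theorem smul_notMem_span_of_smul_eq {x y u : Fin 5 → k} {d : k} (hd : d ≠ 0) (h : A • x = d • y)
    (hu : u ∉ Submodule.span k {x}) : A • u ∉ Submodule.span k {y} := by
  intro hm
  obtain ⟨s, hs⟩ := Submodule.mem_span_singleton.1 hm
  apply hu
  rw [Submodule.mem_span_singleton]
  refine ⟨s * d⁻¹, ?_⟩
  rw [mul_smul, ← inv_smul_eq_of_smul_eq hd h, ← gl_smul_smul, hs, inv_smul_smul]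

theorem IsDegenerateAt.of_smul_eq
    (hA : ∀ x y z, polarForm f (A • x) (A • y) (A • z) = c * polarForm f x y z)
    {x y : Fin 5 → k} {d : k} (hd : d ≠ 0) (h : A • x = d • y)
    (hx : IsDegenerateAt (polarForm f) x) : IsDegenerateAt (polarForm f) y := by
  obtain ⟨u, hu, hxu⟩ := hx
  exact ⟨A • u, smul_notMem_span_of_smul_eq hd h hu, apply_eq_zero_of_smul_eq hA hd h hxu⟩

theorem IsCuspidalAt.of_smul_eq (hc : c ≠ 0)
    (hA : ∀ x y z, polarForm f (A • x) (A • y) (A • z) = c * polarForm f x y z)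
    {x y : Fin 5 → k} {d : k} (hd : d ≠ 0) (h : A • x = d • y)
    (hx : IsCuspidalAt (polarForm f) x) : IsCuspidalAt (polarForm f) y := by
  obtain ⟨u, hu, hxu, huuu⟩ := hx
  exact ⟨A • u, smul_notMem_span_of_smul_eq hd h hu, apply_eq_zero_of_smul_eq hA hd h hxu, by
    rw [hA]; exact mul_ne_zero hc huuu⟩

end Similitude

section Points

variable {k : Type*} [Field k] [IsAlgClosed k] [CharZero k] {f : MvPolynomial (Fin 5) k}
variable {v : Fin 6 → Fin 5 → k}

/-- The singular points represented by the vectors `v i`. -/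
def IsSixSingular.point (h : IsSixSingular (polarForm f) v) (i : Fin 6) : ProjSpace k 4 :=
  Projectivization.mk k (v i) (h.ne_zero i)

namespace IsSixSingular

theorem point_injective (h : IsSixSingular (polarForm f) v) : Function.Injective h.point := by
  intro i j hij
  by_contra hne
  obtain ⟨a, ha⟩ := (Projectivization.mk_eq_mk_iff' _ _ _ _ _).1 hij
  have := LinearIndependent.pair_iff.1 (h.indep i j hne) 1 (-a) (by rw [← ha]; module)
  exact one_ne_zero this.1

theorem point_mem (hf : f.IsHomogeneous 3) (h : IsSixSingular (polarForm f) v) (i : Fin 6) :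
    h.point i ∈ singularPoints f :=
  (mk_mem_singularPoints_iff hf _).2 (h.sing i)

theorem exists_point_eq (hf : f.IsHomogeneous 3) (h : IsSixSingular (polarForm f) v)
    {p : ProjSpace k 4} (hp : p ∈ singularPoints f) : ∃ i, h.point i = p := by
  have hmk : p = Projectivization.mk k p.rep p.rep_nonzero := (Projectivization.mk_rep p).symm
  rw [hmk, mk_mem_singularPoints_iff hf] at hp
  obtain ⟨i, hi⟩ := h.all _ hp
  obtain ⟨c, hc⟩ := Submodule.mem_span_singleton.1 hi
  refine ⟨i, ?_⟩
  rw [hmk, eq_comm]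
  exact (Projectivization.mk_eq_mk_iff' _ _ _ _ _).2 ⟨c, hc⟩

theorem setOf_eq_image (hf : f.IsHomogeneous 3) (h : IsSixSingular (polarForm f) v)
    {P : ProjSpace k 4 → Prop} {I : Set (Fin 6)} (hP : ∀ i, P (h.point i) ↔ i ∈ I) :
    {p | p ∈ singularPoints f ∧ P p} = h.point '' I := by
  ext p
  constructor
  · rintro ⟨hp, hpP⟩
    obtain ⟨i, rfl⟩ := h.exists_point_eq hf hp
    exact ⟨i, (hP i).1 hpP, rfl⟩
  · rintro ⟨i, hi, rfl⟩
    exact ⟨h.point_mem hf i, (hP i).2 hi⟩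

theorem isTypeA_one_point_iff (hf : f.IsHomogeneous 3) (h : IsSixSingular (polarForm f) v)
    (i : Fin 6) : IsTypeA f 1 (h.point i) ↔ ¬ IsDegenerateAt (polarForm f) (v i) :=
  isTypeA_one_iff hf (h.ne_zero i) (h.sing i)

theorem linearSpan_image_point (h : IsSixSingular (polarForm f) v) (I : Set (Fin 6)) :
    linearSpan (h.point '' I) = Submodule.span k (v '' I) := by
  rw [linearSpan, iSup_image, Submodule.span_eq_iSup_of_singleton_spans, iSup_image]
  rfl

theorem exists_smul_eq (h : IsSixSingular (polarForm f) v) {A : GL (Fin 5) k} {c : k}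
    (hA : ∀ x y z, polarForm f (A • x) (A • y) (A • z) = c * polarForm f x y z) (i : Fin 6) :
    ∃ (j : Fin 6) (d : k), d ≠ 0 ∧ A • v i = d • v j := by
  obtain ⟨j, hj⟩ := h.all (A • v i) (by
    refine LinearMap.ext fun z => ?_
    have h1 := hA (v i) (v i) (A⁻¹ • z)
    rw [smul_inv_smul, h.sing] at h1
    simpa using h1)
  obtain ⟨d, hd⟩ := Submodule.mem_span_singleton.1 hj
  refine ⟨j, d, ?_, hd.symm⟩
  rintro rfl
  rw [zero_smul] at hd
  exact (smul_ne_zero_iff_ne A).2 (h.ne_zero i) hd.symm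

end IsSixSingular

theorem smul_projSubspace_eq {G : Subgroup PGL(Fin 5, k)} {W : Submodule k (Fin 5 → k)}
    (hW : ∀ A : GL (Fin 5) k, Matrix.ProjGenLinGroup.mk A ∈ G → ∀ w ∈ W, A • w ∈ W)
    {g : PGL(Fin 5, k)} (hg : g ∈ G) : g • projSubspace (n := 4) W = projSubspace W := by
  have key : ∀ g ∈ G, g • projSubspace (n := 4) W ⊆ projSubspace W := by
    rintro g hg _ ⟨p, hp, rfl⟩
    obtain ⟨A, rfl⟩ := Matrix.ProjGenLinGroup.mk_surjective g
    induction p using Projectivization.ind with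
    | h x hx =>
      simp only [projSubspace, Set.mem_ofPred_eq, smul_mk, Projectivization.submodule_mk,
        Submodule.span_singleton_le_iff_mem] at hp ⊢
      exact hW A hg x hp
  refine Set.Subset.antisymm (key g hg) ?_
  rw [Set.subset_smul_set_iff]
  exact key _ (G.inv_mem hg)

end Points

end CubicThreefold

namespace CubicThreefold

open Module

namespace IsBidegenerate

variable {k : Type*} [Field k] [IsAlgClosed k] [CharZero k] {f : MvPolynomial (Fin 5) k}
variable {v : Fin 6 → Fin 5 → k}

theorem degenerate_iff (h : IsBidegenerate (polarForm f) v) (i : Fin 6) :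
    IsDegenerateAt (polarForm f) (v i) ↔ i = 0 ∨ i = 1 := by
  constructor
  · intro hd
    by_contra hi
    rw [not_or] at hi
    exact h.not_degenerate hi.1 hi.2 hd
  · rintro (rfl | rfl)
    · exact h.degenerate_zero
    · exact h.degenerate_one

theorem nodes_eq (hf : f.IsHomogeneous 3) (h : IsBidegenerate (polarForm f) v) :
    nodes f = h.point '' {2, 3, 4, 5} :=
  h.setOf_eq_image hf fun i => by
    rw [h.isTypeA_one_point_iff hf, h.degenerate_iff]
    fin_cases i <;> simp

theorem nonNodes_eq (hf : f.IsHomogeneous 3) (h : IsBidegenerate (polarForm f) v) :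
    nonNodes f = h.point '' {0, 1} :=
  h.setOf_eq_image hf fun i => by
    rw [h.isTypeA_one_point_iff hf, not_not, h.degenerate_iff]
    simp

theorem ncard_nodes (hf : f.IsHomogeneous 3) (h : IsBidegenerate (polarForm f) v) :
    (nodes f).ncard = 4 := by
  rw [h.nodes_eq hf, Set.ncard_image_of_injective _ h.point_injective]
  have : ({2, 3, 4, 5} : Set (Fin 6)) = (({2, 3, 4, 5} : Finset (Fin 6)) : Set (Fin 6)) := by simp
  rw [this, Set.ncard_coe_finset]
  rfl

theorem ncard_nonNodes (hf : f.IsHomogeneous 3) (h : IsBidegenerate (polarForm f) v) :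
    (nonNodes f).ncard = 2 := by
  rw [h.nonNodes_eq hf, Set.ncard_image_of_injective _ h.point_injective]
  exact Set.ncard_pair (by decide)

theorem five_mem (h : IsBidegenerate (polarForm f) v) :
    v 5 ∈ Submodule.span k {v 2, v 3, v 4} := by
  obtain ⟨c2, c3, c4, -, -, -, h5, -, -, -⟩ := h.exists_sixth
  exact Submodule.mem_span_triple.2 ⟨c2, c3, c4, h5.symm⟩

theorem mem_of_ne (h : IsBidegenerate (polarForm f) v) {i : Fin 6} (h0 : i ≠ 0) (h1 : i ≠ 1) :
    v i ∈ Submodule.span k {v 2, v 3, v 4} := by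
  fin_cases i
  · exact absurd rfl h0
  · exact absurd rfl h1
  · exact Submodule.subset_span (by simp)
  · exact Submodule.subset_span (by simp)
  · exact Submodule.subset_span (by simp)
  · exact h.five_mem

theorem linearSpan_nodes (hf : f.IsHomogeneous 3) (h : IsBidegenerate (polarForm f) v) :
    linearSpan (nodes f) = Submodule.span k {v 2, v 3, v 4} := by
  rw [h.nodes_eq hf, h.linearSpan_image_point]
  apply le_antisymm
  · rw [Submodule.span_le]
    rintro _ ⟨i, hi, rfl⟩
    exact h.mem_of_ne (by rintro rfl; simp at hi) (by rintro rfl; simp at hi)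
  · refine Submodule.span_mono ?_
    simp [Set.image_insert_eq, Set.insert_subset_iff]

theorem linearSpan_nonNodes (hf : f.IsHomogeneous 3) (h : IsBidegenerate (polarForm f) v) :
    linearSpan (nonNodes f) = Submodule.span k {v 0, v 1} := by
  rw [h.nonNodes_eq hf, h.linearSpan_image_point, Set.image_pair]

theorem linearIndependent_plane (h : IsBidegenerate (polarForm f) v) :
    LinearIndependent k ![v 2, v 3, v 4] := by
  rw [linearIndependent_triple_iff]
  intro r s t hr
  have := Fintype.linearIndependent_iff.1 h.linearIndependent_five ![0, 0, r, s, t] (by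
    simpa [Fin.sum_univ_five] using hr)
  exact ⟨this 2, this 3, this 4⟩

theorem disjoint_plane_line (h : IsBidegenerate (polarForm f) v) {x : Fin 5 → k}
    (hx : x ∈ Submodule.span k {v 2, v 3, v 4}) (hx' : x ∈ Submodule.span k {v 0, v 1}) :
    x = 0 := by
  obtain ⟨r, s, t, rfl⟩ := Submodule.mem_span_triple.1 hx
  obtain ⟨a, b, hab⟩ := Submodule.mem_span_pair.1 hx'
  have := Fintype.linearIndependent_iff.1 h.linearIndependent_five ![-a, -b, r, s, t] (by
    simp only [Fin.sum_univ_five, Matrix.cons_val]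
    calc _ = (r • v 2 + s • v 3 + t • v 4) - (a • v 0 + b • v 1) := by module
      _ = 0 := by rw [hab, sub_self])
  have h2 : r = 0 := this 2
  have h3 : s = 0 := this 3
  have h4 : t = 0 := this 4
  simp [h2, h3, h4]

theorem apply_line (h : IsBidegenerate (polarForm f) v) {x : Fin 5 → k}
    (hx : x ∈ Submodule.span k {v 0, v 1}) : polarForm f x x x = 0 := by
  obtain ⟨a, b, rfl⟩ := Submodule.mem_span_pair.1 hx
  simp [h.sing, h.apply_self, h.apply_self']

theorem exists_smul_eq_of_similitude (h : IsBidegenerate (polarForm f) v) {A : GL (Fin 5) k}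
    {c : k} (hc : c ≠ 0)
    (hA : ∀ x y z, polarForm f (A • x) (A • y) (A • z) = c * polarForm f x y z) (i : Fin 6) :
    ∃ (j : Fin 6) (d : k), d ≠ 0 ∧ A • v i = d • v j ∧ ((i = 0 ∨ i = 1) ↔ (j = 0 ∨ j = 1)) := by
  obtain ⟨j, d, hd, hij⟩ := h.exists_smul_eq hA i
  refine ⟨j, d, hd, hij, ?_⟩
  rw [← h.degenerate_iff, ← h.degenerate_iff]
  exact ⟨fun hi => hi.of_smul_eq hA hd hij, fun hj => hj.of_smul_eq (polarForm_inv_smul hc hA)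
    (inv_ne_zero hd) (inv_smul_eq_of_smul_eq hd hij)⟩

theorem exists_hasSign (h : IsBidegenerate (polarForm f) v) {A : GL (Fin 5) k}
    {c : k} (hc : c ≠ 0)
    (hA : ∀ x y z, polarForm f (A • x) (A • y) (A • z) = c * polarForm f x y z) :
    ∃ s, HasSign (v 0) (v 1) A s := by
  have hne : ∀ (j : Fin 6) (a b : k), a ≠ 0 → A • v 0 = a • v j → A • v 1 = b • v j → False := by
    intro j a b ha h0 h1
    have h2 : A • (b • v 0 + (-a) • v 1) = 0 := by
      rw [smul_add, gl_smul_smul, gl_smul_smul, h0, h1]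
      module
    have h3 : b • v 0 + (-a) • v 1 = 0 := by
      by_contra hne
      exact (smul_ne_zero_iff_ne A).2 hne h2
    have := (LinearIndependent.pair_iff.1 (h.indep 0 1 (by decide)) b (-a) h3).2
    exact ha (neg_eq_zero.1 this)
  obtain ⟨j, a, ha, h0, hj⟩ := h.exists_smul_eq_of_similitude hc hA 0
  obtain ⟨l, b, hb, h1, hl⟩ := h.exists_smul_eq_of_similitude hc hA 1
  rcases hj.1 (Or.inl rfl) with rfl | rfl <;> rcases hl.1 (Or.inr rfl) with rfl | rfl
  · exact (hne _ _ _ ha h0 h1).elim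
  · exact ⟨1, Or.inl ⟨rfl, a, b, h0, h1⟩⟩
  · exact ⟨-1, Or.inr ⟨rfl, a, b, h0, h1⟩⟩
  · exact (hne _ _ _ ha h0 h1).elim

theorem smul_mem_plane (h : IsBidegenerate (polarForm f) v) {A : GL (Fin 5) k} {c : k} (hc : c ≠ 0)
    (hA : ∀ x y z, polarForm f (A • x) (A • y) (A • z) = c * polarForm f x y z) {w : Fin 5 → k}
    (hw : w ∈ Submodule.span k {v 2, v 3, v 4}) : A • w ∈ Submodule.span k {v 2, v 3, v 4} := by
  have hi : ∀ i : Fin 6, i ≠ 0 → i ≠ 1 → A • v i ∈ Submodule.span k {v 2, v 3, v 4} := by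
    intro i hi0 hi1
    obtain ⟨j, a, -, hij, hj⟩ := h.exists_smul_eq_of_similitude hc hA i
    rw [hij]
    exact Submodule.smul_mem _ _ (h.mem_of_ne (fun h0 => (hj.2 (Or.inl h0)).elim hi0 hi1)
      fun h1 => (hj.2 (Or.inr h1)).elim hi0 hi1)
  obtain ⟨r, s, t, rfl⟩ := Submodule.mem_span_triple.1 hw
  simp only [smul_add, gl_smul_smul]
  exact Submodule.add_mem _ (Submodule.add_mem _
    (Submodule.smul_mem _ _ (hi 2 (by decide) (by decide)))
    (Submodule.smul_mem _ _ (hi 3 (by decide) (by decide))))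
    (Submodule.smul_mem _ _ (hi 4 (by decide) (by decide)))

theorem smul_mem_line (h : IsBidegenerate (polarForm f) v) {A : GL (Fin 5) k} {c : k} (hc : c ≠ 0)
    (hA : ∀ x y z, polarForm f (A • x) (A • y) (A • z) = c * polarForm f x y z) {w : Fin 5 → k}
    (hw : w ∈ Submodule.span k {v 0, v 1}) : A • w ∈ Submodule.span k {v 0, v 1} := by
  obtain ⟨s, hs⟩ := h.exists_hasSign hc hA
  obtain ⟨a, b, rfl⟩ := Submodule.mem_span_pair.1 hw
  rw [smul_add, gl_smul_smul, gl_smul_smul, Submodule.mem_span_pair]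
  rcases hs with ⟨-, c, d, h0, h1⟩ | ⟨-, c, d, h0, h1⟩
  · exact ⟨a * c, b * d, by rw [h0, h1, smul_smul, smul_smul]⟩
  · exact ⟨b * d, a * c, by rw [h0, h1, smul_smul, smul_smul, add_comm]⟩

theorem isLinearizable (hf : f.IsHomogeneous 3) (h : IsBidegenerate (polarForm f) v) :
    IsLinearizable (hypersurface f) (aut f) := by
  obtain ⟨e, n, he, hn, had⟩ := h.exists_isAdapted
  have hsim := fun A hA => exists_polarForm_smul hf h.toIsSixSingular (A := A) hA
  have hi : LinearIndependent k ![v 2, e, n] := by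
    rw [linearIndependent_triple_iff]
    intro r s t hr
    have := Fintype.linearIndependent_iff.1 had.indep ![0, 0, r, s, t] (by
      simpa [Fin.sum_univ_five] using hr)
    exact ⟨this 2, this 3, this 4⟩
  have hspan : Submodule.span k {v 2, e, n} = Submodule.span k {v 2, v 3, v 4} := by
    refine Submodule.eq_of_le_of_finrank_eq ?_ ?_
    · rw [Submodule.span_le]
      rintro x (rfl | rfl | rfl)
      · exact Submodule.subset_span (by simp)
      · exact he
      · exact hn
    · rw [IsSixSingular.finrank_span_triple hi, IsSixSingular.finrank_span_triple h.linearIndependent_plane]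
  refine isLinearizable_of_isAdapted hf had hsim (fun A hA => ?_) fun A hA w hw => ?_
  · obtain ⟨c, hc, hcA⟩ := hsim A hA
    exact h.exists_hasSign hc hcA
  · obtain ⟨c, hc, hcA⟩ := hsim A hA
    rw [hspan] at hw ⊢
    exact h.smul_mem_plane hc hcA hw

theorem isTypeA_point_zero (hf : f.IsHomogeneous 3) (h : IsBidegenerate (polarForm f) v) :
    (IsCuspidalAt (polarForm f) (v 0) → IsTypeA f 2 (h.point 0)) ∧
    (¬ IsCuspidalAt (polarForm f) (v 0) → IsTypeA f 3 (h.point 0)) := by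
  obtain ⟨e, n, -, -, had⟩ := h.exists_isAdapted
  rw [had.isCuspidalAt_iff h.finrank_eq h.symm, not_not]
  exact had.isTypeA hf (h.ne_zero 0)

theorem hasType_of_isTypeA (hf : f.IsHomogeneous 3) (hsing : (singularPoints f).ncard = 6)
    (h : IsBidegenerate (polarForm f) v) {m : ℕ} (hm : 2 ≤ m) (h0 : IsTypeA f m (h.point 0))
    (h1 : IsTypeA f m (h.point 1)) : HasType2Am4A1 f m := by
  refine ⟨hsing, h.ncard_nodes hf, ?_⟩
  have : {p | p ∈ singularPoints f ∧ IsTypeA f m p} = h.point '' {0, 1} :=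
    h.setOf_eq_image hf fun i => by
      constructor
      · intro hi
        exact (h.degenerate_iff i).1 ((isDegenerateAt_iff_of_isTypeA hf (h.ne_zero i) (h.sing i)
          (by omega) hi).2 hm)
      · rintro (rfl | rfl)
        · exact h0
        · exact h1
  rw [this, Set.ncard_image_of_injective _ h.point_injective]
  exact Set.ncard_pair (by decide)

theorem hasType_of_smul_ne (hf : f.IsHomogeneous 3) (hsing : (singularPoints f).ncard = 6)
    (h : IsBidegenerate (polarForm f) v) (hg : ∃ g ∈ aut f, g • h.point 0 ≠ h.point 0) :
    HasType2Am4A1 f 2 ∨ HasType2Am4A1 f 3 := by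
  obtain ⟨g, hg, hne⟩ := hg
  obtain ⟨A, rfl⟩ := Matrix.ProjGenLinGroup.mk_surjective g
  obtain ⟨c, hc, hA⟩ := exists_polarForm_smul hf h.toIsSixSingular hg
  obtain ⟨j, d, hd, hj, hj0⟩ := h.exists_smul_eq_of_similitude hc hA 0
  have hpt : Matrix.ProjGenLinGroup.mk A • h.point 0 = h.point j := by
    rw [IsSixSingular.point, smul_mk]
    exact (Projectivization.mk_eq_mk_iff' _ _ _ _ _).2 ⟨d, hj.symm⟩
  have hj1 : j = 1 := by
    rcases hj0.1 (Or.inl rfl) with rfl | rfl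
    · exact absurd hpt hne
    · rfl
  subst hj1
  have hcusp : IsCuspidalAt (polarForm f) (v 0) ↔ IsCuspidalAt (polarForm f) (v 1) :=
    ⟨fun h0 => h0.of_smul_eq hc hA hd hj, fun h1 => h1.of_smul_eq (inv_ne_zero hc)
      (polarForm_inv_smul hc hA) (inv_ne_zero hd) (inv_smul_eq_of_smul_eq hd hj)⟩
  obtain ⟨k2, k3⟩ := h.isTypeA_point_zero hf
  obtain ⟨l2, l3⟩ := h.swap.isTypeA_point_zero hf
  by_cases h0 : IsCuspidalAt (polarForm f) (v 0)
  · exact Or.inl (h.hasType_of_isTypeA hf hsing le_rfl (k2 h0) (l2 (hcusp.1 h0)))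
  · exact Or.inr (h.hasType_of_isTypeA hf hsing (by norm_num) (k3 h0)
      (l3 fun h1 => h0 (hcusp.2 h1)))

end IsBidegenerate

section Final

variable {k : Type*} [Field k] [IsAlgClosed k] [CharZero k] {f : MvPolynomial (Fin 5) k}
variable {v : Fin 6 → Fin 5 → k}

theorem isLinearizable_of_point_fixed (hf : f.IsHomogeneous 3)
    (h : IsSixSingular (polarForm f) v) {i : Fin 6}
    (hfix : ∀ g ∈ aut f, g • h.point i = h.point i) :
    IsLinearizable (hypersurface f) (aut f) := by
  obtain ⟨j, hj⟩ : ∃ j : Fin 6, i ≠ j := ⟨i + 1, by fin_cases i <;> decide⟩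
  refine isLinearizable_of_fixed hf (h.ne_zero i) (h.sing i) (fun h0 => ?_) fun A hA => ?_
  · exact h.apply_ne_zero hj (by rw [h0]; rfl)
  · have := hfix _ hA
    rw [IsSixSingular.point, smul_mk] at this
    obtain ⟨c, hc⟩ := (Projectivization.mk_eq_mk_iff' _ _ _ _ _).1 this
    exact ⟨c, hc.symm⟩

theorem exists_isBidegenerate_of_not_fixed (hf : f.IsHomogeneous 3)
    (h : IsSixSingular (polarForm f) v) (hA : ∃ p ∈ singularPoints f, ¬ IsTypeA f 1 p)
    (hmove : ∀ p ∈ singularPoints f, ∃ g ∈ aut f, g • p ≠ p) :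
    ∃ w, IsBidegenerate (polarForm f) w := by
  obtain ⟨p, hp, hpA⟩ := hA
  obtain ⟨i, rfl⟩ := h.exists_point_eq hf hp
  rw [h.isTypeA_one_point_iff hf, not_not] at hpA
  obtain ⟨g, hg, hne⟩ := hmove _ hp
  obtain ⟨A, rfl⟩ := Matrix.ProjGenLinGroup.mk_surjective g
  obtain ⟨c, hc, hA⟩ := exists_polarForm_smul hf h hg
  obtain ⟨j, d, hd, hj⟩ := h.exists_smul_eq hA i
  have hij : i ≠ j := by
    rintro rfl
    apply hne
    rw [IsSixSingular.point, smul_mk]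
    exact (Projectivization.mk_eq_mk_iff' _ _ _ _ _).2 ⟨d, hj.symm⟩
  obtain ⟨w, hw, -⟩ := h.exists_isBidegenerate (by simp) hij hpA (hpA.of_smul_eq hA hd hj)
  exact ⟨w, hw⟩

theorem exists_isBidegenerate_of_hasType (hf : f.IsHomogeneous 3)
    (h : IsSixSingular (polarForm f) v) {m : ℕ} (hm : 2 ≤ m) (ht : HasType2Am4A1 f m) :
    ∃ w, IsBidegenerate (polarForm f) w := by
  obtain ⟨p, q, hpq, hS⟩ := Set.ncard_eq_two.1 ht.2.2
  have hp : p ∈ {p | p ∈ singularPoints f ∧ IsTypeA f m p} := by rw [hS]; simp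
  have hq : q ∈ {p | p ∈ singularPoints f ∧ IsTypeA f m p} := by rw [hS]; simp
  obtain ⟨i, rfl⟩ := h.exists_point_eq hf hp.1
  obtain ⟨j, rfl⟩ := h.exists_point_eq hf hq.1
  have hd : ∀ i, IsTypeA f m (h.point i) → IsDegenerateAt (polarForm f) (v i) := fun i hi =>
    (isDegenerateAt_iff_of_isTypeA hf (h.ne_zero i) (h.sing i) (by omega) hi).2 hm
  obtain ⟨w, hw, -⟩ := h.exists_isBidegenerate (by simp) (fun hij => hpq (by rw [hij]))
    (hd i hp.2) (hd j hq.2)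
  exact ⟨w, hw⟩

theorem projSubspace_subset_hypersurface (hf : f.IsHomogeneous 3) {W : Submodule k (Fin 5 → k)}
    (hW : ∀ x ∈ W, polarForm f x x x = 0) : projSubspace (n := 4) W ⊆ hypersurface f := by
  intro p hp
  induction p using Projectivization.ind with
  | h x hx =>
    rw [projSubspace, Set.mem_ofPred_eq, Projectivization.submodule_mk,
      Submodule.span_singleton_le_iff_mem] at hp
    exact (mk_mem_hypersurface_iff hf hx).2 (hW x hp)

theorem disjoint_projSubspace {W W' : Submodule k (Fin 5 → k)}
    (h : ∀ x ∈ W, x ∈ W' → x = 0) : Disjoint (projSubspace (n := 4) W) (projSubspace W') := by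
  rw [Set.disjoint_left]
  intro p hp hp'
  induction p using Projectivization.ind with
  | h x hx =>
    rw [projSubspace, Set.mem_ofPred_eq, Projectivization.submodule_mk,
      Submodule.span_singleton_le_iff_mem] at hp hp'
    exact hx (h x hp hp')

end Final

end CubicThreefold

theorem mainTheorem12 {k : Type*} [Field k] [IsAlgClosed k] [CharZero k]
    (f : MvPolynomial (Fin 5) k) (hf : f.IsHomogeneous 3)
    (hsing : (singularPoints f).ncard = 6)
    (hA : ∃ p ∈ singularPoints f, ¬ IsTypeA f 1 p) :
    -- the action of the full automorphism group is linearizable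
    IsLinearizable (hypersurface f) (aut f) ∧
    -- if no singular point is fixed, the singularity type is `2A_2 + 4A_1` or `2A_3 + 4A_1`
    ((∀ p ∈ singularPoints f, ∃ g ∈ aut f, g • p ≠ p) →
      HasType2Am4A1 f 2 ∨ HasType2Am4A1 f 3) ∧
    -- the invariant plane and the invariant line
    (HasType2Am4A1 f 2 ∨ HasType2Am4A1 f 3 →
      Module.finrank k (linearSpan (nodes f)) = 3 ∧
      (nonNodes f).ncard = 2 ∧
      Module.finrank k (linearSpan (nonNodes f)) = 2 ∧
      projSubspace (linearSpan (nodes f)) ⊆ hypersurface f ∧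
      projSubspace (linearSpan (nonNodes f)) ⊆ hypersurface f ∧
      Disjoint (projSubspace (linearSpan (nodes f))) (projSubspace (linearSpan (nonNodes f))) ∧
      (∀ g ∈ aut f, g • projSubspace (linearSpan (nodes f)) =
        projSubspace (linearSpan (nodes f))) ∧
      (∀ g ∈ aut f, g • projSubspace (linearSpan (nonNodes f)) =
        projSubspace (linearSpan (nonNodes f)))) := by
  obtain ⟨v, hv⟩ := exists_isSixSingular hf hsing
  refine ⟨?_, fun hmove => ?_, fun ht => ?_⟩
  · by_cases hmove : ∀ p ∈ singularPoints f, ∃ g ∈ aut f, g • p ≠ p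
    · obtain ⟨w, hw⟩ := exists_isBidegenerate_of_not_fixed hf hv hA hmove
      exact hw.isLinearizable hf
    · push Not at hmove
      obtain ⟨p, hp, hfix⟩ := hmove
      obtain ⟨i, rfl⟩ := hv.exists_point_eq hf hp
      exact isLinearizable_of_point_fixed hf hv hfix
  · obtain ⟨w, hw⟩ := exists_isBidegenerate_of_not_fixed hf hv hA hmove
    exact hw.hasType_of_smul_ne hf hsing (hmove _ (hw.point_mem hf 0))
  · obtain ⟨w, hw⟩ : ∃ w, IsBidegenerate (polarForm f) w := by
      rcases ht with ht | ht
      · exact exists_isBidegenerate_of_hasType hf hv le_rfl ht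
      · exact exists_isBidegenerate_of_hasType hf hv (by norm_num) ht
    have hsim := fun A hA => exists_polarForm_smul hf hw.toIsSixSingular (A := A) hA
    rw [hw.linearSpan_nodes hf, hw.linearSpan_nonNodes hf]
    refine ⟨IsSixSingular.finrank_span_triple hw.linearIndependent_plane, hw.ncard_nonNodes hf, ?_,
      projSubspace_subset_hypersurface hf fun x hx => hw.apply_plane hx hx hx,
      projSubspace_subset_hypersurface hf fun x hx => hw.apply_line hx,
      disjoint_projSubspace fun x hx hx' => hw.disjoint_plane_line hx hx',
      fun g hg => smul_projSubspace_eq (fun A hA x hx => ?_) hg,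
      fun g hg => smul_projSubspace_eq (fun A hA x hx => ?_) hg⟩
    · have := finrank_span_eq_card (hw.indep 0 1 (by decide))
      rwa [Matrix.range_cons, Matrix.range_cons, Matrix.range_empty, Set.union_empty,
        Set.singleton_union] at this
    · obtain ⟨c, hc, hcA⟩ := hsim A hA
      exact hw.smul_mem_plane hc hcA hx
    · obtain ⟨c, hc, hcA⟩ := hsim A hA
      exact hw.smul_mem_line hc hcA hx
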